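/- Let $\mathbb K$ be an algebraically closed field of characteristic zero. **Data.** Let $I=\{1,\dots,r\}$, let $A=(A_{ij})_{i,j\in I}$ be an invertible symmetrisable generalised Cartan matrix, and let $\mathfrak g=\mathfrak g(A)$ be the Kac–Moody algebra with Chevalley generators $e_i,f_i,h_i$ ($i\in I$; $[h_i,e_j]=A_{ij}e_j$) and Cartan subalgebra $\mathfrak h=\langle h_i\rangle_{i\in I}$. Let $\epsilon_i\in\mathbb K$ ($i\in I$) be nonzero numbers such that $D^{-1}A$ is symmetric, where $D=\mathrm{diag}(\epsilon_i)$, and let $\kappa$ be the invariant symmetric bilinear form on $\mathfrak g$ with $\kappa(e_i,f_j)=\delta_{ij}\epsilon_j$; thus $\kappa(h_i,h_j)=A_{ij}\epsilon_j$. Let $(-,-)$ be the form on $\mathfrak h^*$ induced by $\kappa$. Let $\lambda=\sum_i\lambda_i\Lambda_i$ be a dominant integral weight ($\lambda_i\in\mathbb Z_{\ge0}$; $\Lambda_i$ the fundamental weights, $\Lambda_i(h_j)=\delta_{ij}$), and for $\mu=\sum_i\mu_i\Lambda_i$ put $\mu^{\blacktriangle}=\sum_i\epsilon_i^{-1}\mu_i\Lambda_i$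 and $\mu^{\blacktriangledown}=\sum_i\epsilon_i\mu_i\Lambda_i$. Put $J=\{j\in I:\lambda_j\ne0\}$ and $K=\{k\in I:\lambda_k=0\}$. Let $B=(B_{ij})_{i,j\in\{0\}\cup I}$ be given by $$B_{00}=0,\quad B_{i0}=-\lambda_i,\quad B_{0j}=-\epsilon_j^{-1}\lambda_j,\quad B_{ij}=A_{ij}\qquad(i,j\in I),$$ and assume that $B$ is invertible. A weight $\mu$ of $\mathfrak g$ is *pseudo-minuscule* if it is dominant integral and $(\mu^{\blacktriangledown},\beta)\in\{0,1\}$ for every positive root $\beta$ of $\mathfrak g$. **The algebra $\mathscr B$.** Let $\tilde{\mathscr B}$ be the Lie superalgebra generated by $e_i,f_i,h_i$ ($i\in\{0\}\cup I$), where $e_0,f_0$ are odd and the other generators even, modulo $[h_i,e_j]=B_{ij}e_j$, $[h_i,f_j]=-B_{ij}f_j$, $[e_i,f_j]=\delta_{ij}h_j$, and let $\mathscr B$ be its quotient by the maximal graded ideal intersecting the local part trivially, for the $\mathbb Z$-grading with $\deg e_i=1=-\deg f_i$ for all $i\in\{0\}\cup I$. From now on $\mathscr B$ carries the consistent $\mathbb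 Z$-grading, in which $\deg e_0=1=-\deg f_0$ and all other generators have degree $0$. Let $\llbracket-,-\rrbracket$ be its bracket, $L=\sum_{i}(B^{-1})_{0i}h_i$ its grading element, and $\langle-|-\rangle$ the invariant bilinear form on $\mathscr B$ with $\mathbb Z_2$-graded symmetry that extends $\kappa$ and satisfies $\langle e_0|f_0\rangle=-\langle f_0|e_0\rangle=1$. **The cartanification $\mathscr B^W$.** Consider the vector space $\mathscr B^{\ell}=\mathscr B_{-1}U(\mathscr B_0)\oplus U(\mathscr B_0)\oplus\mathscr B_1U(\mathscr B_0)$, where $\mathscr B_{\pm1}U(\mathscr B_0)=\mathscr B_{\pm1}\otimes U(\mathscr B_0)$ is a $U(\mathscr B_0)$-bimodule with $zx=xz+\llbracket z,x\rrbracket$ for $z\in\mathscr B_0$, $x\in\mathscr B_{\pm1}$. Products of elements of opposite degrees $\pm1$ are determined by $(Xx)(yY)=X(xy)Y$ for $X,Y\in U(\mathscr B_0)$ and $$x_{-1}y_1=-\llbracket y_1,x_{-1}\rrbracket+\langle x_{-1}|y_1\rangle L,\qquad x_1y_{-1}=\llbracket y_{-1},x_1\rrbracket+\langle x_1|y_{-1}\rangle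 L+\langle x_1|y_{-1}\rangle$$ for $x_{\pm1},y_{\pm1}\in\mathscr B_{\pm1}$. With the supercommutator as the bracket, $\mathscr B^{\ell}$ is a local Lie superalgebra. From its subalgebra generated by $\mathscr B_{-1}\mathscr B_0$ and $\mathscr B_1$, factor out the maximal ideal intersecting the subspace of degree $0$ trivially. The *cartanification* $\mathscr B^W$ of $\mathscr B$ is the minimal $\mathbb Z$-graded Lie superalgebra with the resulting local part. **The algebra $W$.** Let $\tilde W$ be the Lie superalgebra generated by $e_i,h_i$ ($i\in\{0\}\cup I$), $f_i$ ($i\in I$) and $f_{0i}$ ($i\in\{0\}\cup K$), where $e_0$ and the $f_{0i}$ are odd and the other generators even, modulo the relations $$[e_i,f_j]=\delta_{ij}h_j,\quad [h_i,f_j]=-B_{ij}f_j,\quad [h_i,e_j]=B_{ij}e_j,\quad [e_0,f_{0i}]=h_i,\quad [h_i,f_{0j}]=-B_{i0}f_{0j},$$ $$(\mathrm{ad}\,e_i)^{1-B_{ij}}(e_j)=(\mathrm{ad}\,f_i)^{1-B_{ij}}(f_j)=0$$ for all indices $i,j\in\{0\}\cup I$ for which the generators involved are defined and, in the last line, $1-B_{ij}$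 is a non-negative integer, and moreover, for all $i\in\{0\}\cup K$, $j\in J$ and $k,l\in K$, $$[e_k,[f_l,f_{0i}]]=\delta_{kl}B_{il}f_{0k},\qquad(\mathrm{ad}\,f_j)^{1-B_{j0}}(f_{0i})=[e_j,f_{0i}]=0,$$ $$[e_k,[e_k,f_{0i}]]=[f_k,[f_k,f_{0i}]]=0,\qquad[e_j,[e_k,f_{0i}]]=0.$$ Give $\tilde W$ the consistent $\mathbb Z$-grading in which $\deg e_0=1$, $\deg f_{0i}=-1$ and all other generators have degree $0$. The tensor hierarchy algebra $W$ is the quotient of $\tilde W$ by the maximal graded ideal intersecting the local part trivially. **Proposition.** Assume that $\lambda^{\blacktriangle}$ is pseudo-minuscule. Then there is a (unique) homomorphism $\phi$ of local Lie superalgebras from the local part of $W$ to the local part of $\mathscr B^W$ such that $$\phi(f_{0i})=f_0h_i\ \ (i\in\{0\}\cup K),\qquad \phi(e_i)=e_i,\ \ \phi(h_i)=h_i\ \ (i\in\{0\}\cup I),\qquad\phi(f_i)=f_i\ \ (i\in I).$$ Moreover, all the defining relations of $\tilde W$ listed above hold in $\mathscr B^W$ when $f_{0i}$ is replaced by $f_0h_i$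 and the other generators by the elements of $\mathscr B^W$ with the same names. -/

import Mathlib

open scoped TensorProduct

set_option linter.unusedSectionVars false
set_option linter.unnecessarySeqFocus false

universe u

noncomputable section

namespace Cartanification

/-! ### Algebras given by generators and relations

The product of a (not necessarily associative) algebra plays the role of the bracket of a
Lie superalgebra. -/

/-- A bilinear map that is compatible with submodules descends to the quotients. -/
def quotMap₂ {𝕂 A B C : Type*} [Field 𝕂] [AddCommGroup A] [Module 𝕂 A] [AddCommGroup B]
    [Module 𝕂 B] [AddCommGroup C] [Module 𝕂 C] (f : A →ₗ[𝕂] B →ₗ[𝕂] C)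
    (p : Submodule 𝕂 A) (q : Submodule 𝕂 B) (s : Submodule 𝕂 C)
    (hp : ∀ a ∈ p, ∀ b, f a b ∈ s) (hq : ∀ a, ∀ b ∈ q, f a b ∈ s) :
    (A ⧸ p) →ₗ[𝕂] (B ⧸ q) →ₗ[𝕂] (C ⧸ s) :=
  p.liftQ
    { toFun := fun a => q.mapQ s (f a) (fun b hb => hq a b hb)
      map_add' := fun a a' => by
        ext b; simp
      map_smul' := fun c a => by
        ext b; simp }
    (fun a ha => by
      rw [LinearMap.mem_ker]
      ext b
      simpa using hp a ha b)

@[simp] theorem quotMap₂_mk {𝕂 A B C : Type*} [Field 𝕂] [AddCommGroup A] [Module 𝕂 A]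
    [AddCommGroup B] [Module 𝕂 B] [AddCommGroup C] [Module 𝕂 C] (f : A →ₗ[𝕂] B →ₗ[𝕂] C)
    (p : Submodule 𝕂 A) (q : Submodule 𝕂 B) (s : Submodule 𝕂 C)
    (hp : ∀ a ∈ p, ∀ b, f a b ∈ s) (hq : ∀ a, ∀ b ∈ q, f a b ∈ s) (a : A) (b : B) :
    quotMap₂ f p q s hp hq (Submodule.Quotient.mk a) (Submodule.Quotient.mk b) =
      Submodule.Quotient.mk (f a b) := rfl

section Free

variable (𝕂 : Type u) [Field 𝕂] {X : Type u}

/-- The free non-unital non-associative algebra on `X`. -/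
abbrev FreeNA (X : Type u) := FreeNonUnitalNonAssocAlgebra 𝕂 X

/-- A generator, as an element of the free algebra. -/
abbrev gen (x : X) : FreeNA 𝕂 X := FreeNonUnitalNonAssocAlgebra.of 𝕂 x

/-- A bracket monomial, as an element of the free algebra. -/
def mon (m : FreeMagma X) : FreeNA 𝕂 X := MonoidAlgebra.ofMagma 𝕂 (FreeMagma X) m

theorem mon_mul (m n : FreeMagma X) : mon 𝕂 (m * n) = mon 𝕂 m * mon 𝕂 n :=
  map_mul (MonoidAlgebra.ofMagma 𝕂 (FreeMagma X)) m n

theorem gen_eq_mon (x : X) : gen 𝕂 x = mon 𝕂 (FreeMagma.of x) := rfl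

theorem span_mon : Submodule.span 𝕂 (Set.range (mon 𝕂 : FreeMagma X → FreeNA 𝕂 X)) = ⊤ := by
  rw [eq_top_iff]
  rintro x -
  induction x using MonoidAlgebra.induction_linear with
  | zero => exact Submodule.zero_mem _
  | add f g hf hg => exact Submodule.add_mem _ hf hg
  | single m c =>
    have : MonoidAlgebra.single m c = c • mon 𝕂 m := by
      simp [mon, MonoidAlgebra.ofMagma_apply]
    rw [this]
    exact Submodule.smul_mem _ _ (Submodule.subset_span ⟨m, rfl⟩)

/-- The total degree of a monomial, for a degree function on the generators. -/
def mdeg {G : Type*} [Add G] (w : X → G) : FreeMagma X → G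
  | .of x => w x
  | .mul a b => mdeg w a + mdeg w b

@[simp] theorem mdeg_of {G : Type*} [Add G] (w : X → G) (x : X) :
    mdeg w (FreeMagma.of x) = w x := rfl

@[simp] theorem mdeg_mul {G : Type*} [Add G] (w : X → G) (a b : FreeMagma X) :
    mdeg w (a * b) = mdeg w a + mdeg w b := rfl

/-- The sign `(-1)^{ab}` for parities `a` and `b`. -/
def sgn (a b : ZMod 2) : 𝕂 := if a = 1 ∧ b = 1 then -1 else 1

/-- The laws of a Lie superalgebra, for generators of parity `p`: super-antisymmetry and the
super-Jacobi identity on bracket monomials (which span the free algebra). -/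
inductive SuperRel (p : X → ZMod 2) : FreeNA 𝕂 X → Prop
  | anti (a b : FreeMagma X) :
      SuperRel p (mon 𝕂 a * mon 𝕂 b + sgn 𝕂 (mdeg p a) (mdeg p b) • (mon 𝕂 b * mon 𝕂 a))
  | jacobi (a b c : FreeMagma X) :
      SuperRel p (mon 𝕂 a * (mon 𝕂 b * mon 𝕂 c) - ((mon 𝕂 a * mon 𝕂 b) * mon 𝕂 c
        + sgn 𝕂 (mdeg p a) (mdeg p b) • (mon 𝕂 b * (mon 𝕂 a * mon 𝕂 c))))

/-- Two-sided ideals (as submodules) of a non-associative algebra. -/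
def IsIdeal {𝕂 A : Type*} [Field 𝕂] [NonUnitalNonAssocRing A] [Module 𝕂 A]
    (J : Submodule 𝕂 A) : Prop :=
  ∀ x y : A, y ∈ J → x * y ∈ J ∧ y * x ∈ J

variable (X) in
/-- An ideal of the free algebra on `X`; it stands for the algebra generated by `X` modulo the
relations in the ideal. -/
structure Presentation where
  ideal : Submodule 𝕂 (FreeNA 𝕂 X)
  isIdeal : IsIdeal ideal

variable {𝕂}

/-- The smallest ideal containing a set of relators. -/
def Presentation.span (S : Set (FreeNA 𝕂 X)) : Presentation 𝕂 X where
  ideal := sInf {J | IsIdeal J ∧ S ⊆ J}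
  isIdeal x y hy := by
    simp only [Submodule.mem_sInf, Set.mem_ofPred_eq] at hy ⊢
    exact ⟨fun J hJ => (hJ.1 x y (hy J hJ)).1, fun J hJ => (hJ.1 x y (hy J hJ)).2⟩

theorem Presentation.subset_span (S : Set (FreeNA 𝕂 X)) :
    S ⊆ ((Presentation.span S).ideal : Set (FreeNA 𝕂 X)) := by
  intro x hx
  simp only [Presentation.span, SetLike.mem_coe, Submodule.mem_sInf, Set.mem_ofPred_eq]
  exact fun J hJ => hJ.2 hx

/-- The Lie superalgebra generated by `X`, with parities `p`, modulo the relators in `R`. -/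
def superPresentation (p : X → ZMod 2) (R : FreeNA 𝕂 X → Prop) : Presentation 𝕂 X :=
  Presentation.span {x | SuperRel 𝕂 p x ∨ R x}

namespace Presentation

variable (P : Presentation 𝕂 X)

/-- The presented algebra. -/
def Alg : Type u := FreeNA 𝕂 X ⧸ P.ideal

instance : AddCommGroup P.Alg := inferInstanceAs (AddCommGroup (FreeNA 𝕂 X ⧸ P.ideal))
instance : Module 𝕂 P.Alg := inferInstanceAs (Module 𝕂 (FreeNA 𝕂 X ⧸ P.ideal))

/-- The bracket on the presented algebra. -/
def bracket : P.Alg →ₗ[𝕂] P.Alg →ₗ[𝕂] P.Alg :=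
  quotMap₂ (LinearMap.mul 𝕂 (FreeNA 𝕂 X)) P.ideal P.ideal P.ideal
    (fun a ha b => (P.isIdeal b a ha).2) (fun a b hb => (P.isIdeal a b hb).1)

instance : NonUnitalNonAssocRing P.Alg :=
  { (inferInstance : AddCommGroup P.Alg) with
    mul := fun x y => P.bracket x y
    left_distrib := fun a b c => map_add (P.bracket a) b c
    right_distrib := fun a b c => LinearMap.map_add₂ P.bracket a b c
    zero_mul := fun a => LinearMap.map_zero₂ P.bracket a
    mul_zero := fun a => map_zero (P.bracket a) }

theorem mul_def (x y : P.Alg) : x * y = P.bracket x y := rfl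

instance : IsScalarTower 𝕂 P.Alg P.Alg := ⟨fun c x y => LinearMap.map_smul₂ P.bracket c x y⟩
instance : SMulCommClass 𝕂 P.Alg P.Alg := ⟨fun c x y => ((P.bracket x).map_smul c y).symm⟩

/-- The quotient map from the free algebra. -/
def proj : FreeNA 𝕂 X →ₗ[𝕂] P.Alg := P.ideal.mkQ

theorem proj_mul (x y : FreeNA 𝕂 X) : P.proj (x * y) = P.proj x * P.proj y := rfl

theorem proj_surjective : Function.Surjective P.proj := P.ideal.mkQ_surjective

theorem proj_eq_zero {x : FreeNA 𝕂 X} : P.proj x = 0 ↔ x ∈ P.ideal :=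
  Submodule.Quotient.mk_eq_zero P.ideal

/-- The component of degree `n` of the presented algebra, for a degree function `w` on the
generators: the span of the bracket monomials of total degree `n`. -/
def comp {G : Type*} [Add G] (w : X → G) (n : G) : Submodule 𝕂 P.Alg :=
  Submodule.span 𝕂 {x | ∃ m : FreeMagma X, mdeg w m = n ∧ P.proj (mon 𝕂 m) = x}

theorem gen_mem {G : Type*} [Add G] (w : X → G) (x : X) {n : G} (h : w x = n) :
    P.proj (gen 𝕂 x) ∈ P.comp w n := Submodule.subset_span ⟨FreeMagma.of x, h, rfl⟩

theorem mul_mem {G : Type*} [Add G] (w : X → G) {k l n : G} (h : k + l = n) {x y : P.Alg}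
    (hx : x ∈ P.comp w k) (hy : y ∈ P.comp w l) : x * y ∈ P.comp w n := by
  induction hx using Submodule.span_induction with
  | zero => simp
  | add a b _ _ ha hb => rw [add_mul]; exact Submodule.add_mem _ ha hb
  | smul c a _ ha => rw [smul_mul_assoc]; exact Submodule.smul_mem _ _ ha
  | mem a ha =>
    obtain ⟨m, hm, rfl⟩ := ha
    induction hy using Submodule.span_induction with
    | zero => simp
    | add a b _ _ ha hb => rw [mul_add]; exact Submodule.add_mem _ ha hb
    | smul c a _ ha => rw [mul_smul_comm]; exact Submodule.smul_mem _ _ ha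
    | mem a ha =>
      obtain ⟨m', hm', rfl⟩ := ha
      exact Submodule.subset_span ⟨m * m', by simp [hm, hm', h], by rw [mon_mul, proj_mul]⟩

@[elab_as_elim] theorem alg_induction {Q : P.Alg → Prop} (x : P.Alg) (hm : ∀ m, Q (P.proj (mon 𝕂 m)))
    (h0 : Q 0) (ha : ∀ x y, Q x → Q y → Q (x + y)) (hs : ∀ (c : 𝕂) x, Q x → Q (c • x)) : Q x := by
  obtain ⟨x, rfl⟩ := P.proj_surjective x
  have hx : x ∈ Submodule.span 𝕂 (Set.range (mon 𝕂 : FreeMagma X → FreeNA 𝕂 X)) := by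
    rw [span_mon]; trivial
  induction hx using Submodule.span_induction with
  | zero => simpa using h0
  | add a b _ _ ha' hb' => rw [map_add]; exact ha _ _ ha' hb'
  | smul c a _ ha' => rw [map_smul]; exact hs _ _ ha'
  | mem a ha' => obtain ⟨m, rfl⟩ := ha'; exact hm m

/-- The sum of all ideals of the presented algebra that are graded with respect to the degree
function `w` and intersect the local part (degrees `-1`, `0` and `1`) trivially. -/
def maxIdeal (w : X → ℤ) : Submodule 𝕂 P.Alg :=
  sSup {N | IsIdeal N ∧ N ≤ ⨆ n : ℤ, N ⊓ P.comp w n ∧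
    N ⊓ (P.comp w (-1) ⊔ P.comp w 0 ⊔ P.comp w 1) = ⊥}

theorem maxIdeal_isIdeal (w : X → ℤ) : IsIdeal (P.maxIdeal w) := by
  intro x y hy
  constructor
  · have : P.maxIdeal w ≤ (P.maxIdeal w).comap (LinearMap.mulLeft 𝕂 x) :=
      sSup_le fun N hN z hz => Submodule.mem_sSup_of_mem hN (hN.1 x z hz).1
    exact this hy
  · have : P.maxIdeal w ≤ (P.maxIdeal w).comap (LinearMap.mulRight 𝕂 x) :=
      sSup_le fun N hN z hz => Submodule.mem_sSup_of_mem hN (hN.1 x z hz).2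
    exact this hy

/-- The quotient of the presented algebra by the maximal graded ideal intersecting the local part
trivially, presented by the preimage of that ideal in the free algebra. -/
def minimal (w : X → ℤ) : Presentation 𝕂 X where
  ideal := (P.maxIdeal w).comap P.proj
  isIdeal x y hy := by
    have := P.maxIdeal_isIdeal w (P.proj x) (P.proj y) hy
    exact ⟨this.1, this.2⟩

theorem le_minimal (w : X → ℤ) : P.ideal ≤ (P.minimal w).ideal := by
  intro x hx
  have : P.proj x = 0 := P.proj_eq_zero.2 hx
  simp [minimal, this]

/-- The presented algebra is a Lie superalgebra, the generators having parity `p`. -/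
def IsSuper (p : X → ZMod 2) : Prop := ∀ x, SuperRel 𝕂 p x → x ∈ P.ideal

end Presentation

theorem superPresentation_isSuper (p : X → ZMod 2) (R : FreeNA 𝕂 X → Prop) :
    (superPresentation p R).IsSuper p := fun _ hx => Presentation.subset_span _ (Or.inl hx)

theorem superPresentation_rel (p : X → ZMod 2) (R : FreeNA 𝕂 X → Prop) {x : FreeNA 𝕂 X}
    (hx : R x) : (superPresentation p R).proj x = 0 :=
  (Presentation.proj_eq_zero _).2 (Presentation.subset_span _ (Or.inr hx))

theorem Presentation.minimal_isSuper {P : Presentation 𝕂 X} {p : X → ZMod 2} (h : P.IsSuper p)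
    (w : X → ℤ) : (P.minimal w).IsSuper p := fun x hx => P.le_minimal w (h x hx)

/-- The degree function `w` is consistent with the parity `p`. -/
def Consistent (p : X → ZMod 2) (w : X → ℤ) : Prop := ∀ x, p x = (w x : ZMod 2)

theorem Consistent.mdeg {p : X → ZMod 2} {w : X → ℤ} (h : Consistent p w) (m : FreeMagma X) :
    Cartanification.mdeg p m = ((Cartanification.mdeg w m : ℤ) : ZMod 2) := by
  induction m using FreeMagma.rec with
  | of x => exact h x
  | mul a b ha hb =>
    change Cartanification.mdeg p a + Cartanification.mdeg p b = _
    rw [ha, hb]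
    exact (Int.cast_add _ _).symm

namespace Presentation

variable {P : Presentation 𝕂 X} {p : X → ZMod 2} {w : X → ℤ}

theorem anti_zero (h : P.IsSuper p) (hw : Consistent p w) {z : P.Alg} (hz : z ∈ P.comp w 0)
    (x : P.Alg) : z * x = -(x * z) := by
  induction hz using Submodule.span_induction with
  | zero => simp
  | add a b _ _ ha hb => rw [add_mul, mul_add, ha, hb]; abel
  | smul c a _ ha => rw [smul_mul_assoc, mul_smul_comm, ha, smul_neg]
  | mem a ha =>
    obtain ⟨m, hm, rfl⟩ := ha
    refine P.alg_induction x (fun n => ?_) ?_ (fun x y hx hy => ?_) (fun c x hx => ?_)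
    · have := P.proj_eq_zero.2 (h _ (SuperRel.anti m n))
      rw [hw.mdeg m, hm] at this
      simp only [sgn, Int.cast_zero, zero_ne_one, false_and, if_false, one_smul, map_add,
        proj_mul] at this
      exact eq_neg_of_add_eq_zero_left this
    · simp
    · rw [add_mul, mul_add, hx, hy]; abel
    · rw [smul_mul_assoc, mul_smul_comm, hx, smul_neg]

theorem jacobi_zero (h : P.IsSuper p) (hw : Consistent p w) {z : P.Alg} (hz : z ∈ P.comp w 0)
    (x y : P.Alg) : z * (x * y) = (z * x) * y + x * (z * y) := by
  induction hz using Submodule.span_induction with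
  | zero => simp
  | add a b _ _ ha hb => simp only [add_mul, mul_add, ha, hb]; abel
  | smul c a _ ha => simp only [smul_mul_assoc, mul_smul_comm, ha, smul_add]
  | mem a ha =>
    obtain ⟨m, hm, rfl⟩ := ha
    refine P.alg_induction x (fun n => ?_) ?_ (fun x y hx hy => ?_) (fun c x hx => ?_)
    · refine P.alg_induction y (fun k => ?_) ?_ (fun x y hx hy => ?_) (fun c x hx => ?_)
      · have := P.proj_eq_zero.2 (h _ (SuperRel.jacobi m n k))
        rw [hw.mdeg m, hm] at this
        simp only [sgn, Int.cast_zero, zero_ne_one, false_and, if_false, one_smul, map_add,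
          map_sub, proj_mul] at this
        exact sub_eq_zero.1 this
      · simp
      · simp only [mul_add, hx, hy]; abel
      · simp only [mul_smul_comm, hx, smul_add]
    · simp
    · simp only [add_mul, mul_add, hx, hy]; abel
    · simp only [smul_mul_assoc, mul_smul_comm, hx, smul_add]

/-- The bracket between two homogeneous components. -/
def compMul (P : Presentation 𝕂 X) (w : X → ℤ) {k l n : ℤ} (h : k + l = n) :
    P.comp w k →ₗ[𝕂] P.comp w l →ₗ[𝕂] P.comp w n :=
  LinearMap.mk₂ 𝕂 (fun x y => ⟨x.1 * y.1, P.mul_mem w h x.2 y.2⟩)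
    (fun _ _ _ => Subtype.ext (add_mul _ _ _)) (fun _ _ _ => Subtype.ext (smul_mul_assoc _ _ _))
    (fun _ _ _ => Subtype.ext (mul_add _ _ _)) (fun _ _ _ => Subtype.ext (mul_smul_comm _ _ _))

@[simp] theorem compMul_coe (P : Presentation 𝕂 X) (w : X → ℤ) {k l n : ℤ} (h : k + l = n)
    (x : P.comp w k) (y : P.comp w l) : (P.compMul w h x y : P.Alg) = x.1 * y.1 := rfl

end Presentation

end Free

/-! ### Local Lie superalgebras -/

/-- A local Lie superalgebra `G₋₁ ⊕ G₀ ⊕ G₁` with a consistent `ℤ`-grading: `G₀` is even and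
`G₋₁`, `G₁` are odd. The brackets are defined whenever the degrees add up to `-1`, `0` or `1`;
the remaining ones are determined by super-antisymmetry, namely `⟦x, z⟧ = -⟦z, x⟧` if `z` is
even and `⟦y, x⟧ = ⟦x, y⟧` if `x`, `y` are odd of opposite degrees. The laws are all instances of the
super-Jacobi identity in which every term is defined. -/
structure LocalLieSuperalgebra (𝕂 : Type u) [Field 𝕂] where
  Gm : Type u
  G0 : Type u
  Gp : Type u
  [acgm : AddCommGroup Gm]
  [acg0 : AddCommGroup G0]
  [acgp : AddCommGroup Gp]
  [modm : Module 𝕂 Gm]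
  [mod0 : Module 𝕂 G0]
  [modp : Module 𝕂 Gp]
  b00 : G0 →ₗ[𝕂] G0 →ₗ[𝕂] G0
  b0m : G0 →ₗ[𝕂] Gm →ₗ[𝕂] Gm
  b0p : G0 →ₗ[𝕂] Gp →ₗ[𝕂] Gp
  bpm : Gp →ₗ[𝕂] Gm →ₗ[𝕂] G0
  alt : ∀ z, b00 z z = 0
  jac00 : ∀ z t s, b00 z (b00 t s) = b00 (b00 z t) s + b00 t (b00 z s)
  jacm : ∀ z t x, b0m z (b0m t x) = b0m (b00 z t) x + b0m t (b0m z x)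
  jacp : ∀ z t y, b0p z (b0p t y) = b0p (b00 z t) y + b0p t (b0p z y)
  jacpm : ∀ z y x, b00 z (bpm y x) = bpm (b0p z y) x + bpm y (b0m z x)

attribute [instance] LocalLieSuperalgebra.acgm LocalLieSuperalgebra.acg0
  LocalLieSuperalgebra.acgp LocalLieSuperalgebra.modm LocalLieSuperalgebra.mod0
  LocalLieSuperalgebra.modp

/-- Homomorphisms of local Lie superalgebras: linear maps that preserve the degree and all the
brackets that are defined. -/
@[ext] structure LocalHom {𝕂 : Type u} [Field 𝕂] (G H : LocalLieSuperalgebra 𝕂) where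
  neg : G.Gm →ₗ[𝕂] H.Gm
  zero : G.G0 →ₗ[𝕂] H.G0
  pos : G.Gp →ₗ[𝕂] H.Gp
  map_b00 : ∀ z t, zero (G.b00 z t) = H.b00 (zero z) (zero t)
  map_b0m : ∀ z x, neg (G.b0m z x) = H.b0m (zero z) (neg x)
  map_b0p : ∀ z y, pos (G.b0p z y) = H.b0p (zero z) (pos y)
  map_bpm : ∀ y x, zero (G.bpm y x) = H.bpm (pos y) (neg x)

/-- The local part of a Lie superalgebra given by generators and relations, for a consistent
`ℤ`-grading. -/
def Presentation.localPart {𝕂 : Type u} [Field 𝕂] [CharZero 𝕂] {X : Type u}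
    (P : Presentation 𝕂 X) {p : X → ZMod 2} (h : P.IsSuper p) {w : X → ℤ}
    (hw : Consistent p w) : LocalLieSuperalgebra 𝕂 where
  Gm := P.comp w (-1)
  G0 := P.comp w 0
  Gp := P.comp w 1
  b00 := P.compMul w (by norm_num)
  b0m := P.compMul w (by norm_num)
  b0p := P.compMul w (by norm_num)
  bpm := P.compMul w (by norm_num)
  alt z := by
    apply Subtype.ext
    have h1 := Presentation.anti_zero h hw z.2 z.1
    have h2 : (2 : 𝕂) • (z.1 * z.1) = 0 := by rw [two_smul]; nth_rewrite 1 [h1]; simp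
    simpa using h2
  jac00 z t s := Subtype.ext (Presentation.jacobi_zero h hw z.2 t.1 s.1)
  jacm z t s := Subtype.ext (Presentation.jacobi_zero h hw z.2 t.1 s.1)
  jacp z t s := Subtype.ext (Presentation.jacobi_zero h hw z.2 t.1 s.1)
  jacpm z t s := Subtype.ext (Presentation.jacobi_zero h hw z.2 t.1 s.1)

/-! ### The local part of the algebra with restricted associativity -/

section Enveloping

attribute [local instance 100] LieRing.ofAssociativeRing

variable {𝕂 : Type u} [Field 𝕂] {g : Type u} [LieRing g] [LieAlgebra 𝕂 g]
  {V V' : Type u} [AddCommGroup V] [Module 𝕂 V] [AddCommGroup V'] [Module 𝕂 V']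

/-- The canonical map from a Lie algebra to its enveloping algebra. -/
def inU (𝕂 : Type u) [Field 𝕂] {g : Type u} [LieRing g] [LieAlgebra 𝕂 g] :
    g →ₗ[𝕂] UniversalEnvelopingAlgebra 𝕂 g :=
  (UniversalEnvelopingAlgebra.ι 𝕂 : g →ₗ⁅𝕂⁆ UniversalEnvelopingAlgebra 𝕂 g)

theorem inU_lie (z t : g) : inU 𝕂 ⁅z, t⁆ = inU 𝕂 z * inU 𝕂 t - inU 𝕂 t * inU 𝕂 z := by
  have := (UniversalEnvelopingAlgebra.ι 𝕂 : g →ₗ⁅𝕂⁆ UniversalEnvelopingAlgebra 𝕂 g).map_lie z t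
  rw [LieRing.of_associative_ring_bracket] at this
  exact this

theorem uea_induction {Q : UniversalEnvelopingAlgebra 𝕂 g → Prop}
    (hc : ∀ c : 𝕂, Q (algebraMap 𝕂 _ c)) (hi : ∀ z : g, Q (inU 𝕂 z))
    (ha : ∀ u v, Q u → Q v → Q (u + v)) (hm : ∀ u v, Q u → Q v → Q (u * v))
    (u : UniversalEnvelopingAlgebra 𝕂 g) : Q u := by
  let S : Subalgebra 𝕂 (UniversalEnvelopingAlgebra 𝕂 g) :=
    { carrier := {u | Q u}
      mul_mem' := fun {a b} => hm a b
      add_mem' := fun {a b} => ha a b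
      algebraMap_mem' := hc }
  let f : g →ₗ⁅𝕂⁆ S :=
    { toFun := fun z => ⟨inU 𝕂 z, hi z⟩
      map_add' := fun z t => Subtype.ext (map_add _ z t)
      map_smul' := fun c z => Subtype.ext (map_smul _ c z)
      map_lie' := fun {z t} => by
        apply Subtype.ext
        rw [LieRing.of_associative_ring_bracket]
        exact inU_lie z t }
  have h : S.val.comp (UniversalEnvelopingAlgebra.lift 𝕂 f) = AlgHom.id 𝕂 _ := by
    apply UniversalEnvelopingAlgebra.hom_ext
    ext z
    change S.val (UniversalEnvelopingAlgebra.lift 𝕂 f (UniversalEnvelopingAlgebra.ι 𝕂 z)) = _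
    rw [UniversalEnvelopingAlgebra.lift_ι_apply]
    rfl
  have h' := DFunLike.congr_fun h u
  have : S.val (UniversalEnvelopingAlgebra.lift 𝕂 f u) = u := h'
  rw [← this]
  exact (UniversalEnvelopingAlgebra.lift 𝕂 f u).2

/-- A representation of a Lie algebra, as a linear map. -/
def IsRep (a : g →ₗ[𝕂] Module.End 𝕂 V) : Prop := ∀ z t, a ⁅z, t⁆ = a z * a t - a t * a z

/-- In the algebra generated by `g` and `V` with `z x - x z = ⟦z, x⟧` for `z ∈ g` and `x ∈ V`, the
component of degree one in `V` is `V U(g) = V ⊗ U(g)`; this is left multiplication by `U(g)` on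
it, determined by `z (x u) = ⟦z, x⟧ u + x (z u)`. -/
def lact (a : g →ₗ[𝕂] Module.End 𝕂 V) (ha : IsRep a) :
    UniversalEnvelopingAlgebra 𝕂 g →ₐ[𝕂]
      Module.End 𝕂 (V ⊗[𝕂] UniversalEnvelopingAlgebra 𝕂 g) :=
  UniversalEnvelopingAlgebra.lift 𝕂
    { toFun := fun z => (a z).rTensor _ + (LinearMap.mulLeft 𝕂 (inU 𝕂 z)).lTensor V
      map_add' := fun z t => by
        ext x u
        simp [TensorProduct.tmul_add, add_mul]
        abel
      map_smul' := fun c z => by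
        ext x u
        simp [TensorProduct.smul_tmul']
      map_lie' := fun {z t} => by
        rw [LieRing.of_associative_ring_bracket]
        apply TensorProduct.ext'
        intro x u
        have := ha z t
        simp [this, inU_lie, TensorProduct.tmul_sub, sub_mul, mul_assoc]
        abel }

theorem lact_inU (a : g →ₗ[𝕂] Module.End 𝕂 V) (ha : IsRep a) (z : g) (x : V)
    (u : UniversalEnvelopingAlgebra 𝕂 g) :
    lact a ha (inU 𝕂 z) (x ⊗ₜ u) = (a z x) ⊗ₜ u + x ⊗ₜ (inU 𝕂 z * u) := by
  have : lact a ha (inU 𝕂 z) =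
      (a z).rTensor _ + (LinearMap.mulLeft 𝕂 (inU 𝕂 z)).lTensor V :=
    UniversalEnvelopingAlgebra.lift_ι_apply 𝕂 _ z
  rw [this]; simp

/-- Right multiplication by `U(g)` on `V U(g)`. -/
def ract (V : Type u) [AddCommGroup V] [Module 𝕂 V] :
    UniversalEnvelopingAlgebra 𝕂 g →ₗ[𝕂]
      Module.End 𝕂 (V ⊗[𝕂] UniversalEnvelopingAlgebra 𝕂 g) :=
  (LinearMap.lTensorHom V).comp (LinearMap.mul 𝕂 (UniversalEnvelopingAlgebra 𝕂 g)).flip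

@[simp] theorem ract_tmul (u v : UniversalEnvelopingAlgebra 𝕂 g) (x : V) :
    ract V u (x ⊗ₜ v) = x ⊗ₜ (v * u) := rfl

theorem ract_mul (u v : UniversalEnvelopingAlgebra 𝕂 g)
    (X : V ⊗[𝕂] UniversalEnvelopingAlgebra 𝕂 g) :
    ract V (u * v) X = ract V v (ract V u X) := by
  induction X using TensorProduct.induction_on with
  | zero => simp
  | add X Y hX hY => simp only [map_add, hX, hY]
  | tmul x w => simp [mul_assoc]

theorem lact_ract (a : g →ₗ[𝕂] Module.End 𝕂 V) (ha : IsRep a)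
    (u v : UniversalEnvelopingAlgebra 𝕂 g) (X : V ⊗[𝕂] UniversalEnvelopingAlgebra 𝕂 g) :
    lact a ha u (ract V v X) = ract V v (lact a ha u X) := by
  induction u using uea_induction generalizing X with
  | hc c => simp [Algebra.algebraMap_eq_smul_one]
  | hi z =>
    induction X using TensorProduct.induction_on with
    | zero => simp
    | add X Y hX hY => simp only [map_add, hX, hY]
    | tmul x w => simp [lact_inU, mul_assoc]
  | ha u w hu hw => simp only [map_add, LinearMap.add_apply, hu, hw]
  | hm u w hu hw => simp only [map_mul, Module.End.mul_apply, hu, hw]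

/-- The product `V U(g) × V' U(g) → U(g)` given by `(x u) (y v) = x (u (y v))`, where `u (y v)` is
computed by left multiplication on `V' U(g)`, and by `x (y v) = (x y) v`, where `x y = q x y`
is prescribed. -/
def prodU (a' : g →ₗ[𝕂] Module.End 𝕂 V') (ha' : IsRep a')
    (q : V →ₗ[𝕂] V' →ₗ[𝕂] UniversalEnvelopingAlgebra 𝕂 g) :
    (V ⊗[𝕂] UniversalEnvelopingAlgebra 𝕂 g) →ₗ[𝕂]
      (V' ⊗[𝕂] UniversalEnvelopingAlgebra 𝕂 g) →ₗ[𝕂] UniversalEnvelopingAlgebra 𝕂 g :=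
  TensorProduct.lift (LinearMap.mk₂ 𝕂
    (fun x u => (TensorProduct.lift
      ((LinearMap.mul 𝕂 (UniversalEnvelopingAlgebra 𝕂 g)).comp (q x))).comp (lact a' ha' u))
    (fun x x' u => by
      apply LinearMap.ext; intro Y
      simp only [LinearMap.comp_apply, LinearMap.add_apply]
      generalize lact a' ha' u Y = Z
      induction Z using TensorProduct.induction_on with
      | zero => simp
      | add X Y hX hY => simp only [map_add] at hX hY ⊢; rw [hX, hY]; abel
      | tmul y v => simp)
    (fun c x u => by
      apply LinearMap.ext; intro Y
      simp only [LinearMap.comp_apply, LinearMap.smul_apply]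
      generalize lact a' ha' u Y = Z
      induction Z using TensorProduct.induction_on with
      | zero => simp
      | add X Y hX hY => simp only [map_add, hX, hY, smul_add]
      | tmul y v => simp)
    (fun x u u' => by simp [LinearMap.comp_add])
    (fun c x u => by simp [LinearMap.comp_smul]))

variable {a : g →ₗ[𝕂] Module.End 𝕂 V} {ha : IsRep a} {a' : g →ₗ[𝕂] Module.End 𝕂 V'}
  {ha' : IsRep a'} {q : V →ₗ[𝕂] V' →ₗ[𝕂] UniversalEnvelopingAlgebra 𝕂 g}

theorem prodU_tmul (x : V) (u : UniversalEnvelopingAlgebra 𝕂 g)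
    (Y : V' ⊗[𝕂] UniversalEnvelopingAlgebra 𝕂 g) :
    prodU a' ha' q (x ⊗ₜ u) Y = prodU a' ha' q (x ⊗ₜ 1) (lact a' ha' u Y) := by
  simp [prodU]

theorem prodU_one_tmul (x : V) (y : V') (v : UniversalEnvelopingAlgebra 𝕂 g) :
    prodU a' ha' q (x ⊗ₜ 1) (y ⊗ₜ v) = q x y * v := by
  simp [prodU]

theorem prodU_ract (X : V ⊗[𝕂] UniversalEnvelopingAlgebra 𝕂 g)
    (Y : V' ⊗[𝕂] UniversalEnvelopingAlgebra 𝕂 g) (w : UniversalEnvelopingAlgebra 𝕂 g) :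
    prodU a' ha' q X (ract V' w Y) = prodU a' ha' q X Y * w := by
  induction X using TensorProduct.induction_on with
  | zero => simp
  | add X X' hX hX' => simp only [map_add, LinearMap.add_apply, hX, hX', add_mul]
  | tmul x u =>
    rw [prodU_tmul, prodU_tmul x u Y, lact_ract]
    generalize lact a' ha' u Y = Z
    induction Z using TensorProduct.induction_on with
    | zero => simp
    | add X Y hX hY => simp only [map_add, hX, hY, add_mul]
    | tmul y v => simp [prodU_one_tmul, mul_assoc]

theorem prodU_assoc (X : V ⊗[𝕂] UniversalEnvelopingAlgebra 𝕂 g)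
    (Y : V' ⊗[𝕂] UniversalEnvelopingAlgebra 𝕂 g) (w : UniversalEnvelopingAlgebra 𝕂 g) :
    prodU a' ha' q (ract V w X) Y = prodU a' ha' q X (lact a' ha' w Y) := by
  induction X using TensorProduct.induction_on with
  | zero => simp
  | add X X' hX hX' => simp only [map_add, LinearMap.add_apply, hX, hX']
  | tmul x u =>
    rw [ract_tmul, prodU_tmul, prodU_tmul x u, map_mul, Module.End.mul_apply]

theorem lact_prodU
    (hq : ∀ z x y, inU 𝕂 z * q x y - q x y * inU 𝕂 z = q (a z x) y + q x (a' z y))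
    (X : V ⊗[𝕂] UniversalEnvelopingAlgebra 𝕂 g)
    (Y : V' ⊗[𝕂] UniversalEnvelopingAlgebra 𝕂 g) (w : UniversalEnvelopingAlgebra 𝕂 g) :
    prodU a' ha' q (lact a ha w X) Y = w * prodU a' ha' q X Y := by
  induction w using uea_induction generalizing X with
  | hc c => simp [Algebra.algebraMap_eq_smul_one]
  | ha u w hu hw => simp only [map_add, LinearMap.add_apply, hu, hw, add_mul]
  | hm u w hu hw => simp only [map_mul, Module.End.mul_apply, hu, hw, mul_assoc]
  | hi z =>
    induction X using TensorProduct.induction_on with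
    | zero => simp
    | add X X' hX hX' => simp only [map_add, LinearMap.add_apply, hX, hX', mul_add]
    | tmul x u =>
      rw [lact_inU, map_add, LinearMap.add_apply, prodU_tmul, prodU_tmul x, prodU_tmul x u,
        map_mul, Module.End.mul_apply]
      generalize lact a' ha' u Y = Z
      induction Z using TensorProduct.induction_on with
      | zero => simp
      | add X Y hX hY =>
        simp only [map_add, mul_add, ← hX, ← hY]; abel
      | tmul y v =>
        rw [lact_inU, map_add]
        simp only [prodU_one_tmul]
        have := congrArg (· * v) (hq z x y)
        simp only [sub_mul, add_mul] at this
        rw [sub_eq_iff_eq_add] at this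
        rw [← mul_assoc, ← mul_assoc, this]
        abel

/-- The product is the one determined by `(X x) (y Y) = (X (x y)) Y` for `X, Y ∈ U(g)`. -/
theorem prodU_eq
    (hq : ∀ z x y, inU 𝕂 z * q x y - q x y * inU 𝕂 z = q (a z x) y + q x (a' z y))
    (x : V) (y : V') (u v : UniversalEnvelopingAlgebra 𝕂 g) :
    prodU a' ha' q (lact a ha u (x ⊗ₜ 1)) (y ⊗ₜ v) = u * q x y * v := by
  rw [lact_prodU hq, prodU_one_tmul, mul_assoc]

end Enveloping


namespace LocalLieSuperalgebra

variable {𝕂 : Type u} [Field 𝕂] (G : LocalLieSuperalgebra 𝕂)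

/-- The even part `G₀` is a Lie algebra. -/
instance : LieRing G.G0 where
  bracket z t := G.b00 z t
  add_lie z t s := LinearMap.map_add₂ G.b00 z t s
  lie_add z t s := map_add (G.b00 z) t s
  lie_self := G.alt
  leibniz_lie := G.jac00

instance : LieAlgebra 𝕂 G.G0 where
  lie_smul c z t := map_smul (G.b00 z) c t

theorem lie_def (z t : G.G0) : ⁅z, t⁆ = G.b00 z t := rfl

theorem isRep_m : IsRep (V := G.Gm) G.b0m := fun z t => by
  ext x; simp [lie_def, G.jacm z t x]

theorem isRep_p : IsRep (V := G.Gp) G.b0p := fun z t => by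
  ext x; simp [lie_def, G.jacp z t x]

/-- The enveloping algebra `U(G₀)`. -/
abbrev U : Type u := UniversalEnvelopingAlgebra 𝕂 G.G0

/-- Graded subspaces of a local Lie superalgebra that are closed under the bracket. -/
structure Sub where
  m : Submodule 𝕂 G.Gm
  z : Submodule 𝕂 G.G0
  p : Submodule 𝕂 G.Gp
  b00_mem : ∀ s ∈ z, ∀ t ∈ z, G.b00 s t ∈ z
  b0m_mem : ∀ s ∈ z, ∀ x ∈ m, G.b0m s x ∈ m
  b0p_mem : ∀ s ∈ z, ∀ y ∈ p, G.b0p s y ∈ p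
  bpm_mem : ∀ y ∈ p, ∀ x ∈ m, G.bpm y x ∈ z

variable {G}

/-- A subalgebra, as a local Lie superalgebra. -/
def Sub.toLocal (S : G.Sub) : LocalLieSuperalgebra 𝕂 where
  Gm := S.m
  G0 := S.z
  Gp := S.p
  b00 := LinearMap.mk₂ 𝕂 (fun s t => ⟨G.b00 s t, S.b00_mem s s.2 t t.2⟩)
    (by intros; ext; simp) (by intros; ext; simp) (by intros; ext; simp) (by intros; ext; simp)
  b0m := LinearMap.mk₂ 𝕂 (fun s t => ⟨G.b0m s t, S.b0m_mem s s.2 t t.2⟩)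
    (by intros; ext; simp) (by intros; ext; simp) (by intros; ext; simp) (by intros; ext; simp)
  b0p := LinearMap.mk₂ 𝕂 (fun s t => ⟨G.b0p s t, S.b0p_mem s s.2 t t.2⟩)
    (by intros; ext; simp) (by intros; ext; simp) (by intros; ext; simp) (by intros; ext; simp)
  bpm := LinearMap.mk₂ 𝕂 (fun s t => ⟨G.bpm s t, S.bpm_mem s s.2 t t.2⟩)
    (by intros; ext; simp) (by intros; ext; simp) (by intros; ext; simp) (by intros; ext; simp)
  alt s := Subtype.ext (G.alt s.1)
  jac00 z t s := Subtype.ext (G.jac00 z.1 t.1 s.1)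
  jacm z t s := Subtype.ext (G.jacm z.1 t.1 s.1)
  jacp z t s := Subtype.ext (G.jacp z.1 t.1 s.1)
  jacpm z t s := Subtype.ext (G.jacpm z.1 t.1 s.1)

/-- The subalgebra generated by sets of elements of degree `-1` and `1`: the intersection of all
subalgebras containing them. -/
def Sub.generated (A : Set G.Gm) (C : Set G.Gp) : G.Sub where
  m := sInf {N | ∃ T : G.Sub, A ⊆ T.m ∧ C ⊆ T.p ∧ T.m = N}
  z := sInf {N | ∃ T : G.Sub, A ⊆ T.m ∧ C ⊆ T.p ∧ T.z = N}
  p := sInf {N | ∃ T : G.Sub, A ⊆ T.m ∧ C ⊆ T.p ∧ T.p = N}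
  b00_mem s hs t ht := by
    simp only [Submodule.mem_sInf] at *
    rintro _ ⟨T, hA, hC, rfl⟩
    exact T.b00_mem s (hs _ ⟨T, hA, hC, rfl⟩) t (ht _ ⟨T, hA, hC, rfl⟩)
  b0m_mem s hs t ht := by
    simp only [Submodule.mem_sInf] at *
    rintro _ ⟨T, hA, hC, rfl⟩
    exact T.b0m_mem s (hs _ ⟨T, hA, hC, rfl⟩) t (ht _ ⟨T, hA, hC, rfl⟩)
  b0p_mem s hs t ht := by
    simp only [Submodule.mem_sInf] at *
    rintro _ ⟨T, hA, hC, rfl⟩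
    exact T.b0p_mem s (hs _ ⟨T, hA, hC, rfl⟩) t (ht _ ⟨T, hA, hC, rfl⟩)
  bpm_mem s hs t ht := by
    simp only [Submodule.mem_sInf] at *
    rintro _ ⟨T, hA, hC, rfl⟩
    exact T.bpm_mem s (hs _ ⟨T, hA, hC, rfl⟩) t (ht _ ⟨T, hA, hC, rfl⟩)

theorem Sub.generated_m {A : Set G.Gm} {C : Set G.Gp} {x : G.Gm} (hx : x ∈ A) :
    x ∈ (Sub.generated A C).m := by
  simp only [Sub.generated, Submodule.mem_sInf]
  rintro _ ⟨T, hA, -, rfl⟩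
  exact hA hx

theorem Sub.generated_p {A : Set G.Gm} {C : Set G.Gp} {x : G.Gp} (hx : x ∈ C) :
    x ∈ (Sub.generated A C).p := by
  simp only [Sub.generated, Submodule.mem_sInf]
  rintro _ ⟨T, -, hC, rfl⟩
  exact hC hx

variable (G)

/-- Graded ideals of a local Lie superalgebra. -/
structure LocalIdeal where
  m : Submodule 𝕂 G.Gm
  z : Submodule 𝕂 G.G0
  p : Submodule 𝕂 G.Gp
  b00_left : ∀ s ∈ z, ∀ t, G.b00 s t ∈ z
  b00_right : ∀ s, ∀ t ∈ z, G.b00 s t ∈ z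
  b0m_left : ∀ s ∈ z, ∀ x, G.b0m s x ∈ m
  b0m_right : ∀ s, ∀ x ∈ m, G.b0m s x ∈ m
  b0p_left : ∀ s ∈ z, ∀ y, G.b0p s y ∈ p
  b0p_right : ∀ s, ∀ y ∈ p, G.b0p s y ∈ p
  bpm_left : ∀ y ∈ p, ∀ x, G.bpm y x ∈ z
  bpm_right : ∀ y, ∀ x ∈ m, G.bpm y x ∈ z

variable {G}

/-- The quotient of a local Lie superalgebra by an ideal. -/
def LocalIdeal.quot (I : G.LocalIdeal) : LocalLieSuperalgebra 𝕂 where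
  Gm := G.Gm ⧸ I.m
  G0 := G.G0 ⧸ I.z
  Gp := G.Gp ⧸ I.p
  b00 := quotMap₂ G.b00 _ _ _ I.b00_left I.b00_right
  b0m := quotMap₂ G.b0m _ _ _ I.b0m_left I.b0m_right
  b0p := quotMap₂ G.b0p _ _ _ I.b0p_left I.b0p_right
  bpm := quotMap₂ G.bpm _ _ _ I.bpm_left I.bpm_right
  alt s := by
    obtain ⟨s, rfl⟩ := Submodule.Quotient.mk_surjective _ s
    simp [G.alt]
  jac00 z t s := by
    obtain ⟨z, rfl⟩ := Submodule.Quotient.mk_surjective _ z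
    obtain ⟨t, rfl⟩ := Submodule.Quotient.mk_surjective _ t
    obtain ⟨s, rfl⟩ := Submodule.Quotient.mk_surjective _ s
    simp only [quotMap₂_mk, G.jac00 z t s, Submodule.Quotient.mk_add]
  jacm z t s := by
    obtain ⟨z, rfl⟩ := Submodule.Quotient.mk_surjective _ z
    obtain ⟨t, rfl⟩ := Submodule.Quotient.mk_surjective _ t
    obtain ⟨s, rfl⟩ := Submodule.Quotient.mk_surjective _ s
    simp only [quotMap₂_mk, G.jacm z t s, Submodule.Quotient.mk_add]
  jacp z t s := by
    obtain ⟨z, rfl⟩ := Submodule.Quotient.mk_surjective _ z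
    obtain ⟨t, rfl⟩ := Submodule.Quotient.mk_surjective _ t
    obtain ⟨s, rfl⟩ := Submodule.Quotient.mk_surjective _ s
    simp only [quotMap₂_mk, G.jacp z t s, Submodule.Quotient.mk_add]
  jacpm z t s := by
    obtain ⟨z, rfl⟩ := Submodule.Quotient.mk_surjective _ z
    obtain ⟨t, rfl⟩ := Submodule.Quotient.mk_surjective _ t
    obtain ⟨s, rfl⟩ := Submodule.Quotient.mk_surjective _ s
    simp only [quotMap₂_mk, G.jacpm z t s, Submodule.Quotient.mk_add]

variable (G)

/-- The maximal peripheral ideal: the sum of all ideals intersecting `G₀` trivially. -/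
def maxPeripheral : G.LocalIdeal where
  m := sSup {N | ∃ I : G.LocalIdeal, I.z = ⊥ ∧ I.m = N}
  z := ⊥
  p := sSup {N | ∃ I : G.LocalIdeal, I.z = ⊥ ∧ I.p = N}
  b00_left s hs t := by
    rw [Submodule.mem_bot] at hs; subst hs; simp
  b00_right s t ht := by
    rw [Submodule.mem_bot] at ht; subst ht; simp
  b0m_left s hs x := by
    rw [Submodule.mem_bot] at hs; subst hs; simp
  b0m_right s := by
    change sSup {N | ∃ I : G.LocalIdeal, I.z = ⊥ ∧ I.m = N} ≤ Submodule.comap (G.b0m s) (sSup _)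
    refine sSup_le ?_
    rintro _ ⟨I, hI, rfl⟩ x hx
    have h : I.m ≤ sSup {N | ∃ I : G.LocalIdeal, I.z = ⊥ ∧ I.m = N} := le_sSup ⟨I, hI, rfl⟩
    exact h (I.b0m_right s x hx)
  b0p_left s hs x := by
    rw [Submodule.mem_bot] at hs; subst hs; simp
  b0p_right s := by
    change sSup {N | ∃ I : G.LocalIdeal, I.z = ⊥ ∧ I.p = N} ≤ Submodule.comap (G.b0p s) (sSup _)
    refine sSup_le ?_
    rintro _ ⟨I, hI, rfl⟩ x hx
    have h : I.p ≤ sSup {N | ∃ I : G.LocalIdeal, I.z = ⊥ ∧ I.p = N} := le_sSup ⟨I, hI, rfl⟩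
    exact h (I.b0p_right s x hx)
  bpm_left y hy x := by
    have : sSup {N | ∃ I : G.LocalIdeal, I.z = ⊥ ∧ I.p = N} ≤
        Submodule.comap (G.bpm.flip x) ⊥ := by
      refine sSup_le ?_
      rintro _ ⟨I, hI, rfl⟩ y hy
      rw [← hI]
      exact I.bpm_left y hy x
    exact this hy
  bpm_right y := by
    change sSup {N | ∃ I : G.LocalIdeal, I.z = ⊥ ∧ I.m = N} ≤ Submodule.comap (G.bpm y) ⊥
    refine sSup_le ?_
    rintro _ ⟨I, hI, rfl⟩ x hx
    rw [← hI]
    exact I.bpm_right y x hx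

/-- The elements of a local Lie superalgebra, as generators of a Lie superalgebra. -/
inductive Gen : Type u
  | m (x : G.Gm)
  | z (x : G.G0)
  | p (x : G.Gp)

/-- The degrees of the generators. -/
def Gen.deg : G.Gen → ℤ
  | .m _ => -1
  | .z _ => 0
  | .p _ => 1

/-- The parities of the generators. -/
def Gen.par (x : G.Gen) : ZMod 2 := (Gen.deg G x : ZMod 2)

/-- The relations of the maximal Lie superalgebra with local part `G`: those that hold in `G`. -/
inductive Gen.Rel : FreeNA 𝕂 G.Gen → Prop
  | add_m (x y : G.Gm) : Rel (gen 𝕂 (.m (x + y)) - (gen 𝕂 (.m x) + gen 𝕂 (.m y)))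
  | add_z (x y : G.G0) : Rel (gen 𝕂 (.z (x + y)) - (gen 𝕂 (.z x) + gen 𝕂 (.z y)))
  | add_p (x y : G.Gp) : Rel (gen 𝕂 (.p (x + y)) - (gen 𝕂 (.p x) + gen 𝕂 (.p y)))
  | smul_m (c : 𝕂) (x : G.Gm) : Rel (gen 𝕂 (.m (c • x)) - c • gen 𝕂 (.m x))
  | smul_z (c : 𝕂) (x : G.G0) : Rel (gen 𝕂 (.z (c • x)) - c • gen 𝕂 (.z x))
  | smul_p (c : 𝕂) (x : G.Gp) : Rel (gen 𝕂 (.p (c • x)) - c • gen 𝕂 (.p x))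
  | b00 (s t : G.G0) : Rel (gen 𝕂 (.z s) * gen 𝕂 (.z t) - gen 𝕂 (.z (G.b00 s t)))
  | b0m (s : G.G0) (x : G.Gm) : Rel (gen 𝕂 (.z s) * gen 𝕂 (.m x) - gen 𝕂 (.m (G.b0m s x)))
  | b0p (s : G.G0) (y : G.Gp) : Rel (gen 𝕂 (.z s) * gen 𝕂 (.p y) - gen 𝕂 (.p (G.b0p s y)))
  | bpm (y : G.Gp) (x : G.Gm) : Rel (gen 𝕂 (.p y) * gen 𝕂 (.m x) - gen 𝕂 (.z (G.bpm y x)))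

/-- The minimal `ℤ`-graded Lie superalgebra with local part `G`: the maximal one modulo the
maximal graded ideal intersecting the local part trivially. -/
def minimalExtension : Presentation 𝕂 G.Gen :=
  (superPresentation (Gen.par G) (Gen.Rel G)).minimal (Gen.deg G)

theorem minimalExtension_isSuper : G.minimalExtension.IsSuper (Gen.par G) :=
  Presentation.minimal_isSuper (superPresentation_isSuper _ _) _

/-- The local part of the minimal `ℤ`-graded Lie superalgebra with local part `G`. -/
def minimalExtensionLocal [CharZero 𝕂] : LocalLieSuperalgebra 𝕂 :=
  G.minimalExtension.localPart G.minimalExtension_isSuper (w := Gen.deg G) (fun _ => rfl)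

end LocalLieSuperalgebra

/-! ### Contragredient local Lie superalgebras and the cartanification -/

/-- A contragredient local Lie superalgebra (with a consistent `ℤ`-grading): a local Lie
superalgebra with a grading element `L` and an invariant bilinear map `⟨x | y⟩` for `x ∈ G₋₁` and
`y ∈ G₁`. In the invariance condition `⟨⟦x, z⟧ | y⟩ = ⟨x | ⟦z, y⟧⟩`, note `⟦x, z⟧ = -⟦z, x⟧`. -/
structure ContragredientLocal (𝕂 : Type u) [Field 𝕂] extends LocalLieSuperalgebra 𝕂 where
  L : G0
  form : Gm →ₗ[𝕂] Gp →ₗ[𝕂] 𝕂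
  grading_zero : ∀ z, b00 L z = 0
  grading_neg : ∀ x, b0m L x = -x
  grading_pos : ∀ y, b0p L y = y
  invariant : ∀ x z y, form (-b0m z x) y = form x (b0p z y)

namespace ContragredientLocal

variable {𝕂 : Type u} [Field 𝕂] (G : ContragredientLocal 𝕂)

/-- The products `x y = -⟦y, x⟧ + ⟨x | y⟩ L` for `x ∈ G₋₁` and `y ∈ G₁`. -/
def qmp : G.Gm →ₗ[𝕂] G.Gp →ₗ[𝕂] G.U :=
  -(G.bpm.flip.compr₂ (inU 𝕂)) + G.form.compr₂ (LinearMap.toSpanSingleton 𝕂 G.U (inU 𝕂 G.L))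

/-- The products `y x = ⟦x, y⟧ + ⟨y | x⟩ L + ⟨y | x⟩` for `x ∈ G₋₁` and `y ∈ G₁`, where
`⟨y | x⟩ = -⟨x | y⟩`. -/
def qpm : G.Gp →ₗ[𝕂] G.Gm →ₗ[𝕂] G.U :=
  G.bpm.compr₂ (inU 𝕂) -
    G.form.flip.compr₂ (LinearMap.toSpanSingleton 𝕂 G.U (inU 𝕂 G.L + 1))

theorem qmp_apply (x : G.Gm) (y : G.Gp) :
    G.qmp x y = -inU 𝕂 (G.bpm y x) + G.form x y • inU 𝕂 G.L := by
  simp [qmp]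

theorem qpm_apply (x : G.Gm) (y : G.Gp) :
    G.qpm y x = inU 𝕂 (G.bpm y x) + (-G.form x y) • inU 𝕂 G.L + (-G.form x y) • 1 := by
  simp [qpm]
  abel

theorem form_b0m (z : G.G0) (x : G.Gm) (y : G.Gp) :
    G.form (G.b0m z x) y + G.form x (G.b0p z y) = 0 := by
  rw [← G.invariant x z y]; simp

theorem comm_L (z : G.G0) : inU 𝕂 z * inU 𝕂 G.L = inU 𝕂 G.L * inU 𝕂 z := by
  have := inU_lie (𝕂 := 𝕂) G.L z
  rw [LocalLieSuperalgebra.lie_def, G.grading_zero, map_zero] at this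
  exact (sub_eq_zero.1 this.symm).symm

theorem comm_bpm (z : G.G0) (y : G.Gp) (x : G.Gm) :
    inU 𝕂 z * inU 𝕂 (G.bpm y x) - inU 𝕂 (G.bpm y x) * inU 𝕂 z =
      inU 𝕂 (G.bpm (G.b0p z y) x) + inU 𝕂 (G.bpm y (G.b0m z x)) := by
  rw [← inU_lie, LocalLieSuperalgebra.lie_def, G.jacpm, map_add]

theorem qmp_equivariant (z : G.G0) (x : G.Gm) (y : G.Gp) :
    inU 𝕂 z * G.qmp x y - G.qmp x y * inU 𝕂 z = G.qmp (G.b0m z x) y + G.qmp x (G.b0p z y) := by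
  have h := G.comm_bpm z y x
  have h' := G.form_b0m z x y
  simp only [qmp_apply, mul_add, add_mul, mul_neg, neg_mul, mul_smul_comm, smul_mul_assoc,
    G.comm_L z]
  rw [eq_neg_of_add_eq_zero_left h', ← sub_eq_zero]
  rw [← sub_eq_zero] at h
  rw [← neg_eq_zero, ← h, neg_smul]
  abel

theorem qpm_equivariant (z : G.G0) (y : G.Gp) (x : G.Gm) :
    inU 𝕂 z * G.qpm y x - G.qpm y x * inU 𝕂 z = G.qpm (G.b0p z y) x + G.qpm y (G.b0m z x) := by
  have h := G.comm_bpm z y x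
  have h' := G.form_b0m z x y
  simp only [qpm_apply, mul_add, add_mul, mul_smul_comm, smul_mul_assoc,
    G.comm_L z, mul_one, one_mul]
  rw [eq_neg_of_add_eq_zero_left h', ← sub_eq_zero]
  rw [← sub_eq_zero] at h
  rw [← h]
  simp only [neg_neg, neg_smul]
  abel

/-- The local part of the algebra with restricted associativity associated to `G`, namely
`G₋₁ U(G₀) ⊕ U(G₀) ⊕ G₁ U(G₀)`, as a local Lie superalgebra with the super-commutator as the
bracket. -/
def ell : LocalLieSuperalgebra 𝕂 where
  Gm := G.Gm ⊗[𝕂] G.U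
  G0 := G.U
  Gp := G.Gp ⊗[𝕂] G.U
  b00 := LinearMap.mk₂ 𝕂 (fun u v => u * v - v * u)
    (by intros; simp only [mul_add, add_mul]; abel)
    (by intros; simp [smul_sub])
    (by intros; simp only [mul_add, add_mul]; abel)
    (by intros; simp [smul_sub])
  b0m := LinearMap.mk₂ 𝕂 (fun u X => lact G.b0m G.isRep_m u X - ract G.Gm u X)
    (by intros; simp only [map_add, LinearMap.add_apply]; abel)
    (by intros; simp [smul_sub])
    (by intros; simp only [map_add]; abel)
    (by intros; simp [smul_sub])
  b0p := LinearMap.mk₂ 𝕂 (fun u X => lact G.b0p G.isRep_p u X - ract G.Gp u X)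
    (by intros; simp only [map_add, LinearMap.add_apply]; abel)
    (by intros; simp [smul_sub])
    (by intros; simp only [map_add]; abel)
    (by intros; simp [smul_sub])
  bpm := LinearMap.mk₂ 𝕂
    (fun Y X => prodU G.b0m G.isRep_m G.qpm Y X + prodU G.b0p G.isRep_p G.qmp X Y)
    (by intros; simp only [map_add, LinearMap.add_apply]; abel)
    (by intros; simp)
    (by intros; simp only [map_add, LinearMap.add_apply]; abel)
    (by intros; simp)
  alt u := by simp
  jac00 u v w := by simp only [LinearMap.mk₂_apply]; noncomm_ring
  jacm u v X := by
    simp only [LinearMap.mk₂_apply, map_sub, LinearMap.sub_apply, map_mul, Module.End.mul_apply,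
      lact_ract, ract_mul]
    abel
  jacp u v X := by
    simp only [LinearMap.mk₂_apply, map_sub, LinearMap.sub_apply, map_mul, Module.End.mul_apply,
      lact_ract, ract_mul]
    abel
  jacpm u Y X := by
    simp only [LinearMap.mk₂_apply, map_sub, LinearMap.sub_apply, prodU_ract, prodU_assoc,
      lact_prodU G.qpm_equivariant, lact_prodU G.qmp_equivariant, mul_add, add_mul]
    abel

/-- The local cartanification of `G`: in the local Lie superalgebra above, take the subalgebra
generated by `G₋₁ G₀` and `G₁`, and factor out its maximal peripheral ideal. -/
def cartSub : G.ell.Sub :=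
  LocalLieSuperalgebra.Sub.generated {X | ∃ (x : G.Gm) (z : G.G0), X = x ⊗ₜ[𝕂] inU 𝕂 z}
    {Y | ∃ y : G.Gp, Y = y ⊗ₜ[𝕂] (1 : G.U)}

/-- The local cartanification of `G`. -/
def localCartanification : LocalLieSuperalgebra 𝕂 := G.cartSub.toLocal.maxPeripheral.quot

/-- The cartanification of `G`: the minimal `ℤ`-graded Lie superalgebra whose local part is the
local cartanification. -/
def cartanification : Presentation 𝕂 G.localCartanification.Gen :=
  G.localCartanification.minimalExtension

/-- The local part of the cartanification of `G`. -/
def cartanificationLocal [CharZero 𝕂] : LocalLieSuperalgebra 𝕂 :=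
  G.localCartanification.minimalExtensionLocal

end ContragredientLocal

/-! ### Contragredient Lie superalgebras -/

/-- The generators `e i`, `f i`, `h i`. -/
inductive CGen (N : Type) : Type u
  | e (i : N)
  | f (i : N)
  | h (i : N)

/-- The parities of the generators, where `e i` and `f i` have parity `p i`. -/
def CGen.par {N : Type} (p : N → ZMod 2) : CGen.{u} N → ZMod 2
  | .e i => p i
  | .f i => p i
  | .h _ => 0

/-- The degrees of the generators, where `e i` has degree `d i` and `f i` has degree `-d i`. -/
def CGen.deg {N : Type} (d : N → ℤ) : CGen.{u} N → ℤ
  | .e i => d i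
  | .f i => -d i
  | .h _ => 0

/-- The relations `[h i, e j] = M i j e j`, `[h i, f j] = -M i j f j`, `[e i, f j] = δ i j h j`. -/
inductive CGen.Rel {𝕂 : Type u} [Field 𝕂] {N : Type} [DecidableEq N] (M : Matrix N N 𝕂) :
    FreeNA 𝕂 (CGen.{u} N) → Prop
  | he (i j : N) : Rel M (gen 𝕂 (.h i) * gen 𝕂 (.e j) - M i j • gen 𝕂 (.e j))
  | hf (i j : N) : Rel M (gen 𝕂 (.h i) * gen 𝕂 (.f j) + M i j • gen 𝕂 (.f j))
  | ef (i j : N) : Rel M (gen 𝕂 (.e i) * gen 𝕂 (.f j) - if i = j then gen 𝕂 (.h j) else 0)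

section Contragredient

variable {𝕂 : Type u} [Field 𝕂] {N : Type} [DecidableEq N]

/-- The Lie superalgebra generated by `e i`, `f i` (of parity `p i`) and `h i` modulo the relations
above. -/
def tildeContragredient (M : Matrix N N 𝕂) (p : N → ZMod 2) : Presentation 𝕂 (CGen.{u} N) :=
  superPresentation (CGen.par p) (CGen.Rel M)

/-- The contragredient Lie superalgebra with Cartan matrix `M`: the quotient by the maximal graded
ideal intersecting the local part trivially, for the `ℤ`-grading where every `e i` has degree
`1` and every `f i` has degree `-1`. If all parities are zero and `M` is an invertible generalised
Cartan matrix, this is the Kac-Moody algebra of `M`. -/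
def contragredient (M : Matrix N N 𝕂) (p : N → ZMod 2) : Presentation 𝕂 (CGen.{u} N) :=
  (tildeContragredient M p).minimal (CGen.deg fun _ => 1)

theorem contragredient_isSuper (M : Matrix N N 𝕂) (p : N → ZMod 2) :
    (contragredient M p).IsSuper (CGen.par p) :=
  Presentation.minimal_isSuper (superPresentation_isSuper _ _) _

theorem contragredient_rel (M : Matrix N N 𝕂) (p : N → ZMod 2) {x : FreeNA 𝕂 (CGen.{u} N)}
    (hx : CGen.Rel M x) : (contragredient M p).proj x = 0 :=
  (Presentation.proj_eq_zero _).2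
    (Presentation.le_minimal _ _ (Presentation.subset_span _ (Or.inr hx)))

end Contragredient

/-! ### A linear functional on a contragredient Lie superalgebra

For a distinguished index `o` we construct the linear functional on the contragredient Lie
superalgebra that is `1` on `h o` and `0` on the other `h i` and on all homogeneous elements of
nonzero degree. It is obtained from a module generated by a vector `v` with `h i v = δ i o v`,
`e i v = 0` for all `i` and `f i v = 0` for `i ≠ o`. -/

/-- Pairs `(a, b)` of elements of an associative algebra, `a` being thought of as even and `b` as odd,
with the super-commutator as the product. -/
def SComm (R : Type*) : Type _ := R × R

namespace SComm

variable {𝕂 R : Type*} [Field 𝕂] [Ring R] [Algebra 𝕂 R]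

instance : AddCommGroup (SComm R) := inferInstanceAs (AddCommGroup (R × R))
instance : Module 𝕂 (SComm R) := inferInstanceAs (Module 𝕂 (R × R))

instance : Mul (SComm R) :=
  ⟨fun a b => (a.1 * b.1 - b.1 * a.1 + (a.2 * b.2 + b.2 * a.2),
    a.1 * b.2 - b.2 * a.1 + (a.2 * b.1 - b.1 * a.2))⟩

theorem ext' {a b : SComm R} (h1 : a.1 = b.1) (h2 : a.2 = b.2) : a = b := Prod.ext h1 h2

@[simp] theorem add_fst (a b : SComm R) : (a + b).1 = a.1 + b.1 := rfl
@[simp] theorem add_snd (a b : SComm R) : (a + b).2 = a.2 + b.2 := rfl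
@[simp] theorem sub_fst (a b : SComm R) : (a - b).1 = a.1 - b.1 := rfl
@[simp] theorem sub_snd (a b : SComm R) : (a - b).2 = a.2 - b.2 := rfl
@[simp] theorem zero_fst : (0 : SComm R).1 = 0 := rfl
@[simp] theorem zero_snd : (0 : SComm R).2 = 0 := rfl
@[simp] theorem neg_fst (a : SComm R) : (-a).1 = -a.1 := rfl
@[simp] theorem neg_snd (a : SComm R) : (-a).2 = -a.2 := rfl
@[simp] theorem smul_fst (c : 𝕂) (a : SComm R) : (c • a).1 = c • a.1 := rfl
@[simp] theorem smul_snd (c : 𝕂) (a : SComm R) : (c • a).2 = c • a.2 := rfl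
@[simp] theorem mul_fst (a b : SComm R) :
    (a * b).1 = a.1 * b.1 - b.1 * a.1 + (a.2 * b.2 + b.2 * a.2) := rfl
@[simp] theorem mul_snd (a b : SComm R) :
    (a * b).2 = a.1 * b.2 - b.2 * a.1 + (a.2 * b.1 - b.1 * a.2) := rfl

instance : NonUnitalNonAssocRing (SComm R) :=
  { (inferInstance : AddCommGroup (SComm R)), (inferInstance : Mul (SComm R)) with
    left_distrib := fun a b c => by apply ext' <;> simp <;> noncomm_ring
    right_distrib := fun a b c => by apply ext' <;> simp <;> noncomm_ring
    zero_mul := fun a => by apply ext' <;> simp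
    mul_zero := fun a => by apply ext' <;> simp }

instance : IsScalarTower 𝕂 (SComm R) (SComm R) :=
  ⟨fun c a b => by apply ext' <;> simp [smul_add, smul_sub]⟩

instance : SMulCommClass 𝕂 (SComm R) (SComm R) :=
  ⟨fun c a b => by apply ext' <;> simp [smul_add, smul_sub]⟩

/-- Place an element in the component of a given parity. -/
def put (q : ZMod 2) (a : R) : SComm R := if q = 0 then (a, 0) else (0, a)

@[simp] theorem put_zero_fst (a : R) : (put 0 a).1 = a := rfl
@[simp] theorem put_zero_snd (a : R) : (put 0 a).2 = 0 := rfl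
@[simp] theorem put_one_fst (a : R) : (put 1 a).1 = 0 := rfl
@[simp] theorem put_one_snd (a : R) : (put 1 a).2 = a := rfl

theorem zmod2_cases (a : ZMod 2) : a = 0 ∨ a = 1 := by revert a; decide

/-- Homogeneous pairs. -/
def Homog (q : ZMod 2) (A : SComm R) : Prop := (q = 0 → A.2 = 0) ∧ (q = 1 → A.1 = 0)

theorem anti {a b : ZMod 2} {A B : SComm R} (hA : Homog a A) (hB : Homog b B) :
    A * B + sgn 𝕂 a b • (B * A) = 0 := by
  rcases zmod2_cases a with rfl | rfl <;> rcases zmod2_cases b with rfl | rfl <;>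
    simp [Homog] at hA hB <;>
    (apply ext' <;> simp [sgn, hA, hB] <;> abel)

theorem jacobi {a b c : ZMod 2} {A B C : SComm R} (hA : Homog a A) (hB : Homog b B)
    (hC : Homog c C) : A * (B * C) - ((A * B) * C + sgn 𝕂 a b • (B * (A * C))) = 0 := by
  rcases zmod2_cases a with rfl | rfl <;> rcases zmod2_cases b with rfl | rfl <;>
    rcases zmod2_cases c with rfl | rfl <;>
    simp [Homog] at hA hB hC <;>
    (apply ext' <;> simp [sgn, hA, hB, hC, mul_sub, sub_mul, mul_add, add_mul, mul_assoc] <;> abel)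

end SComm

section Functional

variable {𝕂 : Type u} [Field 𝕂] {N : Type} [DecidableEq N] (M : Matrix N N 𝕂)
  (p : N → ZMod 2) (o : N)

/-- The eigenvalue of `h i` on the basis vectors: `none` is `v` and `some [j₁, …, jₙ]` is
`f j₁ ⋯ f jₙ f o v`. -/
def hval (i : N) : Option (List N) → 𝕂
  | none => if i = o then 1 else 0
  | some w => (if i = o then 1 else 0) - M i o - (w.map (M i)).sum

/-- The action of `h i`. -/
def opH (i : N) : Module.End 𝕂 (Option (List N) →₀ 𝕂) :=
  Finsupp.linearCombination 𝕂 fun b => Finsupp.single b (hval M o i b)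

/-- The action of `f j` on basis vectors. -/
def fval (j : N) : Option (List N) → (Option (List N) →₀ 𝕂)
  | none => if j = o then Finsupp.single (some []) 1 else 0
  | some w => Finsupp.single (some (j :: w)) 1

/-- The action of `f j`. -/
def opF (j : N) : Module.End 𝕂 (Option (List N) →₀ 𝕂) :=
  Finsupp.linearCombination 𝕂 (fval o j)

/-- The action of `e i` on `f j₁ ⋯ f jₙ f o v`. -/
def erec (i : N) : List N → (Option (List N) →₀ 𝕂)
  | [] => if i = o then Finsupp.single none 1 else 0
  | j :: w => sgn 𝕂 (p i) (p j) • opF o j (erec i w) +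
      if i = j then Finsupp.single (some w) (hval M o i (some w)) else 0

/-- The action of `e i` on basis vectors. -/
def eval (i : N) : Option (List N) → (Option (List N) →₀ 𝕂)
  | none => 0
  | some w => erec M p o i w

/-- The action of `e i`. -/
def opE (i : N) : Module.End 𝕂 (Option (List N) →₀ 𝕂) :=
  Finsupp.linearCombination 𝕂 (eval M p o i)

/-- The action of the generators. -/
def opGen : CGen.{u} N → SComm (Module.End 𝕂 (Option (List N) →₀ 𝕂))
  | .e i => SComm.put (p i) (opE M p o i)
  | .f i => SComm.put (p i) (opF o i)
  | .h i => SComm.put 0 (opH M o i)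

/-- The representation of the free algebra. -/
def rep : FreeNA 𝕂 (CGen.{u} N) →ₙₐ[𝕂] SComm (Module.End 𝕂 (Option (List N) →₀ 𝕂)) :=
  FreeNonUnitalNonAssocAlgebra.lift 𝕂 (opGen M p o)

@[simp] theorem opH_single (i : N) (b : Option (List N)) :
    opH M o i (Finsupp.single b 1) = hval M o i b • Finsupp.single b 1 := by
  simp [opH]

@[simp] theorem opF_single (i : N) (b : Option (List N)) :
    opF o i (Finsupp.single b (1 : 𝕂)) = fval o i b := by
  simp [opF]

@[simp] theorem opE_single (i : N) (b : Option (List N)) :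
    opE M p o i (Finsupp.single b 1) = eval M p o i b := by
  simp [opE]

theorem end_ext {S T : Module.End 𝕂 (Option (List N) →₀ 𝕂)}
    (h : ∀ b, S (Finsupp.single b 1) = T (Finsupp.single b 1)) : S = T := by
  apply Finsupp.lhom_ext
  intro b c
  have : Finsupp.single b c = c • Finsupp.single b (1 : 𝕂) := by simp
  rw [this, map_smul, map_smul, h]

theorem opHF (i j : N) : opH M o i * opF o j = opF o j * opH M o i - M i j • opF o j := by
  apply end_ext
  rintro (_ | w)
  · simp only [Module.End.mul_apply, LinearMap.sub_apply, LinearMap.smul_apply, opF_single,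
      opH_single, map_smul, fval]
    by_cases hj : j = o
    · subst hj
      rw [if_pos rfl, opH_single, ← sub_smul]
      simp [hval]
    · simp [hj]
  · simp only [Module.End.mul_apply, LinearMap.sub_apply, LinearMap.smul_apply, opF_single,
      opH_single, map_smul, fval, hval, List.map_cons, List.sum_cons]
    rw [← sub_smul]
    congr 1
    ring

theorem opHE (i j : N) : opH M o i * opE M p o j = opE M p o j * opH M o i + M i j • opE M p o j := by
  apply end_ext
  rintro (_ | w)
  · simp only [Module.End.mul_apply, LinearMap.add_apply, LinearMap.smul_apply, opE_single,
      opH_single, map_smul, eval, map_zero, smul_zero, add_zero]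
  · simp only [Module.End.mul_apply, LinearMap.add_apply, LinearMap.smul_apply, opE_single,
      opH_single, map_smul, eval]
    induction w with
    | nil =>
      by_cases hj : j = o
      · subst hj
        simp [erec, hval, sub_smul]
      · simp [erec, hj]
    | cons k w ih =>
      have hF := fun v => LinearMap.congr_fun (opHF M o i k) v
      simp only [Module.End.mul_apply, LinearMap.sub_apply, LinearMap.smul_apply] at hF
      have e1 : hval M o i (some (k :: w)) = hval M o i (some w) - M i k := by
        simp [hval]; ring
      simp only [erec, map_add, map_smul, hF, ih, e1]
      by_cases hk : j = k
      · subst hk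
        have e2 : Finsupp.single (some w) (hval M o j (some w)) =
            hval M o j (some w) • Finsupp.single (some w) (1 : 𝕂) := by simp
        rw [if_pos rfl, e2, map_smul, opH_single]
        module
      · rw [if_neg hk]
        simp only [map_zero]
        module

theorem opEF (i j : N) : opE M p o i * opF o j =
    sgn 𝕂 (p i) (p j) • (opF o j * opE M p o i) + if i = j then opH M o i else 0 := by
  apply end_ext
  rintro (_ | w)
  · by_cases hj : j = o
    · subst hj
      by_cases hi : i = j
      · subst hi; simp [fval, eval, erec, hval]
      · simp [fval, eval, erec, hi]
    · by_cases hi : i = j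
      · subst hi; simp [fval, eval, hval, hj]
      · simp [fval, eval, hi, hj]
  · by_cases hi : i = j
    · subst hi; simp [fval, eval, erec]
    · simp [fval, eval, erec, hi]

open SComm in
theorem rep_rel {x : FreeNA 𝕂 (CGen.{u} N)} (hx : CGen.Rel M x) : rep M p o x = 0 := by
  cases hx with
  | he i j =>
    have h := opHE M p o i j
    rcases zmod2_cases (p j) with hj | hj <;>
      (apply SComm.ext' <;> simp [rep, opGen, hj, h] <;> abel)
  | hf i j =>
    have h := opHF M o i j
    rcases zmod2_cases (p j) with hj | hj <;>
      (apply SComm.ext' <;> simp [rep, opGen, hj, h] <;> abel)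
  | ef i j =>
    have h := opEF M p o i j
    by_cases hij : i = j
    · subst hij
      rw [if_pos rfl] at h
      rcases zmod2_cases (p i) with hi | hi <;> simp [hi, sgn] at h <;>
        (apply SComm.ext' <;> simp [rep, opGen, hi, h] <;> module)
    · rw [if_neg hij, add_zero] at h
      rw [if_neg hij]
      rcases zmod2_cases (p i) with hi | hi <;> rcases zmod2_cases (p j) with hj | hj <;>
        simp [hi, hj, sgn] at h <;>
        (apply SComm.ext' <;> simp [rep, opGen, hi, hj, h] <;> module)

open SComm in
theorem rep_parity (m : FreeMagma (CGen.{u} N)) :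
    SComm.Homog (mdeg (CGen.par p) m) (rep M p o (mon 𝕂 m)) := by
  unfold SComm.Homog
  induction m using FreeMagma.rec with
  | of x =>
    have : rep M p o (mon 𝕂 (FreeMagma.of x)) = opGen M p o x :=
      FreeNonUnitalNonAssocAlgebra.lift_of_apply 𝕂 _ x
    rw [this]
    cases x <;> simp +contextual [CGen.par, opGen]
  | mul a b ha hb =>
    change (mdeg (CGen.par p) (a * b) = 0 → (rep M p o (mon 𝕂 (a * b))).2 = 0) ∧
      (mdeg (CGen.par p) (a * b) = 1 → (rep M p o (mon 𝕂 (a * b))).1 = 0)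
    rw [mon_mul, map_mul, mdeg_mul]
    rcases zmod2_cases (mdeg (CGen.par p) a) with h1 | h1 <;>
      rcases zmod2_cases (mdeg (CGen.par p) b) with h2 | h2 <;>
      simp [h1, h2] at ha hb ⊢ <;> simp [ha, hb]

theorem rep_super {x : FreeNA 𝕂 (CGen.{u} N)} (hx : SuperRel 𝕂 (CGen.par p) x) :
    rep M p o x = 0 := by
  cases hx with
  | anti a b =>
    simp only [map_add, map_smul, map_mul]
    exact SComm.anti (rep_parity M p o a) (rep_parity M p o b)
  | jacobi a b c =>
    simp only [map_add, map_sub, map_smul, map_mul]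
    exact SComm.jacobi (rep_parity M p o a) (rep_parity M p o b) (rep_parity M p o c)

theorem rep_ideal {x : FreeNA 𝕂 (CGen.{u} N)} (hx : x ∈ (tildeContragredient M p).ideal) :
    rep M p o x = 0 := by
  have : LinearMap.ker (rep M p o : FreeNA 𝕂 (CGen.{u} N) →ₗ[𝕂]
      SComm (Module.End 𝕂 (Option (List N) →₀ 𝕂))) ∈
      {J : Submodule 𝕂 (FreeNA 𝕂 (CGen.{u} N)) | IsIdeal J ∧
        {x | SuperRel 𝕂 (CGen.par p) x ∨ CGen.Rel M x} ⊆ (J : Set _)} := by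
    refine ⟨fun x y hy => ?_, ?_⟩
    · simp only [LinearMap.mem_ker] at hy ⊢
      have hy : rep M p o y = 0 := hy
      exact ⟨by change rep M p o (x * y) = 0; rw [map_mul, hy, mul_zero],
        by change rep M p o (y * x) = 0; rw [map_mul, hy, zero_mul]⟩
    · rintro x (hx | hx)
      · exact rep_super M p o hx
      · exact rep_rel M p o hx
  exact (Submodule.mem_sInf.1 hx) _ this

/-- The degree of a basis vector, where `f j` has degree `-d j`. -/
def bdeg (d : N → ℤ) : Option (List N) → ℤ
  | none => 0
  | some w => -(d o + (w.map d).sum)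

/-- The span of the basis vectors of degree `k`. -/
def vdeg (𝕂 : Type u) [Field 𝕂] {N : Type} (o : N) (d : N → ℤ) (k : ℤ) :
    Submodule 𝕂 (Option (List N) →₀ 𝕂) :=
  Finsupp.supported 𝕂 𝕂 {b | bdeg o d b = k}

theorem single_mem_vdeg (d : N → ℤ) {k : ℤ} {b : Option (List N)} (h : bdeg o d b = k) (c : 𝕂) :
    Finsupp.single b c ∈ vdeg 𝕂 o d k :=
  Finsupp.single_mem_supported 𝕂 c h

/-- An endomorphism raises the degree by `n`. -/
def Raises (d : N → ℤ) (n : ℤ) (S : Module.End 𝕂 (Option (List N) →₀ 𝕂)) : Prop :=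
  ∀ k, ∀ v ∈ vdeg 𝕂 o d k, S v ∈ vdeg 𝕂 o d (k + n)

variable {o} in
theorem raises_of (d : N → ℤ) (n : ℤ) (S : Module.End 𝕂 (Option (List N) →₀ 𝕂))
    (h : ∀ b, S (Finsupp.single b 1) ∈ vdeg 𝕂 o d (bdeg o d b + n)) : Raises o d n S := by
  intro k v hv
  rw [vdeg, Finsupp.supported_eq_span_single] at hv
  induction hv using Submodule.span_induction with
  | zero => simp
  | add a b _ _ ha hb => rw [map_add]; exact Submodule.add_mem _ ha hb
  | smul c a _ ha => rw [map_smul]; exact Submodule.smul_mem _ _ ha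
  | mem a ha =>
    obtain ⟨b, rfl, rfl⟩ := ha
    exact h b

theorem opF_raises (d : N → ℤ) (i : N) : Raises o d (-d i) (opF o i : Module.End 𝕂 _) := by
  apply raises_of
  rintro (_ | w)
  · by_cases hi : i = o
    · subst hi
      simpa [fval] using single_mem_vdeg i d (by simp [bdeg]) (1 : 𝕂)
    · simp [fval, hi]
  · simpa [fval] using single_mem_vdeg o d (by simp [bdeg]; ring) (1 : 𝕂)

theorem opH_raises (d : N → ℤ) (i : N) : Raises o d 0 (opH M o i) := by
  apply raises_of
  intro b
  rw [opH_single]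
  exact Submodule.smul_mem _ _ (single_mem_vdeg o d (by simp) 1)

theorem opE_raises (d : N → ℤ) (i : N) : Raises o d (d i) (opE M p o i) := by
  apply raises_of
  rintro (_ | w)
  · simp [eval]
  · rw [opE_single, eval]
    induction w with
    | nil =>
      by_cases hi : i = o
      · subst hi
        simpa [erec] using single_mem_vdeg i d (by simp [bdeg]) (1 : 𝕂)
      · simp [erec, hi]
    | cons j w ih =>
      rw [erec]
      refine Submodule.add_mem _ (Submodule.smul_mem _ _ ?_) ?_
      · have := opF_raises o d j _ _ ih
        have e : bdeg o d (some w) + d i + -d j = bdeg o d (some (j :: w)) + d i := by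
          simp [bdeg]; ring
        rwa [e] at this
      · by_cases hi : i = j
        · subst hi
          rw [if_pos rfl]
          exact single_mem_vdeg o d (by simp [bdeg]; ring) _
        · simp [hi]

theorem Raises.comp {d : N → ℤ} {m n : ℤ} {S T : Module.End 𝕂 (Option (List N) →₀ 𝕂)}
    (hS : Raises o d m S) (hT : Raises o d n T) : Raises o d (m + n) (S * T) := by
  intro k v hv
  have := hS _ _ (hT _ _ hv)
  rwa [add_assoc, add_comm n m] at this

theorem Raises.add {d : N → ℤ} {n : ℤ} {S T : Module.End 𝕂 (Option (List N) →₀ 𝕂)}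
    (hS : Raises o d n S) (hT : Raises o d n T) : Raises o d n (S + T) :=
  fun k v hv => Submodule.add_mem _ (hS k v hv) (hT k v hv)

theorem Raises.sub {d : N → ℤ} {n : ℤ} {S T : Module.End 𝕂 (Option (List N) →₀ 𝕂)}
    (hS : Raises o d n S) (hT : Raises o d n T) : Raises o d n (S - T) :=
  fun k v hv => Submodule.sub_mem _ (hS k v hv) (hT k v hv)

theorem Raises.zero {d : N → ℤ} {n : ℤ} : Raises o d n (0 : Module.End 𝕂 _) :=
  fun _ _ _ => Submodule.zero_mem _

theorem rep_raises (d : N → ℤ) (m : FreeMagma (CGen.{u} N)) :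
    Raises o d (mdeg (CGen.deg d) m) (rep M p o (mon 𝕂 m)).1 ∧
      Raises o d (mdeg (CGen.deg d) m) (rep M p o (mon 𝕂 m)).2 := by
  induction m using FreeMagma.rec with
  | of x =>
    have : rep M p o (mon 𝕂 (FreeMagma.of x)) = opGen M p o x :=
      FreeNonUnitalNonAssocAlgebra.lift_of_apply 𝕂 _ x
    rw [this]
    cases x with
    | e i =>
      rcases SComm.zmod2_cases (p i) with hi | hi <;>
        simp [opGen, CGen.deg, mdeg, hi, opE_raises, Raises.zero]
    | f i =>
      rcases SComm.zmod2_cases (p i) with hi | hi <;>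
        simp [opGen, CGen.deg, mdeg, hi, opF_raises, Raises.zero]
    | h i => simp [opGen, CGen.deg, mdeg, opH_raises, Raises.zero]
  | mul a b ha hb =>
    change Raises o d (mdeg (CGen.deg d) (a * b)) (rep M p o (mon 𝕂 (a * b))).1 ∧
      Raises o d (mdeg (CGen.deg d) (a * b)) (rep M p o (mon 𝕂 (a * b))).2
    rw [mon_mul, map_mul, mdeg_mul, SComm.mul_fst, SComm.mul_snd]
    have c := @add_comm ℤ _
    refine ⟨.add _ (.sub _ (ha.1.comp _ hb.1) ?_) (.add _ (ha.2.comp _ hb.2) ?_),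
      .add _ (.sub _ (ha.1.comp _ hb.2) ?_) (.sub _ (ha.2.comp _ hb.1) ?_)⟩
    · rw [c]; exact hb.1.comp _ ha.1
    · rw [c]; exact hb.2.comp _ ha.2
    · rw [c]; exact hb.2.comp _ ha.1
    · rw [c]; exact hb.1.comp _ ha.2

/-- The basis vector `v`. -/
def vac (𝕂 : Type u) [Field 𝕂] (N : Type) : Option (List N) →₀ 𝕂 := Finsupp.single none 1

/-- The functional on the free algebra: the coefficient of `v` in `x v`. -/
def chiFree : FreeNA 𝕂 (CGen.{u} N) →ₗ[𝕂] 𝕂 where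
  toFun x := (rep M p o x).1 (vac 𝕂 N) none
  map_add' x y := by simp
  map_smul' c x := by simp

theorem chiFree_of_deg (d : N → ℤ) {m : FreeMagma (CGen.{u} N)}
    (h : mdeg (CGen.deg d) m ≠ 0) : chiFree M p o (mon 𝕂 m) = 0 := by
  have h1 := (rep_raises M p o d m).1 0 (vac 𝕂 N) (single_mem_vdeg o d rfl 1)
  rw [zero_add] at h1
  by_contra h2
  have h3 := h1 (Finsupp.mem_support_iff.2 h2)
  exact h (show (0 : ℤ) = _ from h3).symm

/-- The functional on the Lie superalgebra without the quotient by the maximal ideal. -/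
def chiTilde : (tildeContragredient M p).Alg →ₗ[𝕂] 𝕂 :=
  Submodule.liftQ _ (chiFree M p o) (fun x hx => by
    rw [LinearMap.mem_ker]
    change (rep M p o x).1 (vac 𝕂 N) none = 0
    rw [rep_ideal M p o hx]
    simp)

theorem chiTilde_proj (x : FreeNA 𝕂 (CGen.{u} N)) :
    chiTilde M p o ((tildeContragredient M p).proj x) = chiFree M p o x := rfl

theorem chiTilde_maxIdeal {x : (tildeContragredient M p).Alg}
    (hx : x ∈ (tildeContragredient M p).maxIdeal (CGen.deg fun _ => 1)) :
    chiTilde M p o x = 0 := by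
  have : (tildeContragredient M p).maxIdeal (CGen.deg fun _ => 1) ≤
      LinearMap.ker (chiTilde M p o) := by
    refine sSup_le ?_
    rintro I ⟨-, hg, hl⟩
    refine hg.trans (iSup_le fun n => ?_)
    by_cases hn : n = 0
    · subst hn
      intro y hy
      have : y ∈ (⊥ : Submodule 𝕂 (tildeContragredient M p).Alg) := by
        rw [← hl]
        exact ⟨hy.1, Submodule.mem_sup_left (Submodule.mem_sup_right hy.2)⟩
      rw [(Submodule.mem_bot 𝕂).1 this]
      exact Submodule.zero_mem _
    · refine inf_le_right.trans (Submodule.span_le.2 ?_)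
      rintro _ ⟨m, hm, rfl⟩
      rw [SetLike.mem_coe, LinearMap.mem_ker, chiTilde_proj]
      exact chiFree_of_deg M p o (fun _ => 1) (by rw [hm]; exact hn)
  exact this hx

/-- The functional on the contragredient Lie superalgebra. -/
def chi : (contragredient M p).Alg →ₗ[𝕂] 𝕂 :=
  Submodule.liftQ _ (chiFree M p o) (fun x hx => by
    rw [LinearMap.mem_ker, ← chiTilde_proj]
    exact chiTilde_maxIdeal M p o hx)

theorem chi_proj (x : FreeNA 𝕂 (CGen.{u} N)) :
    chi M p o ((contragredient M p).proj x) = chiFree M p o x := rfl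

theorem chi_h (i : N) :
    chi M p o ((contragredient M p).proj (gen 𝕂 (.h i))) = if i = o then 1 else 0 := by
  rw [chi_proj]
  change (rep M p o (gen 𝕂 (.h i))).1 (vac 𝕂 N) none = _
  by_cases hi : i = o <;> simp [rep, opGen, vac, hval, hi]

theorem chi_of_deg (d : N → ℤ) {n : ℤ} (hn : n ≠ 0) {x : (contragredient M p).Alg}
    (hx : x ∈ (contragredient M p).comp (CGen.deg d) n) : chi M p o x = 0 := by
  have : (contragredient M p).comp (CGen.deg d) n ≤ LinearMap.ker (chi M p o) := by
    refine Submodule.span_le.2 ?_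
    rintro _ ⟨m, hm, rfl⟩
    rw [SetLike.mem_coe, LinearMap.mem_ker, chi_proj]
    exact chiFree_of_deg M p o d (by rw [hm]; exact hn)
  exact this hx

/-- For a grading where `e o` has degree one and the other generators have degree zero, monomials
of degree zero act on `v` by scalars. -/
theorem rep_vac {d : N → ℤ} (hd : ∀ i, 0 ≤ d i) (ho : d o = 1) {m : FreeMagma (CGen.{u} N)}
    (hm : mdeg (CGen.deg d) m = 0) :
    (rep M p o (mon 𝕂 m)).1 (vac 𝕂 N) = chiFree M p o (mon 𝕂 m) • vac 𝕂 N := by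
  have h1 := (rep_raises M p o d m).1 0 (vac 𝕂 N) (single_mem_vdeg o d rfl 1)
  rw [zero_add, hm] at h1
  ext b
  rcases b with _ | w
  · simp [chiFree, vac]
  · have : (rep M p o (mon 𝕂 m)).1 (vac 𝕂 N) (some w) = 0 := by
      by_contra h2
      have h3 : -(d o + (w.map d).sum) = 0 := h1 (Finsupp.mem_support_iff.2 h2)
      have h4 : 0 ≤ (w.map d).sum := List.sum_nonneg (by simpa using fun i _ => hd i)
      omega
    rw [this]
    simp [vac]

/-- The functional is a character of the even subalgebra of degree zero. -/
theorem chi_mul {d : N → ℤ} (hd : ∀ i, 0 ≤ d i) (ho : d o = 1)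
    (hp : Consistent (CGen.par.{u} p) (CGen.deg d)) {x y : (contragredient M p).Alg}
    (hx : x ∈ (contragredient M p).comp (CGen.deg d) 0)
    (hy : y ∈ (contragredient M p).comp (CGen.deg d) 0) : chi M p o (x * y) = 0 := by
  induction hx using Submodule.span_induction with
  | zero => simp
  | add a b _ _ ha hb => rw [add_mul, map_add, ha, hb, add_zero]
  | smul c a _ ha => rw [smul_mul_assoc, map_smul, ha, smul_zero]
  | mem a ha =>
    obtain ⟨m, hm, rfl⟩ := ha
    induction hy using Submodule.span_induction with
    | zero => simp
    | add a b _ _ ha hb => rw [mul_add, map_add, ha, hb, add_zero]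
    | smul c a _ ha => rw [mul_smul_comm, map_smul, ha, smul_zero]
    | mem a ha =>
      obtain ⟨n, hn, rfl⟩ := ha
      rw [← Presentation.proj_mul, chi_proj]
      have h1 := (rep_parity M p o m).1 (by rw [hp.mdeg, hm]; rfl)
      have h2 := (rep_parity M p o n).1 (by rw [hp.mdeg, hn]; rfl)
      change (rep M p o (mon 𝕂 m * mon 𝕂 n)).1 (vac 𝕂 N) none = 0
      rw [map_mul, SComm.mul_fst, h1, h2]
      simp only [mul_zero, add_zero, LinearMap.sub_apply, Module.End.mul_apply,
        rep_vac M p o hd ho hm, rep_vac M p o hd ho hn, map_smul]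
      rw [smul_comm, sub_self]
      rfl

end Functional

namespace ContragredientLocal

variable {𝕂 : Type u} [Field 𝕂] (G : ContragredientLocal 𝕂)

theorem ell_bracket (x : G.Gm) (y : G.Gp) (z : G.G0) :
    G.ell.bpm (y ⊗ₜ[𝕂] (1 : G.U)) (x ⊗ₜ[𝕂] inU 𝕂 z) =
      inU 𝕂 (-G.form x y • z - G.bpm (G.b0p z y) x + G.form x (G.b0p z y) • G.L) := by
  change prodU G.b0m G.isRep_m G.qpm (y ⊗ₜ[𝕂] (1 : G.U)) (x ⊗ₜ[𝕂] inU 𝕂 z) +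
    prodU G.b0p G.isRep_p G.qmp (x ⊗ₜ[𝕂] inU 𝕂 z) (y ⊗ₜ[𝕂] (1 : G.U)) = _
  rw [prodU_tmul x, lact_inU, map_add, prodU_one_tmul, prodU_one_tmul, prodU_one_tmul, mul_one,
    mul_one, qpm_apply, qmp_apply, qmp_apply]
  simp only [map_add, map_sub, map_smul, add_mul, neg_mul, smul_mul_assoc, one_mul]
  module

theorem tmul_mem_cartSub (x : G.Gm) (z : G.G0) : x ⊗ₜ[𝕂] inU 𝕂 z ∈ G.cartSub.m :=
  LocalLieSuperalgebra.Sub.generated_m ⟨x, z, rfl⟩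

theorem tmul_one_mem_cartSub (y : G.Gp) : y ⊗ₜ[𝕂] (1 : G.U) ∈ G.cartSub.p :=
  LocalLieSuperalgebra.Sub.generated_p ⟨y, rfl⟩

theorem bracket_mem_cartSub (x : G.Gm) (y : G.Gp) (z : G.G0) :
    inU 𝕂 (-G.form x y • z - G.bpm (G.b0p z y) x + G.form x (G.b0p z y) • G.L) ∈ G.cartSub.z := by
  rw [← ell_bracket]
  exact G.cartSub.bpm_mem _ (G.tmul_one_mem_cartSub y) _ (G.tmul_mem_cartSub x z)

theorem inU_bpm_mem (x : G.Gm) (y : G.Gp) : inU 𝕂 (G.bpm y x) ∈ G.cartSub.z := by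
  have h := G.bracket_mem_cartSub x y G.L
  rw [G.grading_pos] at h
  have e : -G.form x y • G.L - G.bpm y x + G.form x y • G.L = -G.bpm y x := by module
  rw [e, map_neg] at h
  have h2 := Submodule.neg_mem _ h
  rwa [neg_neg] at h2

theorem inU_mem_of_form {x : G.Gm} {y : G.Gp} {z : G.G0} (h : G.form x y = -1)
    (h' : G.form x (G.b0p z y) = 0) : inU 𝕂 z ∈ G.cartSub.z := by
  have h1 := Submodule.add_mem _ (G.bracket_mem_cartSub x y z) (G.inU_bpm_mem x (G.b0p z y))
  have e : -G.form x y • z - G.bpm (G.b0p z y) x + G.form x (G.b0p z y) • G.L +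
      G.bpm (G.b0p z y) x = z := by
    rw [h, h']; module
  rwa [← map_add, e] at h1

theorem inU_b00_mem {s t : G.G0} (hs : inU 𝕂 s ∈ G.cartSub.z) (ht : inU 𝕂 t ∈ G.cartSub.z) :
    inU 𝕂 (G.b00 s t) ∈ G.cartSub.z := by
  have h : inU 𝕂 (G.b00 s t) = G.ell.b00 (inU 𝕂 s) (inU 𝕂 t) := inU_lie (𝕂 := 𝕂) s t
  rw [h]
  exact G.cartSub.b00_mem _ hs _ ht

variable [CharZero 𝕂]

/-- The element `x z` of the cartanification, for `x ∈ G₋₁` and `z ∈ G₀`. -/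
def cartNeg (x : G.Gm) (z : G.G0) : G.cartanificationLocal.Gm :=
  ⟨G.cartanification.proj (gen 𝕂 (.m (Submodule.Quotient.mk ⟨_, G.tmul_mem_cartSub x z⟩))),
    Presentation.gen_mem _ _ _ rfl⟩

/-- The element `z` of the cartanification, for `z ∈ G₀` in the subalgebra generated by
`G₋₁ G₀` and `G₁`. -/
def cartZero (z : G.G0) (hz : inU 𝕂 z ∈ G.cartSub.z) : G.cartanificationLocal.G0 :=
  ⟨G.cartanification.proj (gen 𝕂 (.z (Submodule.Quotient.mk ⟨_, hz⟩))),
    Presentation.gen_mem _ _ _ rfl⟩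

/-- The element `y` of the cartanification, for `y ∈ G₁`. -/
def cartPos (y : G.Gp) : G.cartanificationLocal.Gp :=
  ⟨G.cartanification.proj (gen 𝕂 (.p (Submodule.Quotient.mk ⟨_, G.tmul_one_mem_cartSub y⟩))),
    Presentation.gen_mem _ _ _ rfl⟩

end ContragredientLocal

/-! ### The data `(g, λ, κ)` -/

/-- The extension of a matrix by a row and a column with index `0` (here `none`), having a zero on
the diagonal. -/
def extendMatrix {𝕂 : Type u} [Field 𝕂] {r : ℕ} (A : Matrix (Fin r) (Fin r) 𝕂)
    (col row : Fin r → 𝕂) : Matrix (Option (Fin r)) (Option (Fin r)) 𝕂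
  | none, none => 0
  | some i, none => col i
  | none, some j => row j
  | some i, some j => A i j

/-- The data of a triple `(g, λ, κ)`: an invertible generalised Cartan matrix `A`, nonzero
numbers `ε i` such that `D⁻¹ A` is symmetric with `D = diag(ε)` (so that
`κ(e i, f j) = δ i j ε j`), and the Dynkin labels of a dominant integral weight `λ`. The extended
matrix `B` is assumed to be invertible as well. -/
structure Triple (𝕂 : Type u) [Field 𝕂] (r : ℕ) where
  A : Matrix (Fin r) (Fin r) ℤ
  A_diag : ∀ i, A i i = 2
  A_offdiag : ∀ i j, i ≠ j → A i j ≤ 0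
  A_zero : ∀ i j, A i j = 0 → A j i = 0
  A_invertible : A.det ≠ 0
  ε : Fin r → 𝕂
  ε_ne_zero : ∀ i, ε i ≠ 0
  symmetric : ∀ i j, (ε i)⁻¹ * (A i j : 𝕂) = (ε j)⁻¹ * (A j i : 𝕂)
  lam : Fin r → ℕ
  B_invertible : (extendMatrix (A.map (Int.cast : ℤ → 𝕂)) (fun i => -(lam i : 𝕂))
    (fun j => -((ε j)⁻¹ * (lam j : 𝕂)))).det ≠ 0

/-- The generators `e i`, `f j`, `h i` and `f0 k` of `W`, where `i ∈ {0} ∪ I`, `j ∈ I` and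
`k ∈ {0} ∪ K`; here `I = Fin r`, the index `0` is `none`, and `K = {k ∈ I | λ k = 0}`. -/
inductive WGen {r : ℕ} (lam : Fin r → ℕ) : Type u
  | e (i : Option (Fin r))
  | f (j : Fin r)
  | h (i : Option (Fin r))
  | f0 (k : Option {k : Fin r // lam k = 0})

/-- The degrees of the generators in the consistent `ℤ`-grading. -/
def WGen.deg {r : ℕ} (lam : Fin r → ℕ) : WGen.{u} lam → ℤ
  | .e none => 1
  | .e (some _) => 0
  | .f _ => 0
  | .h _ => 0
  | .f0 _ => -1

/-- The parities of the generators: `e 0` and `f0 k` are odd, the others are even. -/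
def WGen.par {r : ℕ} (lam : Fin r → ℕ) : WGen.{u} lam → ZMod 2
  | .e none => 1
  | .e (some _) => 0
  | .f _ => 0
  | .h _ => 0
  | .f0 _ => 1

theorem WGen.consistent {r : ℕ} (lam : Fin r → ℕ) :
    Consistent (WGen.par.{u} lam) (WGen.deg lam) := by
  rintro ((_ | i) | j | i | k) <;> simp [WGen.par, WGen.deg]

namespace Triple

variable {𝕂 : Type u} [Field 𝕂] {r : ℕ} (T : Triple 𝕂 r)

/-- The generalised Cartan matrix, with entries in the field. -/
def cartan : Matrix (Fin r) (Fin r) 𝕂 := T.A.map (Int.cast : ℤ → 𝕂)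

/-- The Dynkin labels of the weight `λ^▲`. -/
def lamTri (i : Fin r) : 𝕂 := (T.ε i)⁻¹ * (T.lam i : 𝕂)

/-- The Cartan matrix `B`. -/
def B : Matrix (Option (Fin r)) (Option (Fin r)) 𝕂 :=
  extendMatrix T.cartan (fun i => -(T.lam i : 𝕂)) (fun j => -T.lamTri j)

theorem isUnit_det_B : IsUnit T.B.det := isUnit_iff_ne_zero.2 T.B_invertible

/-! #### Pseudo-minuscule weights -/

/-- The Kac-Moody algebra `g`. -/
def g : Presentation 𝕂 (CGen.{u} (Fin r)) := contragredient T.cartan 0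

/-- The combination `∑ j, b j α j` of the simple roots is a root of `g`: it is nonzero and there is
a nonzero `x` with `[h i, x] = α(h i) x` for all `i`, where `α j (h i) = A i j`. -/
def IsRoot (b : Fin r → ℤ) : Prop :=
  b ≠ 0 ∧ ∃ x : T.g.Alg, x ≠ 0 ∧
    ∀ i, T.g.proj (gen 𝕂 (.h i)) * x = (((T.A.mulVec b) i : ℤ) : 𝕂) • x

/-- The matrix with entries `κ(h i, h j) = A i j ε j`. -/
def kappaH : Matrix (Fin r) (Fin r) 𝕂 := fun i j => T.cartan i j * T.ε j

/-- The bilinear form on the dual of the Cartan subalgebra of `g` induced by `κ`, where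
`μ` and `ν` are given by their Dynkin labels `μ (h i)` and `ν (h i)`. -/
def weightForm (μ ν : Fin r → 𝕂) : 𝕂 := μ ⬝ᵥ (T.kappaH⁻¹).mulVec ν

/-- A weight `μ`, given by its Dynkin labels, is pseudo-minuscule: it is dominant integral, and
`(μ^▼, β)` is `0` or `1` for all positive roots `β`, where `μ^▼` has the labels `ε i μ i`. -/
def IsPseudoMinuscule (μ : Fin r → 𝕂) : Prop :=
  (∀ i, ∃ m : ℕ, μ i = m) ∧
    ∀ b : Fin r → ℤ, T.IsRoot b → (∀ i, 0 ≤ b i) →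
      T.weightForm (fun i => T.ε i * μ i) (fun i => ((T.A.mulVec b) i : ℤ)) = 0 ∨
      T.weightForm (fun i => T.ε i * μ i) (fun i => ((T.A.mulVec b) i : ℤ)) = 1

/-! #### The contragredient Lie superalgebra -/

/-- The parities: `e 0` and `f 0` are odd. -/
def par : Option (Fin r) → ZMod 2
  | none => 1
  | some _ => 0

/-- The consistent `ℤ`-grading: `e 0` has degree `1` and `e i` has degree `0` for `i ∈ I`. -/
def deg : Option (Fin r) → ℤ
  | none => 1
  | some _ => 0

theorem consistent : Consistent (CGen.par.{u} (par (r := r))) (CGen.deg deg) := by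
  rintro ((_ | i) | (_ | i) | i) <;> simp [CGen.par, CGen.deg, par, deg]

/-- The contragredient Lie superalgebra `𝓑` with Cartan matrix `B`. -/
def 𝓑 : Presentation 𝕂 (CGen.{u} (Option (Fin r))) := contragredient T.B par

theorem 𝓑_isSuper : T.𝓑.IsSuper (CGen.par par) := contragredient_isSuper _ _

/-- The component of degree `n` in the consistent grading. -/
abbrev 𝓑comp (n : ℤ) : Submodule 𝕂 T.𝓑.Alg := T.𝓑.comp (CGen.deg deg) n

/-- The generator `e i` of `𝓑`. -/
def be (i : Option (Fin r)) : T.𝓑.Alg := T.𝓑.proj (gen 𝕂 (.e i))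
/-- The generator `f i` of `𝓑`. -/
def bf (i : Option (Fin r)) : T.𝓑.Alg := T.𝓑.proj (gen 𝕂 (.f i))
/-- The generator `h i` of `𝓑`. -/
def bh (i : Option (Fin r)) : T.𝓑.Alg := T.𝓑.proj (gen 𝕂 (.h i))

theorem e_mem (i : Option (Fin r)) : T.be i ∈ T.𝓑comp (deg i) := Presentation.gen_mem _ _ _ rfl
theorem f_mem (i : Option (Fin r)) : T.bf i ∈ T.𝓑comp (-deg i) := Presentation.gen_mem _ _ _ rfl
theorem h_mem (i : Option (Fin r)) : T.bh i ∈ T.𝓑comp 0 := Presentation.gen_mem _ _ _ rfl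

theorem h_mul_e (i j : Option (Fin r)) : T.bh i * T.be j = T.B i j • T.be j := by
  have := contragredient_rel T.B par (CGen.Rel.he i j)
  rw [map_sub, map_smul, Presentation.proj_mul] at this
  exact sub_eq_zero.1 this

theorem h_mul_f (i j : Option (Fin r)) : T.bh i * T.bf j = -(T.B i j • T.bf j) := by
  have := contragredient_rel T.B par (CGen.Rel.hf i j)
  rw [map_add, map_smul, Presentation.proj_mul] at this
  exact eq_neg_of_add_eq_zero_left this

theorem e_mul_f (i j : Option (Fin r)) : T.be i * T.bf j = if i = j then T.bh j else 0 := by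
  have := contragredient_rel T.B par (CGen.Rel.ef i j)
  rw [map_sub, Presentation.proj_mul] at this
  refine (sub_eq_zero.1 this).trans ?_
  split_ifs
  · rfl
  · exact map_zero _

theorem zero_mul_mul {z : T.𝓑.Alg} (hz : z ∈ T.𝓑comp 0) (x y : T.𝓑.Alg) :
    z * (x * y) = (z * x) * y + x * (z * y) :=
  Presentation.jacobi_zero T.𝓑_isSuper consistent hz x y

theorem h_mul_h (i j : Option (Fin r)) : T.bh i * T.bh j = 0 := by
  have h1 : T.bh j = T.be j * T.bf j := by rw [e_mul_f, if_pos rfl]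
  rw [h1, T.zero_mul_mul (T.h_mem i), h_mul_e, h_mul_f, smul_mul_assoc, mul_neg, mul_smul_comm,
    add_neg_cancel]

theorem f_mul_e_none : T.bf none * T.be none = T.bh none := by
  have h1 := T.𝓑.proj_eq_zero.2 (T.𝓑_isSuper _
    (SuperRel.anti (FreeMagma.of (CGen.e none)) (FreeMagma.of (CGen.f none))))
  simp only [mdeg_of, CGen.par, par, sgn, and_self, if_true, map_add, map_smul,
    Presentation.proj_mul, ← gen_eq_mon] at h1
  have h2 : T.be none * T.bf none + (-1 : 𝕂) • (T.bf none * T.be none) = 0 := h1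
  rw [e_mul_f, if_pos rfl, neg_smul, one_smul] at h2
  exact (eq_neg_of_add_eq_zero_left h2).trans (neg_neg _) |>.symm

/-- The grading element `L = ∑ i, (B⁻¹)₀ᵢ h i`. -/
def L : T.𝓑.Alg := ∑ i, T.B⁻¹ none i • T.bh i

theorem L_mem : T.L ∈ T.𝓑comp 0 :=
  Submodule.sum_mem _ fun i _ => Submodule.smul_mem _ _ (T.h_mem i)

theorem sum_inv (j : Option (Fin r)) : ∑ i, T.B⁻¹ none i * T.B i j = ((deg j : ℤ) : 𝕂) := by
  have h1 := congrFun (congrFun (Matrix.nonsing_inv_mul T.B T.isUnit_det_B) none) j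
  rw [Matrix.mul_apply] at h1
  rw [h1]
  rcases j with _ | j <;> simp [deg]

theorem L_mul_mon (m : FreeMagma (CGen.{u} (Option (Fin r)))) :
    T.L * T.𝓑.proj (mon 𝕂 m) = ((mdeg (CGen.deg deg) m : ℤ) : 𝕂) • T.𝓑.proj (mon 𝕂 m) := by
  induction m using FreeMagma.rec with
  | of x =>
    rw [← gen_eq_mon, mdeg_of]
    cases x with
    | e j =>
      change T.L * T.be j = ((deg j : ℤ) : 𝕂) • T.be j
      rw [L, Finset.sum_mul, ← T.sum_inv j, Finset.sum_smul]
      exact Finset.sum_congr rfl fun i _ => by rw [smul_mul_assoc, h_mul_e, smul_smul]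
    | f j =>
      change T.L * T.bf j = ((-deg j : ℤ) : 𝕂) • T.bf j
      rw [L, Finset.sum_mul, Int.cast_neg, neg_smul, ← T.sum_inv j, Finset.sum_smul,
        ← Finset.sum_neg_distrib]
      exact Finset.sum_congr rfl fun i _ => by rw [smul_mul_assoc, h_mul_f, smul_neg, smul_smul]
    | h j =>
      change T.L * T.bh j = ((0 : ℤ) : 𝕂) • T.bh j
      rw [L, Finset.sum_mul, Int.cast_zero, zero_smul]
      exact Finset.sum_eq_zero fun i _ => by rw [smul_mul_assoc, h_mul_h, smul_zero]
  | mul a b ha hb =>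
    change T.L * T.𝓑.proj (mon 𝕂 (a * b)) =
      ((mdeg (CGen.deg deg) (a * b) : ℤ) : 𝕂) • T.𝓑.proj (mon 𝕂 (a * b))
    rw [mon_mul, Presentation.proj_mul, T.zero_mul_mul T.L_mem, ha, hb, smul_mul_assoc,
      mul_smul_comm, ← add_smul, mdeg_mul, Int.cast_add]

theorem L_mul {n : ℤ} {x : T.𝓑.Alg} (hx : x ∈ T.𝓑comp n) : T.L * x = (n : 𝕂) • x := by
  induction hx using Submodule.span_induction with
  | zero => simp
  | add a b _ _ ha hb => rw [mul_add, smul_add, ha, hb]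
  | smul c a _ ha => rw [mul_smul_comm, ha, smul_comm]
  | mem a ha =>
    obtain ⟨m, rfl, rfl⟩ := ha
    exact T.L_mul_mon m

/-- The linear functional on `𝓑` with `h 0 ↦ 1` and `h i ↦ 0` for `i ∈ I` that vanishes on the
homogeneous elements of nonzero degree in any grading given by degrees of the `e i`. -/
def coeffH0 : T.𝓑.Alg →ₗ[𝕂] 𝕂 := chi T.B par none

theorem coeffH0_mul {x y : T.𝓑.Alg} (hx : x ∈ T.𝓑comp 0) (hy : y ∈ T.𝓑comp 0) :
    T.coeffH0 (x * y) = 0 :=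
  chi_mul T.B par none (by rintro (_ | i) <;> simp [deg]) rfl consistent hx hy

/-- The restriction of the invariant bilinear form to degrees `-1` and `1`. As
`⟨e 0 | f 0⟩ = -⟨f 0 | e 0⟩ = 1`, invariance forces `⟨x | y⟩` to be minus the coefficient of `h 0`
in `⟦x, y⟧`. -/
def form : T.𝓑comp (-1) →ₗ[𝕂] T.𝓑comp 1 →ₗ[𝕂] 𝕂 :=
  -(T.𝓑.compMul (CGen.deg deg) (k := -1) (l := 1) (n := 0) (by norm_num)).compr₂
    (T.coeffH0 ∘ₗ (T.𝓑comp 0).subtype)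

theorem form_apply (x : T.𝓑comp (-1)) (y : T.𝓑comp 1) : T.form x y = -T.coeffH0 (x.1 * y.1) := rfl

variable [CharZero 𝕂]

/-- The local part of `𝓑`, as a contragredient local Lie superalgebra. -/
def 𝓑local : ContragredientLocal 𝕂 where
  toLocalLieSuperalgebra := T.𝓑.localPart T.𝓑_isSuper consistent
  L := ⟨T.L, T.L_mem⟩
  form := T.form
  grading_zero z := Subtype.ext (by
    change T.L * z.1 = 0
    rw [T.L_mul z.2]; simp)
  grading_neg x := Subtype.ext (by
    change T.L * x.1 = -x.1
    rw [T.L_mul x.2]; simp)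
  grading_pos y := Subtype.ext (by
    change T.L * y.1 = y.1
    rw [T.L_mul y.2]; simp)
  invariant x z y := by
    change -T.coeffH0 (-(z.1 * x.1) * y.1) = -T.coeffH0 (x.1 * (z.1 * y.1))
    have h1 := T.coeffH0_mul z.2 (T.𝓑.mul_mem _ (by norm_num : (-1 : ℤ) + 1 = 0) x.2 y.2)
    rw [T.zero_mul_mul z.2, map_add] at h1
    rw [neg_mul, map_neg, eq_neg_of_add_eq_zero_left h1, neg_neg]

/-- The element `e i` of `𝓑₀`, for `i ∈ I`. -/
def e' (i : Fin r) : T.𝓑local.G0 := ⟨T.be (some i), T.e_mem (some i)⟩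
/-- The element `f i` of `𝓑₀`, for `i ∈ I`. -/
def f' (i : Fin r) : T.𝓑local.G0 := ⟨T.bf (some i), by simpa [deg] using T.f_mem (some i)⟩
/-- The element `h i` of `𝓑₀`, for `i ∈ {0} ∪ I`. -/
def h' (i : Option (Fin r)) : T.𝓑local.G0 := ⟨T.bh i, T.h_mem i⟩
/-- The element `f 0` of `𝓑₋₁`. -/
def fo : T.𝓑local.Gm := ⟨T.bf none, T.f_mem none⟩
/-- The element `e 0` of `𝓑₁`. -/
def eo : T.𝓑local.Gp := ⟨T.be none, T.e_mem none⟩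

theorem bpm_eo_fo : T.𝓑local.bpm T.eo T.fo = T.h' none :=
  Subtype.ext (by
    change T.be none * T.bf none = T.bh none
    rw [e_mul_f, if_pos rfl])

theorem form_apply' (x : T.𝓑local.Gm) (y : T.𝓑local.Gp) :
    T.𝓑local.form x y = -T.coeffH0 (x.1 * y.1) := rfl

theorem form_fo_eo : T.𝓑local.form T.fo T.eo = -1 := by
  rw [form_apply']
  change -T.coeffH0 (T.bf none * T.be none) = -1
  rw [f_mul_e_none]
  change -chi T.B par none (T.𝓑.proj (gen 𝕂 (.h none))) = -1
  have := chi_h T.B par none none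
  rw [if_pos rfl] at this
  exact congrArg Neg.neg this

theorem e'_mem (i : Fin r) : inU 𝕂 (T.e' i) ∈ T.𝓑local.cartSub.z := by
  refine T.𝓑local.inU_mem_of_form T.form_fo_eo ?_
  rw [form_apply']
  change -T.coeffH0 (T.bf none * (T.be (some i) * T.be none)) = 0
  rw [neg_eq_zero]
  refine chi_of_deg T.B par none (fun _ => 1) (n := 1) one_ne_zero ?_
  refine Presentation.mul_mem _ _ (k := -1) (l := 2) (by norm_num)
    (Presentation.gen_mem _ _ _ rfl) ?_
  exact Presentation.mul_mem _ _ (k := 1) (l := 1) (by norm_num)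
    (Presentation.gen_mem _ _ _ rfl) (Presentation.gen_mem _ _ _ rfl)

theorem f'_mem (i : Fin r) : inU 𝕂 (T.f' i) ∈ T.𝓑local.cartSub.z := by
  refine T.𝓑local.inU_mem_of_form T.form_fo_eo ?_
  rw [form_apply']
  change -T.coeffH0 (T.bf none * (T.bf (some i) * T.be none)) = 0
  have h1 := Presentation.anti_zero T.𝓑_isSuper consistent (T.f' i).2 (T.be none)
  change T.bf (some i) * T.be none = -(T.be none * T.bf (some i)) at h1
  rw [h1, e_mul_f, if_neg (by simp)]
  simp

theorem h'_mem (i : Option (Fin r)) : inU 𝕂 (T.h' i) ∈ T.𝓑local.cartSub.z := by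
  rcases i with _ | i
  · rw [← bpm_eo_fo]
    exact T.𝓑local.inU_bpm_mem _ _
  · have h1 : T.h' (some i) = T.𝓑local.b00 (T.e' i) (T.f' i) := Subtype.ext (by
      change T.bh (some i) = T.be (some i) * T.bf (some i)
      rw [e_mul_f, if_pos rfl])
    rw [h1]
    exact T.𝓑local.inU_b00_mem (T.e'_mem i) (T.f'_mem i)

/-! #### The cartanification of `𝓑` -/

/-- The cartanification `𝓑^W`. -/
def 𝓑W : Presentation 𝕂 T.𝓑local.localCartanification.Gen := T.𝓑local.cartanification

/-- The local part of `𝓑^W`. -/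
def 𝓑Wlocal : LocalLieSuperalgebra 𝕂 := T.𝓑local.cartanificationLocal

/-- The element `e i` of `𝓑^W`, for `i ∈ I`. -/
def 𝓑We (i : Fin r) : T.𝓑Wlocal.G0 := T.𝓑local.cartZero (T.e' i) (T.e'_mem i)
/-- The element `f i` of `𝓑^W`, for `i ∈ I`. -/
def 𝓑Wf (i : Fin r) : T.𝓑Wlocal.G0 := T.𝓑local.cartZero (T.f' i) (T.f'_mem i)
/-- The element `h i` of `𝓑^W`, for `i ∈ {0} ∪ I`. -/
def 𝓑Wh (i : Option (Fin r)) : T.𝓑Wlocal.G0 := T.𝓑local.cartZero (T.h' i) (T.h'_mem i)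
/-- The element `e 0` of `𝓑^W`. -/
def 𝓑We0 : T.𝓑Wlocal.Gp := T.𝓑local.cartPos T.eo
/-- The element `f 0 h i` of `𝓑^W`, for `i ∈ {0} ∪ I`. -/
def 𝓑Wf0h (i : Option (Fin r)) : T.𝓑Wlocal.Gm := T.𝓑local.cartNeg T.fo (T.h' i)

/-! #### The tensor hierarchy algebra `W` -/

/-- The index in `{0} ∪ I` of an element of `{0} ∪ K`. -/
def idx (k : Option {k : Fin r // T.lam k = 0}) : Option (Fin r) := k.map Subtype.val

/-- The defining relations of `W`. The exponents `1 - B i j` have to be natural numbers; this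
excludes `i = j ∈ I` in the Serre relations. -/
inductive RelW : FreeNA 𝕂 (WGen.{u} T.lam) → Prop
  | ef (i : Option (Fin r)) (j : Fin r) :
      RelW (gen 𝕂 (.e i) * gen 𝕂 (.f j) - if i = some j then gen 𝕂 (.h (some j)) else 0)
  | hf (i : Option (Fin r)) (j : Fin r) :
      RelW (gen 𝕂 (.h i) * gen 𝕂 (.f j) + T.B i (some j) • gen 𝕂 (.f j))
  | he (i j : Option (Fin r)) : RelW (gen 𝕂 (.h i) * gen 𝕂 (.e j) - T.B i j • gen 𝕂 (.e j))
  | e0f0 (i : Option {k : Fin r // T.lam k = 0}) :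
      RelW (gen 𝕂 (.e none) * gen 𝕂 (.f0 i) - gen 𝕂 (.h (T.idx i)))
  | hf0 (i : Option (Fin r)) (j : Option {k : Fin r // T.lam k = 0}) :
      RelW (gen 𝕂 (.h i) * gen 𝕂 (.f0 j) + T.B i none • gen 𝕂 (.f0 j))
  | serre_e (i j : Option (Fin r)) (n : ℕ) (hn : (n : 𝕂) = 1 - T.B i j) :
      RelW ((gen 𝕂 (.e i) * ·)^[n] (gen 𝕂 (.e j)))
  | serre_f (i j : Fin r) (n : ℕ) (hn : (n : 𝕂) = 1 - T.B (some i) (some j)) :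
      RelW ((gen 𝕂 (.f i) * ·)^[n] (gen 𝕂 (.f j)))
  | eff0 (k l : {k : Fin r // T.lam k = 0}) (i : Option {k : Fin r // T.lam k = 0}) :
      RelW (gen 𝕂 (.e (some k)) * (gen 𝕂 (.f l) * gen 𝕂 (.f0 i)) -
        if k = l then T.B (T.idx i) (some l) • gen 𝕂 (.f0 (some k)) else 0)
  | serre_f0 (j : Fin r) (hj : T.lam j ≠ 0) (i : Option {k : Fin r // T.lam k = 0}) (n : ℕ)
      (hn : (n : 𝕂) = 1 - T.B (some j) none) : RelW ((gen 𝕂 (.f j) * ·)^[n] (gen 𝕂 (.f0 i)))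
  | ef0 (j : Fin r) (hj : T.lam j ≠ 0) (i : Option {k : Fin r // T.lam k = 0}) :
      RelW (gen 𝕂 (.e (some j)) * gen 𝕂 (.f0 i))
  | eef0 (k : {k : Fin r // T.lam k = 0}) (i : Option {k : Fin r // T.lam k = 0}) :
      RelW (gen 𝕂 (.e (some k)) * (gen 𝕂 (.e (some k)) * gen 𝕂 (.f0 i)))
  | fff0 (k : {k : Fin r // T.lam k = 0}) (i : Option {k : Fin r // T.lam k = 0}) :
      RelW (gen 𝕂 (.f k) * (gen 𝕂 (.f k) * gen 𝕂 (.f0 i)))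
  | ejf0 (j : Fin r) (hj : T.lam j ≠ 0) (k : {k : Fin r // T.lam k = 0})
      (i : Option {k : Fin r // T.lam k = 0}) :
      RelW (gen 𝕂 (.e (some j)) * (gen 𝕂 (.e (some k)) * gen 𝕂 (.f0 i)))

/-- The Lie superalgebra given by the generators and relations of `W`, without the quotient by the
maximal ideal. -/
def Wtilde : Presentation 𝕂 (WGen.{u} T.lam) := superPresentation (WGen.par T.lam) T.RelW

/-- The tensor hierarchy algebra `W`. -/
def W : Presentation 𝕂 (WGen.{u} T.lam) := T.Wtilde.minimal (WGen.deg T.lam)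

theorem W_isSuper : T.W.IsSuper (WGen.par T.lam) :=
  Presentation.minimal_isSuper (superPresentation_isSuper _ _) _

/-- The local part of `W`, with respect to the consistent `ℤ`-grading. -/
def Wlocal : LocalLieSuperalgebra 𝕂 := T.W.localPart T.W_isSuper (WGen.consistent T.lam)

/-- The generator `e i` of `W`, for `i ∈ I`. -/
def We (i : Fin r) : T.Wlocal.G0 :=
  ⟨T.W.proj (gen 𝕂 (.e (some i))), Presentation.gen_mem _ _ _ rfl⟩
/-- The generator `f i` of `W`, for `i ∈ I`. -/
def Wf (i : Fin r) : T.Wlocal.G0 := ⟨T.W.proj (gen 𝕂 (.f i)), Presentation.gen_mem _ _ _ rfl⟩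
/-- The generator `h i` of `W`, for `i ∈ {0} ∪ I`. -/
def Wh (i : Option (Fin r)) : T.Wlocal.G0 :=
  ⟨T.W.proj (gen 𝕂 (.h i)), Presentation.gen_mem _ _ _ rfl⟩
/-- The generator `e 0` of `W`. -/
def We0 : T.Wlocal.Gp := ⟨T.W.proj (gen 𝕂 (.e none)), Presentation.gen_mem _ _ _ rfl⟩
/-- The generator `f0 i` of `W`, for `i ∈ {0} ∪ K`. -/
def Wf0 (i : Option {k : Fin r // T.lam k = 0}) : T.Wlocal.Gm :=
  ⟨T.W.proj (gen 𝕂 (.f0 i)), Presentation.gen_mem _ _ _ rfl⟩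

/-- The images in `𝓑^W` of the generators of `W`: `f0 i ↦ f 0 h i`, and the other generators are
unchanged. -/
def genImage : WGen.{u} T.lam → T.𝓑W.Alg
  | .e none => T.𝓑We0.1
  | .e (some i) => (T.𝓑We i).1
  | .f i => (T.𝓑Wf i).1
  | .h i => (T.𝓑Wh i).1
  | .f0 i => (T.𝓑Wf0h (T.idx i)).1

/-- The evaluation in `𝓑^W` of an expression in the generators of `W`. -/
def evalW : FreeNA 𝕂 (WGen.{u} T.lam) →ₙₐ[𝕂] T.𝓑W.Alg :=
  FreeNonUnitalNonAssocAlgebra.lift 𝕂 T.genImage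

end Triple

end Cartanification

end

/-! Once every relator of `Wtilde` is known to evaluate to zero in `𝓑W` (`evalW_rel`), the
homomorphism is almost formal. Evaluation factors through `Wtilde` and preserves degrees. The
maximal ideal of `Wtilde` lives in degrees of absolute value at least two, so its image lives in
such degrees as well. In `𝓑W` the element `L` acts by the degree, so these degrees meet the local
part in zero (`disjoint_local`), and evaluation descends to the local part of `W`
(`map_eq_zero_of_minimal`, `exists_localHom`). Uniqueness holds because a graded subalgebra of the
local part that contains the generators is all of it (`comp_le_of_local`, `localHom_ext`).

The relations are checked with explicit brackets: `pairing y x z` is the bracket of y ∈ 𝓑₁ with x z,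
and 𝓑₀ acts on x z by the Leibniz rule. Two principles produce zeros. An element of degree -1 of the
local cartanification vanishes if its brackets with all elements of degree 1 do (`locM_eq_zero`). An
element y of degree 1 has square zero if [[y, X], y] = 0 for all X of degree -1
(`minimalExtension_p_mul_p`). Most relations are then immediate from the Chevalley and Serre
relations of 𝓑, together with [e i, f 0] = 0 for i ∈ I and [f k, f 0] = 0 for k ∈ K.

Pseudo-minusculity enters through a single fact. Let m i be the labels of λ^▲. The form pairs λ with
a root ∑ b i α i to ∑ m i b i (`weightForm_eq`), and a nonzero right-normed bracket of the e i has a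
positive root as its weight. Hence such a bracket vanishes in g when its letters have total m at
least two (`g_word_eq_zero`), and then also in 𝓑, because the relevant part of the maximal ideal for
g is carried into the one for 𝓑 (`map_maxIdeal_le`, `word_eq_zero`). There are three consequences.

If λ j ≠ 0, then f 0 e j = 0 in `𝓑W` (`be_mul_bracket_bf_none`, `cF0_e`). The square of e 0 stays
zero in `𝓑W` (`bracket_bracket_be_none`, `cE0_mul_cE0`). Finally, applying ad f j to f 0 e j = 0
repeatedly shows that ((ad f j)^{λ j} f 0) f j = 0, which is the only obstruction to the Serre
relation for f j and f 0 h i (`cF_serre_cF0_h`). -/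

namespace Cartanification

/-! ### Super laws, grading elements and maximal graded ideals in presented Lie superalgebras. -/

namespace Presentation

section Super

variable {𝕂 : Type u} [Field 𝕂] {X : Type u} {P : Presentation 𝕂 X} {p : X → ZMod 2}

theorem proj_gen_eq (x : X) : P.proj (gen 𝕂 x) = P.proj (mon 𝕂 (FreeMagma.of x)) := rfl

theorem proj_mon_mem {G : Type*} [Add G] (w : X → G) (m : FreeMagma X) :
    P.proj (mon 𝕂 m) ∈ P.comp w (mdeg w m) := Submodule.subset_span ⟨m, rfl, rfl⟩

@[elab_as_elim] theorem comp_induction {G : Type*} [Add G] {w : X → G} {n : G}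
    {Q : (x : P.Alg) → x ∈ P.comp w n → Prop}
    (hm : ∀ m (h : mdeg w m = n), Q (P.proj (mon 𝕂 m)) (h ▸ proj_mon_mem w m))
    (h0 : Q 0 (Submodule.zero_mem _))
    (ha : ∀ x y hx hy, Q x hx → Q y hy → Q (x + y) (Submodule.add_mem _ hx hy))
    (hs : ∀ (c : 𝕂) x hx, Q x hx → Q (c • x) (Submodule.smul_mem _ c hx))
    {x : P.Alg} (hx : x ∈ P.comp w n) : Q x hx := by
  induction hx using Submodule.span_induction with
  | zero => exact h0
  | add a b _ _ h1 h2 => exact ha _ _ _ _ h1 h2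
  | smul c a _ h1 => exact hs _ _ _ h1
  | mem a h1 => obtain ⟨m, h2, rfl⟩ := h1; exact hm m h2

/-- Super-antisymmetry for elements that are homogeneous with respect to the parity. -/
theorem anti_comp (h : P.IsSuper p) {a b : ZMod 2} {x y : P.Alg} (hx : x ∈ P.comp p a)
    (hy : y ∈ P.comp p b) : x * y = -(sgn 𝕂 a b • (y * x)) := by
  induction hx using comp_induction with
  | h0 => simp
  | ha x x' _ _ h1 h2 => rw [add_mul, mul_add, h1, h2, smul_add]; abel
  | hs c x _ h1 => rw [smul_mul_assoc, mul_smul_comm, h1, smul_neg, smul_comm]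
  | hm m hm =>
    induction hy using comp_induction with
    | h0 => simp
    | ha x x' _ _ h1 h2 => rw [add_mul, mul_add, h1, h2, smul_add]; abel
    | hs c x _ h1 => rw [smul_mul_assoc, mul_smul_comm, h1, smul_neg, smul_comm]
    | hm n hn =>
      have := P.proj_eq_zero.2 (h _ (SuperRel.anti m n))
      rw [hm, hn, map_add, map_smul, proj_mul, proj_mul] at this
      exact eq_neg_of_add_eq_zero_left this

/-- The super-Jacobi identity, if the first two elements are homogeneous. -/
theorem jacobi_comp (h : P.IsSuper p) {a b : ZMod 2} {x y : P.Alg} (hx : x ∈ P.comp p a)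
    (hy : y ∈ P.comp p b) (z : P.Alg) :
    x * (y * z) = (x * y) * z + sgn 𝕂 a b • (y * (x * z)) := by
  induction hx using comp_induction with
  | h0 => simp
  | ha x x' _ _ h1 h2 => simp only [add_mul, mul_add, h1, h2, smul_add]; abel
  | hs c x _ h1 => simp only [smul_mul_assoc, mul_smul_comm, h1, smul_add, smul_comm c]
  | hm m hm =>
    induction hy using comp_induction with
    | h0 => simp
    | ha x x' _ _ h1 h2 => simp only [add_mul, mul_add, h1, h2, smul_add]; abel
    | hs c x _ h1 => simp only [smul_mul_assoc, mul_smul_comm, h1, smul_add, smul_comm c]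
    | hm n hn =>
      induction z using P.alg_induction with
      | h0 => simp
      | ha x x' h1 h2 => simp only [mul_add, h1, h2, smul_add]; abel
      | hs c x h1 => simp only [mul_smul_comm, h1, smul_add, smul_comm c]
      | hm k =>
        have := P.proj_eq_zero.2 (h _ (SuperRel.jacobi m n k))
        rw [hm, hn, map_sub, map_add, map_smul] at this
        exact sub_eq_zero.1 this

/-- The Jacobi identity read backwards: left multiplication by a monomial is a polynomial in left
multiplications by generators. This is why closure properties need checking only on generators. -/
theorem jacobi_gen_left (h : P.IsSuper p) (x y : FreeMagma X) (z : P.Alg) :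
    P.proj (mon 𝕂 (x * y)) * z = P.proj (mon 𝕂 x) * (P.proj (mon 𝕂 y) * z) -
      sgn 𝕂 (mdeg p x) (mdeg p y) • (P.proj (mon 𝕂 y) * (P.proj (mon 𝕂 x) * z)) := by
  rw [mon_mul, proj_mul, jacobi_comp h (proj_mon_mem p x) (proj_mon_mem p y)]
  abel

/-- An even factor never produces a sign, so the other argument need not be homogeneous. The same
applies to the Jacobi identity below. -/
theorem even_anti (h : P.IsSuper p) {x : P.Alg} (hx : x ∈ P.comp p 0) (y : P.Alg) :
    x * y = -(y * x) := by
  induction y using P.alg_induction with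
  | h0 => simp
  | ha a b h1 h2 => rw [mul_add, add_mul, h1, h2]; abel
  | hs c a h1 => rw [mul_smul_comm, smul_mul_assoc, h1, smul_neg]
  | hm m =>
    rw [anti_comp h hx (proj_mon_mem p m)]
    simp [sgn]

theorem even_jacobi (h : P.IsSuper p) {x : P.Alg} (hx : x ∈ P.comp p 0) (y z : P.Alg) :
    x * (y * z) = (x * y) * z + y * (x * z) := by
  induction y using P.alg_induction with
  | h0 => simp
  | ha a b h1 h2 => simp only [mul_add, add_mul, h1, h2]; abel
  | hs c a h1 => simp only [mul_smul_comm, smul_mul_assoc, h1, smul_add]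
  | hm m =>
    rw [jacobi_comp h hx (proj_mon_mem p m)]
    simp [sgn]

/-- A family of subspaces that contains the generators and is compatible with left multiplication
by them contains all homogeneous components. -/
theorem comp_le_of_gen_mul (h : P.IsSuper p) {G : Type*} [AddCommMonoid G] {w : X → G}
    {S : G → Submodule 𝕂 P.Alg} (hgen : ∀ x, P.proj (gen 𝕂 x) ∈ S (w x))
    (hmul : ∀ x n, ∀ v ∈ S n, P.proj (gen 𝕂 x) * v ∈ S (w x + n)) (n : G) : P.comp w n ≤ S n := by
  have key : ∀ (m : FreeMagma X) (n : G), ∀ v ∈ S n, P.proj (mon 𝕂 m) * v ∈ S (mdeg w m + n) := by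
    intro m
    induction m using FreeMagma.rec with
    | of x => exact hmul x
    | mul a b ha hb =>
      intro n v hv
      change P.proj (mon 𝕂 (a * b)) * v ∈ S (mdeg w (a * b) + n)
      rw [jacobi_gen_left h, mdeg_mul]
      refine Submodule.sub_mem _ ?_ (Submodule.smul_mem _ _ ?_)
      · rw [add_assoc]; exact ha _ _ (hb _ _ hv)
      · rw [add_comm (mdeg w a), add_assoc]; exact hb _ _ (ha _ _ hv)
  refine Submodule.span_le.2 ?_
  rintro _ ⟨m, rfl, rfl⟩
  induction m using FreeMagma.rec with
  | of x => exact hgen x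
  | mul a b ha hb =>
    change P.proj (mon 𝕂 (a * b)) ∈ S (mdeg w (a * b))
    rw [mon_mul, proj_mul, mdeg_mul]
    exact key a _ _ hb

/-- A subspace stable under left multiplication by the generators is stable under all left
multiplications. -/
theorem mul_mem_of_gen_mul (h : P.IsSuper p) {S : Submodule 𝕂 P.Alg}
    (hmul : ∀ x, ∀ v ∈ S, P.proj (gen 𝕂 x) * v ∈ S) (x : P.Alg) {v : P.Alg} (hv : v ∈ S) :
    x * v ∈ S := by
  induction x using P.alg_induction generalizing v with
  | h0 => simp
  | ha a b h1 h2 => rw [add_mul]; exact S.add_mem (h1 hv) (h2 hv)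
  | hs c a h1 => rw [smul_mul_assoc]; exact S.smul_mem _ (h1 hv)
  | hm m =>
    induction m using FreeMagma.rec generalizing v with
    | of x => exact hmul x v hv
    | mul a b ha hb =>
      change P.proj (mon 𝕂 (a * b)) * v ∈ S
      rw [jacobi_gen_left h]
      exact S.sub_mem (ha (hb hv)) (S.smul_mem _ (hb (ha hv)))

/-- An even element that acts diagonally on the generators acts diagonally on all monomials. -/
theorem mul_mon_of_mul_gen (h : P.IsSuper p) {w : X → ℤ} {d : P.Alg} (hd : d ∈ P.comp p 0)
    (hg : ∀ x, d * P.proj (gen 𝕂 x) = (w x : 𝕂) • P.proj (gen 𝕂 x)) (m : FreeMagma X) :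
    d * P.proj (mon 𝕂 m) = ((mdeg w m : ℤ) : 𝕂) • P.proj (mon 𝕂 m) := by
  induction m using FreeMagma.rec with
  | of x => exact hg x
  | mul a b ha hb =>
    change d * P.proj (mon 𝕂 (a * b)) = ((mdeg w (a * b) : ℤ) : 𝕂) • P.proj (mon 𝕂 (a * b))
    rw [mon_mul, proj_mul, even_jacobi h hd, ha, hb, smul_mul_assoc, mul_smul_comm, ← add_smul,
      mdeg_mul, Int.cast_add]

/-- `d` is a grading element for the degree function `w`. -/
def IsGrading (P : Presentation 𝕂 X) (w : X → ℤ) (d : P.Alg) : Prop :=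
  ∀ m, d * P.proj (mon 𝕂 m) = ((mdeg w m : ℤ) : 𝕂) • P.proj (mon 𝕂 m)

theorem IsGrading.mul_eq {w : X → ℤ} {d : P.Alg} (hd : P.IsGrading w d) {n : ℤ} {x : P.Alg}
    (hx : x ∈ P.comp w n) : d * x = (n : 𝕂) • x := by
  induction hx using comp_induction with
  | h0 => simp
  | ha a b _ _ h1 h2 => rw [mul_add, smul_add, h1, h2]
  | hs c a _ h1 => rw [mul_smul_comm, h1, smul_comm]
  | hm m hm => rw [hd, hm]

/-- The components lie in eigenspaces of left multiplication by `d`, for integer eigenvalues that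
are distinct in characteristic zero. -/
theorem IsGrading.independent [CharZero 𝕂] {w : X → ℤ} {d : P.Alg} (hd : P.IsGrading w d) :
    iSupIndep (P.comp w) := by
  have h1 := Module.End.eigenspaces_iSupIndep (LinearMap.mulLeft 𝕂 d)
  have h2 : iSupIndep fun n : ℤ => Module.End.eigenspace (LinearMap.mulLeft 𝕂 d) (n : 𝕂) :=
    h1.comp Int.cast_injective
  exact h2.mono fun n x hx => Module.End.mem_eigenspace_iff.2 (hd.mul_eq hx)

theorem local_eq_iSup (w : X → ℤ) : P.comp w (-1) ⊔ P.comp w 0 ⊔ P.comp w 1 =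
    ⨆ n ∈ ({-1, 0, 1} : Set ℤ), P.comp w n := by
  rw [iSup_insert, iSup_pair, sup_assoc]

theorem disjoint_local [CharZero 𝕂] {w : X → ℤ} {d : P.Alg} (hd : P.IsGrading w d) :
    Disjoint (P.comp w (-1) ⊔ P.comp w 0 ⊔ P.comp w 1) (⨆ n ∈ {n : ℤ | 2 ≤ |n|}, P.comp w n) := by
  rw [local_eq_iSup]
  refine hd.independent.disjoint_biSup_biSup ?_
  rw [Set.disjoint_left]
  rintro n (rfl | rfl | rfl) hn <;> simp at hn

/-- A graded ideal is the sum of its homogeneous parts, and those of degree -1, 0 and 1 are excluded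
by the trivial intersection with the local part. -/
theorem maxIdeal_le (w : X → ℤ) : P.maxIdeal w ≤ ⨆ n ∈ {n : ℤ | 2 ≤ |n|}, P.comp w n := by
  refine sSup_le ?_
  rintro N ⟨-, hg, hl⟩
  refine hg.trans (iSup_le fun n => ?_)
  by_cases hn : 2 ≤ |n|
  · exact inf_le_right.trans (le_biSup (P.comp w) hn)
  · have h1 : P.comp w n ≤ P.comp w (-1) ⊔ P.comp w 0 ⊔ P.comp w 1 := by
      rw [local_eq_iSup]
      refine le_biSup (P.comp w) ?_
      simp only [Set.mem_insert_iff, Set.mem_singleton_iff]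
      rw [not_le, abs_lt] at hn
      omega
    have h2 : N ⊓ P.comp w n ≤ ⊥ := hl ▸ inf_le_inf_left N h1
    exact h2.trans bot_le

/-- Each summand of the maximal ideal avoids the local part by definition. That their sum does so
too rests on the independence of the components, which the grading element supplies. -/
theorem disjoint_maxIdeal_local [CharZero 𝕂] {w : X → ℤ} {d : P.Alg} (hd : P.IsGrading w d) :
    Disjoint (P.comp w (-1) ⊔ P.comp w 0 ⊔ P.comp w 1) (P.maxIdeal w) :=
  (disjoint_local hd).mono_right (maxIdeal_le w)

/-- A homogeneous subspace of degrees at least two (or, for `s = -1`, at most minus two) that is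
stable under the generators of negative (positive) degree is contained in the maximal graded ideal
intersecting the local part trivially. -/
theorem le_maxIdeal [CharZero 𝕂] (h : P.IsSuper p) {w : X → ℤ} {d : P.Alg} (hd : P.IsGrading w d)
    (s : ℤ) (hs : s = 1 ∨ s = -1)
    (hgen : ∀ x y, s * w x < 0 → 0 ≤ s * w y → P.proj (gen 𝕂 x) * P.proj (gen 𝕂 y) ∈
      Submodule.span 𝕂 (Set.range fun x => P.proj (gen 𝕂 x)))
    {S : Submodule 𝕂 P.Alg}
    (hS : S ≤ ⨆ (g : ZMod 2 × ℤ) (_ : 2 ≤ s * g.2), S ⊓ P.comp (fun x => (p x, w x)) g)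
    (hneg : ∀ x, s * w x < 0 → ∀ v ∈ S, P.proj (gen 𝕂 x) * v ∈ S) : S ≤ P.maxIdeal w := by
  -- `N` is the closure of `S` under the generators with `0 ≤ s * w x`. These never leave the
  -- allowed degrees, so the point is stability under the remaining generators.
  set N : Submodule 𝕂 P.Alg :=
    sInf {M | S ≤ M ∧ ∀ x, 0 ≤ s * w x → ∀ v ∈ M, P.proj (gen 𝕂 x) * v ∈ M} with hN
  have hSN : S ≤ N := le_sInf fun M hM => hM.1
  have hind : ∀ M : Submodule 𝕂 P.Alg, S ≤ M →
      (∀ x, 0 ≤ s * w x → ∀ v ∈ M, P.proj (gen 𝕂 x) * v ∈ M) → N ≤ M :=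
    fun M h1 h2 => sInf_le ⟨h1, h2⟩
  have hpos : ∀ x, 0 ≤ s * w x → ∀ v ∈ N, P.proj (gen 𝕂 x) * v ∈ N := by
    intro x hx v hv
    simp only [hN, Submodule.mem_sInf] at hv ⊢
    exact fun M hM => hM.2 x hx v (hv M hM)
  have hall : ∀ x, ∀ v ∈ N, P.proj (gen 𝕂 x) * v ∈ N := by
    -- `M` is the part of `N` that the lowering generators keep inside `N`. It contains `S`, and it
    -- is closed under the raising ones because x (y v) = [x, y] v ± y (x v), where [x, y] is again
    -- a combination of generators. Hence `M = N`.
    let M : Submodule 𝕂 P.Alg :=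
      N ⊓ ⨅ (x : X) (_ : s * w x < 0), N.comap (LinearMap.mulLeft 𝕂 (P.proj (gen 𝕂 x)))
    have hM : ∀ v, v ∈ M ↔ v ∈ N ∧ ∀ x, s * w x < 0 → P.proj (gen 𝕂 x) * v ∈ N := by
      intro v; simp [M, Submodule.mem_inf, Submodule.mem_iInf]
    have hNM : N ≤ M := by
      refine hind M (fun v hv => (hM v).2 ⟨hSN hv, fun x hx => hSN (hneg x hx v hv)⟩) ?_
      intro y hy v hv
      have hv' := (hM v).1 hv
      refine (hM _).2 ⟨hpos y hy v hv'.1, fun x hx => ?_⟩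
      rw [proj_gen_eq x, proj_gen_eq y, jacobi_comp h (proj_mon_mem p _) (proj_mon_mem p _)]
      refine N.add_mem ?_ (N.smul_mem _ (hpos y hy _ (hv'.2 x hx)))
      have h1 := hgen x y hx hy
      rw [proj_gen_eq x, proj_gen_eq y] at h1
      generalize P.proj (mon 𝕂 (FreeMagma.of x)) * P.proj (mon 𝕂 (FreeMagma.of y)) = u at h1 ⊢
      induction h1 using Submodule.span_induction with
      | zero => simp
      | add a b _ _ h2 h3 => rw [add_mul]; exact N.add_mem h2 h3
      | smul c a _ h2 => rw [smul_mul_assoc]; exact N.smul_mem _ h2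
      | mem a h2 =>
        obtain ⟨t, rfl⟩ := h2
        rcases lt_or_ge (s * w t) 0 with ht | ht
        · exact hv'.2 t ht
        · exact hpos t ht v hv'.1
    intro x v hv
    rcases lt_or_ge (s * w x) 0 with ht | ht
    · exact ((hM v).1 (hNM hv)).2 x ht
    · exact hpos x ht v hv
  have hleft : ∀ x, ∀ v ∈ N, x * v ∈ N := fun x v hv => mul_mem_of_gen_mul h hall x hv
  -- The parity is tracked next to the degree, which need not determine it. Elements of `N` are then
  -- sums of parity-homogeneous ones, and super-antisymmetry turns the left ideal into a two-sided
  -- one.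
  have hgr : N ≤ ⨆ (g : ZMod 2 × ℤ) (_ : 2 ≤ s * g.2),
      N ⊓ P.comp (fun x => (p x, w x)) g := by
    refine hind _ (hS.trans (iSup₂_mono fun g _ => inf_le_inf_right _ hSN)) ?_
    intro y hy
    suffices h1 : (⨆ (g : ZMod 2 × ℤ) (_ : 2 ≤ s * g.2), N ⊓ P.comp (fun x => (p x, w x)) g) ≤
        Submodule.comap (LinearMap.mulLeft 𝕂 (P.proj (gen 𝕂 y)))
          (⨆ (g : ZMod 2 × ℤ) (_ : 2 ≤ s * g.2), N ⊓ P.comp (fun x => (p x, w x)) g) from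
      fun v hv => h1 hv
    refine iSup₂_le fun g hg => ?_
    rintro v ⟨hv, hv'⟩
    refine Submodule.mem_iSup_of_mem ((p y, w y) + g) (Submodule.mem_iSup_of_mem ?_ ⟨?_, ?_⟩)
    · simp only [Prod.snd_add, mul_add]; omega
    · exact hpos y hy v hv
    · exact P.mul_mem _ rfl (gen_mem P (fun x => (p x, w x)) y rfl) hv'
  have hcp : ∀ g : ZMod 2 × ℤ, P.comp (fun x => (p x, w x)) g ≤ P.comp p g.1 := by
    intro g
    refine comp_le_of_gen_mul h (S := fun g : ZMod 2 × ℤ => P.comp p g.1)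
      (fun x => gen_mem P p x rfl) (fun x n v hv => ?_) g
    exact P.mul_mem p rfl (gen_mem P p x rfl) hv
  have hcw : ∀ g : ZMod 2 × ℤ, P.comp (fun x => (p x, w x)) g ≤ P.comp w g.2 := by
    intro g
    refine comp_le_of_gen_mul h (S := fun g : ZMod 2 × ℤ => P.comp w g.2)
      (fun x => gen_mem P w x rfl) (fun x n v hv => ?_) g
    exact P.mul_mem w rfl (gen_mem P w x rfl) hv
  refine hSN.trans (le_sSup ⟨fun x y hy => ⟨hleft x y hy, ?_⟩, ?_, ?_⟩)
  · have h1 : N ≤ N.comap (LinearMap.mulRight 𝕂 x) := by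
      refine hgr.trans (iSup₂_le fun g _ => ?_)
      rintro v ⟨hv, hv'⟩
      change v * x ∈ N
      induction x using P.alg_induction with
      | h0 => simp
      | ha a b h2 h3 => rw [mul_add]; exact N.add_mem h2 h3
      | hs c a h2 => rw [mul_smul_comm]; exact N.smul_mem _ h2
      | hm m =>
        rw [anti_comp h (hcp g hv') (proj_mon_mem p m)]
        exact N.neg_mem (N.smul_mem _ (hleft _ _ hv))
    exact h1 hy
  · refine hgr.trans (iSup₂_le fun g _ => ?_)
    exact le_iSup_of_le g.2 (inf_le_inf_left N (hcw g))
  · have h1 : N ≤ ⨆ n ∈ {n : ℤ | 2 ≤ |n|}, P.comp w n := by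
      refine hgr.trans (iSup₂_le fun g hg => (inf_le_right.trans (hcw g)).trans ?_)
      refine le_biSup (P.comp w) ?_
      change 2 ≤ |g.2|
      rcases hs with rfl | rfl
      · exact (le_abs_self g.2).trans' (by omega)
      · exact (neg_le_abs g.2).trans' (by omega)
    exact ((disjoint_local hd).mono_right h1).symm.eq_bot

end Super

/-! ### Homomorphisms out of presented algebras. -/

section Lift

variable {𝕂 : Type u} [Field 𝕂] {X Y : Type u} {P : Presentation 𝕂 X}

/-- The homomorphism from a presented algebra given by a homomorphism that respects the
relations. -/
noncomputable def lift {A : Type*} [NonUnitalNonAssocRing A] [Module 𝕂 A] (φ : FreeNA 𝕂 X →ₙₐ[𝕂] A)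
    (hφ : ∀ x ∈ P.ideal, φ x = 0) : P.Alg →ₗ[𝕂] A :=
  P.ideal.liftQ (φ : FreeNA 𝕂 X →ₗ[𝕂] A) hφ

theorem lift_proj {A : Type*} [NonUnitalNonAssocRing A] [Module 𝕂 A] (φ : FreeNA 𝕂 X →ₙₐ[𝕂] A)
    (hφ : ∀ x ∈ P.ideal, φ x = 0) (x : FreeNA 𝕂 X) : P.lift φ hφ (P.proj x) = φ x := rfl

theorem lift_mul {A : Type*} [NonUnitalNonAssocRing A] [Module 𝕂 A] (φ : FreeNA 𝕂 X →ₙₐ[𝕂] A)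
    (hφ : ∀ x ∈ P.ideal, φ x = 0) (x y : P.Alg) :
    P.lift φ hφ (x * y) = P.lift φ hφ x * P.lift φ hφ y := by
  obtain ⟨x, rfl⟩ := P.proj_surjective x
  obtain ⟨y, rfl⟩ := P.proj_surjective y
  rw [← proj_mul, lift_proj, lift_proj, lift_proj, map_mul]

theorem map_mon_mem {G : Type*} [Add G] {w : X → G} {w' : Y → G} {P' : Presentation 𝕂 Y}
    (φ : FreeNA 𝕂 X →ₙₐ[𝕂] P'.Alg) (hg : ∀ x, φ (gen 𝕂 x) ∈ P'.comp w' (w x)) (m : FreeMagma X) :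
    φ (mon 𝕂 m) ∈ P'.comp w' (mdeg w m) := by
  induction m using FreeMagma.rec with
  | of x => exact hg x
  | mul a b ha hb =>
    change φ (mon 𝕂 (a * b)) ∈ P'.comp w' (mdeg w (a * b))
    rw [mon_mul, map_mul]
    exact P'.mul_mem w' rfl ha hb

/-- A homomorphism into a Lie superalgebra that preserves parities and respects the defining
relations respects all relations. -/
theorem map_superPresentation_ideal {p : X → ZMod 2} {q : Y → ZMod 2} {P' : Presentation 𝕂 Y}
    (h : P'.IsSuper q) (φ : FreeNA 𝕂 X →ₙₐ[𝕂] P'.Alg)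
    (hg : ∀ x, φ (gen 𝕂 x) ∈ P'.comp q (p x)) {R : FreeNA 𝕂 X → Prop} (hR : ∀ x, R x → φ x = 0) :
    ∀ x ∈ (superPresentation p R).ideal, φ x = 0 := by
  intro x hx
  -- The kernel is one of the ideals containing the relators, and the ideal of the presentation is
  -- the intersection of these.
  have : LinearMap.ker (φ : FreeNA 𝕂 X →ₗ[𝕂] P'.Alg) ∈
      {J : Submodule 𝕂 (FreeNA 𝕂 X) | IsIdeal J ∧
        {x | SuperRel 𝕂 p x ∨ R x} ⊆ (J : Set _)} := by
    refine ⟨fun x y hy => ?_, ?_⟩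
    · have hy : φ y = 0 := hy
      exact ⟨by change φ (x * y) = 0; rw [map_mul, hy, mul_zero],
        by change φ (y * x) = 0; rw [map_mul, hy, zero_mul]⟩
    · rintro x (hx | hx)
      · change φ x = 0
        cases hx with
        | anti a b =>
          simp only [map_add, map_smul, map_mul]
          rw [anti_comp h (map_mon_mem φ hg a) (map_mon_mem φ hg b), neg_add_cancel]
        | jacobi a b c =>
          simp only [map_add, map_smul, map_mul, map_sub]
          rw [jacobi_comp h (map_mon_mem φ hg a) (map_mon_mem φ hg b), sub_self]
      · exact hR x hx
  exact (Submodule.mem_sInf.1 hx) _ this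

theorem minimal_proj_eq_zero {w : X → ℤ} {x : FreeNA 𝕂 X} :
    (P.minimal w).proj x = 0 ↔ P.proj x ∈ P.maxIdeal w := proj_eq_zero _

theorem proj_iterate (x y : FreeNA 𝕂 X) (n : ℕ) :
    P.proj ((x * ·)^[n] y) = (P.proj x * ·)^[n] (P.proj y) := by
  induction n with
  | zero => rfl
  | succ n ih => rw [Function.iterate_succ_apply', Function.iterate_succ_apply', proj_mul, ih]

end Lift

end Presentation

end Cartanification

/-! ### Right-normed brackets, Chevalley pairs and Serre elements. -/

namespace Cartanification

open Presentation

/-- The right-normed bracket `a i₁ (a i₂ (⋯ (a iₙ x)))`. -/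
def word {A N : Type*} [Mul A] (a : N → A) (l : List N) (x : A) : A := l.foldr (fun i v => a i * v) x

section Word

variable {A N : Type*} [Mul A] (a : N → A)

@[simp] theorem word_nil (x : A) : word a [] x = x := rfl
@[simp] theorem word_cons (i : N) (l : List N) (x : A) : word a (i :: l) x = a i * word a l x := rfl
theorem word_append (l l' : List N) (x : A) : word a (l ++ l') x = word a l (word a l' x) :=
  List.foldr_append

end Word

/-- The span of the right-normed brackets in the `a i` of weight `n`, where `a i` has
weight `d i`. -/
def wordSpan {𝕂 A N : Type*} [Field 𝕂] [NonUnitalNonAssocRing A] [Module 𝕂 A] (a : N → A)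
    (d : N → ℤ) (n : ℤ) : Submodule 𝕂 A :=
  Submodule.span 𝕂 {v | ∃ l j, (l.map d).sum + d j = n ∧ word a l (a j) = v}

/-- The span of the elements `h i`, considered as elements of weight zero. -/
def zeroSpan {𝕂 A N : Type*} [Field 𝕂] [NonUnitalNonAssocRing A] [Module 𝕂 A] (h : N → A) (n : ℤ) :
    Submodule 𝕂 A :=
  Submodule.span 𝕂 {v | ∃ i, n = 0 ∧ h i = v}

/-- Two families `a`, `b` of elements of a Lie superalgebra that satisfy the Chevalley relations
with a family `h`. -/
structure ChevalleyPair {𝕂 : Type u} [Field 𝕂] {X : Type u} (P : Presentation 𝕂 X) (p : X → ZMod 2)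
    {N : Type} [DecidableEq N] (q : N → ZMod 2) (a b h : N → P.Alg) (σ : N → 𝕂)
    (c : N → N → 𝕂) : Prop where
  a_mem : ∀ i, a i ∈ P.comp p (q i)
  b_mem : ∀ i, b i ∈ P.comp p (q i)
  h_mem : ∀ i, h i ∈ P.comp p 0
  ha : ∀ i j, h i * a j = c i j • a j
  hb : ∀ i j, h i * b j = -(c i j • b j)
  ba : ∀ i j, b i * a j = if i = j then σ j • h j else 0

namespace ChevalleyPair

variable {𝕂 : Type u} [Field 𝕂] {X : Type u} {P : Presentation 𝕂 X} {p : X → ZMod 2}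
  {N : Type} [DecidableEq N] {q : N → ZMod 2} {a b h : N → P.Alg} {σ : N → 𝕂} {c : N → N → 𝕂}

/-- Exchanging the roles lets each statement about the positive half be reused for the negative one.
The sign in the new `σ` is that of super-antisymmetry, and the weights change sign. -/
theorem swap (hP : P.IsSuper p) (C : ChevalleyPair P p q a b h σ c) :
    ChevalleyPair P p q b a h (fun i => -(sgn 𝕂 (q i) (q i) * σ i)) (fun i j => -c i j) where
  a_mem := C.b_mem
  b_mem := C.a_mem
  h_mem := C.h_mem
  ha i j := by rw [C.hb, neg_smul]
  hb i j := by rw [C.ha, neg_smul, neg_neg]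
  ba i j := by
    rw [anti_comp hP (C.a_mem i) (C.b_mem j), C.ba]
    by_cases hij : i = j
    · subst hij; simp [smul_smul]
    · simp [hij, Ne.symm hij]

variable (hP : P.IsSuper p) (C : ChevalleyPair P p q a b h σ c)
include hP C

theorem h_mul_word {i : N} {x : P.Alg} {t : 𝕂} (hx : h i * x = t • x) (l : List N) :
    h i * word a l x = ((l.map (c i)).sum + t) • word a l x := by
  induction l with
  | nil => simpa using hx
  | cons k l ih =>
    rw [word_cons, even_jacobi hP (C.h_mem i), C.ha, ih, smul_mul_assoc, mul_smul_comm, ← add_smul,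
      List.map_cons, List.sum_cons, add_assoc]

theorem a_mul_h (i j : N) : a i * h j = -(c j i • a i) := by
  rw [← C.ha, even_anti hP (C.h_mem j), neg_neg]

omit hP C [DecidableEq N] in
theorem a_mul_mem_wordSpan (a : N → P.Alg) (d : N → ℤ) {n : ℤ} {v : P.Alg}
    (hv : v ∈ (wordSpan a d n : Submodule 𝕂 P.Alg)) (i : N) :
    a i * v ∈ (wordSpan a d (d i + n) : Submodule 𝕂 P.Alg) := by
  induction hv using Submodule.span_induction with
  | zero => simp
  | add x y _ _ hx hy => rw [mul_add]; exact Submodule.add_mem _ hx hy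
  | smul t x _ hx => rw [mul_smul_comm]; exact Submodule.smul_mem _ _ hx
  | mem x hx =>
    obtain ⟨l, j, rfl, rfl⟩ := hx
    exact Submodule.subset_span ⟨i :: l, j, by simp [add_assoc], rfl⟩

theorem a_mul_mem_of_zeroSpan (d : N → ℤ) {n : ℤ} {v : P.Alg}
    (hv : v ∈ (zeroSpan h n : Submodule 𝕂 P.Alg)) (i : N) :
    a i * v ∈ (wordSpan a d (d i + n) : Submodule 𝕂 P.Alg) := by
  induction hv using Submodule.span_induction with
  | zero => simp
  | add x y _ _ hx hy => rw [mul_add]; exact Submodule.add_mem _ hx hy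
  | smul t x _ hx => rw [mul_smul_comm]; exact Submodule.smul_mem _ _ hx
  | mem x hx =>
    obtain ⟨j, rfl, rfl⟩ := hx
    rw [C.a_mul_h hP]
    exact Submodule.neg_mem _ (Submodule.smul_mem _ _ (Submodule.subset_span ⟨[], i, by simp, rfl⟩))

theorem a_mul_mem_sup (d : N → ℤ) {n : ℤ} {v : P.Alg}
    (hv : v ∈ (wordSpan a d n ⊔ zeroSpan h n : Submodule 𝕂 P.Alg)) (i : N) :
    a i * v ∈ (wordSpan a d (d i + n) : Submodule 𝕂 P.Alg) := by
  obtain ⟨x, hx, y, hy, rfl⟩ := Submodule.mem_sup.1 hv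
  rw [mul_add]
  exact Submodule.add_mem _ (a_mul_mem_wordSpan a d hx i) (C.a_mul_mem_of_zeroSpan hP d hy i)

/-- Moving `b i` to the right through a word leaves, at each matching letter, a multiple of `h i`,
which acts on the rest by its weight. Only a word with a single letter leaves `h i` itself, whence
the second summand. -/
theorem b_mul_mem_sup (d : N → ℤ) {n : ℤ} {v : P.Alg}
    (hv : v ∈ (wordSpan a d n : Submodule 𝕂 P.Alg)) (i : N) :
    b i * v ∈ (wordSpan a d (-d i + n) ⊔ zeroSpan h (-d i + n) : Submodule 𝕂 P.Alg) := by
  induction hv using Submodule.span_induction with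
  | zero => simp
  | add x y _ _ hx hy => rw [mul_add]; exact Submodule.add_mem _ hx hy
  | smul t x _ hx => rw [mul_smul_comm]; exact Submodule.smul_mem _ _ hx
  | mem x hx =>
    obtain ⟨l, j, rfl, rfl⟩ := hx
    induction l with
    | nil =>
      rw [word_nil, C.ba]
      split_ifs with hij
      · subst hij
        exact Submodule.mem_sup_right (Submodule.smul_mem _ _
          (Submodule.subset_span ⟨i, by simp, rfl⟩))
      · exact Submodule.zero_mem _
    | cons k l ih =>
      rw [word_cons, jacobi_comp hP (C.b_mem i) (C.a_mem k), C.ba]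
      refine Submodule.add_mem _ ?_ (Submodule.smul_mem _ _ (Submodule.mem_sup_left ?_))
      · split_ifs with hik
        · subst hik
          rw [smul_mul_assoc, C.h_mul_word hP (C.ha i j)]
          refine Submodule.mem_sup_left (Submodule.smul_mem _ _ (Submodule.smul_mem _ _
            (Submodule.subset_span ⟨l, j, ?_, rfl⟩)))
          simp; ring
        · simp
      · have h1 := C.a_mul_mem_sup hP d ih k
        have e : d k + (-d i + ((l.map d).sum + d j)) =
          -d i + (((k :: l).map d).sum + d j) := by simp; ring
        rwa [e] at h1

theorem h_mul_mem_wordSpan (d : N → ℤ) {n : ℤ} {v : P.Alg}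
    (hv : v ∈ (wordSpan a d n : Submodule 𝕂 P.Alg)) (i : N) :
    h i * v ∈ (wordSpan a d n : Submodule 𝕂 P.Alg) := by
  induction hv using Submodule.span_induction with
  | zero => simp
  | add x y _ _ hx hy => rw [mul_add]; exact Submodule.add_mem _ hx hy
  | smul t x _ hx => rw [mul_smul_comm]; exact Submodule.smul_mem _ _ hx
  | mem x hx =>
    obtain ⟨l, j, rfl, rfl⟩ := hx
    rw [C.h_mul_word hP (C.ha i j)]
    exact Submodule.smul_mem _ _ (Submodule.subset_span ⟨l, j, rfl, rfl⟩)

/-- Up to the nonzero factor `σ j`, the element `h j` is a bracket of two vectors whose weights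
under `h i` cancel. -/
theorem h_mul_h (i j : N) (hσ : σ j ≠ 0) : h i * h j = 0 := by
  have h1 : σ j • h j = b j * a j := by rw [C.ba, if_pos rfl]
  have h2 : h i * (b j * a j) = 0 := by
    rw [even_jacobi hP (C.h_mem i), C.ha, C.hb, neg_mul, smul_mul_assoc, mul_smul_comm,
      neg_add_cancel]
  rw [← h1, mul_smul_comm] at h2
  exact (smul_eq_zero.1 h2).resolve_left hσ

/-- Serre elements are annihilated by the elements `b k`. -/
theorem b_mul_serre [CharZero 𝕂] {i j : N} (hij : i ≠ j) (hq : q i = 0) {n : ℕ} (hn : n ≠ 0)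
    (hc : ((n : 𝕂) - 1) * c i i + 2 * c i j = 0) (h1 : n = 1 → c j i = 0) (k : N) :
    b k * (a i * ·)^[n] (a j) = 0 := by
  have hsgn : ∀ x : ZMod 2, sgn 𝕂 x 0 = 1 := by simp [sgn]
  have ai : a i ∈ P.comp p 0 := hq ▸ C.a_mem i
  have step : ∀ v, b k * (a i * v) = (b k * a i) * v + a i * (b k * v) := by
    intro v
    rw [jacobi_comp hP (C.b_mem k) ai, hsgn, one_smul]
  by_cases hki : k = i
  · subst hki
    have hw : ∀ m : ℕ, h k * (a k * ·)^[m] (a j) =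
        ((m : 𝕂) * c k k + c k j) • (a k * ·)^[m] (a j) := by
      intro m
      induction m with
      | zero => simp [C.ha]
      | succ m ih =>
        rw [Function.iterate_succ_apply', even_jacobi hP (C.h_mem k), C.ha, ih, smul_mul_assoc,
          mul_smul_comm, ← add_smul]
        congr 1; push_cast; ring
    -- The usual sl₂ computation: the weights t · c k k + c k j are summed over t ≤ m, and doubling
    -- clears the denominator. The hypothesis on `n` makes the last factor vanish at `n = m + 1`.
    have key : ∀ m : ℕ, (2 : 𝕂) • (b k * (a k * ·)^[m + 1] (a j)) =
        (σ k * ((m + 1 : 𝕂) * (m * c k k + 2 * c k j))) • (a k * ·)^[m] (a j) := by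
      intro m
      induction m with
      | zero =>
        simp only [zero_add, Function.iterate_one, Function.iterate_zero, id]
        rw [step, C.ba, if_pos rfl, C.ba, if_neg hij, mul_zero, add_zero, smul_mul_assoc, C.ha,
          smul_smul, smul_smul]
        congr 1; push_cast; ring
      | succ m ih =>
        rw [Function.iterate_succ_apply', step, C.ba, if_pos rfl, smul_add,
          ← mul_smul_comm (2 : 𝕂) (a k) (b k * _), ih, smul_mul_assoc, hw, smul_smul, smul_smul, mul_smul_comm]
        rw [(Function.iterate_succ_apply' (a k * ·) m (a j)).symm, ← add_smul]
        congr 1; push_cast; ring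
    obtain ⟨m, rfl⟩ := Nat.exists_eq_succ_of_ne_zero hn
    have h2 := key m
    have h3 : (m : 𝕂) * c k k + 2 * c k j = 0 := by rw [← hc]; push_cast; ring
    rw [h3, mul_zero, mul_zero, zero_smul] at h2
    exact (smul_eq_zero.1 h2).resolve_left two_ne_zero
  -- For `k ≠ i` the elements `b k` and `a i` commute, so only `k = j` can contribute. Then `a i`
  -- sends `h j` to a multiple of `a i` and, at the next application, to zero. For `n = 1` there is
  -- no next application, and the multiple itself has to vanish.
  · have hcomm : ∀ m : ℕ, b k * (a i * ·)^[m] (a j) = (a i * ·)^[m] (b k * a j) := by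
      intro m
      induction m with
      | zero => rfl
      | succ m ih =>
        rw [Function.iterate_succ_apply', Function.iterate_succ_apply', step, C.ba, if_neg hki, ih,
          zero_mul, zero_add]
    have hz : ∀ m : ℕ, (a i * ·)^[m] (0 : P.Alg) = 0 := fun m =>
      Function.iterate_fixed (by simp) m
    rw [hcomm, C.ba]
    split_ifs with hkj
    · subst hkj
      have h3 : a i * (σ k • h k) = -(σ k • c k i • a i) := by
        rw [mul_smul_comm, C.a_mul_h hP, smul_neg]
      obtain ⟨m, rfl⟩ := Nat.exists_eq_succ_of_ne_zero hn
      rw [Function.iterate_succ_apply, h3]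
      rcases m with _ | m
      · rw [h1 rfl]; simp
      · have h4 : a i * a i = 0 := by
          have h5 := even_anti hP ai (a i)
          have h6 : (2 : 𝕂) • (a i * a i) = 0 := by rw [two_smul]; nth_rewrite 1 [h5]; simp
          exact (smul_eq_zero.1 h6).resolve_left two_ne_zero
        rw [Function.iterate_succ_apply, mul_neg, mul_smul_comm, mul_smul_comm, h4, smul_zero,
          smul_zero, neg_zero, hz]
    · exact hz n

end ChevalleyPair

/-! ### Triangular decomposition and Serre relations in contragredient Lie superalgebras. -/

section Contragredient

variable {𝕂 : Type u} [Field 𝕂] {N : Type} [DecidableEq N] {M : Matrix N N 𝕂} {q : N → ZMod 2}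
  {P : Presentation 𝕂 (CGen.{u} N)}

/-- The relations of a contragredient Lie superalgebra are satisfied. -/
def RespectsCartan (M : Matrix N N 𝕂) (P : Presentation 𝕂 (CGen.{u} N)) : Prop :=
  ∀ x, CGen.Rel M x → P.proj x = 0

theorem tilde_respectsCartan : RespectsCartan M (tildeContragredient M q) :=
  fun _ hx => superPresentation_rel _ _ hx

theorem contragredient_respectsCartan : RespectsCartan M (contragredient M q) :=
  fun _ hx => contragredient_rel _ _ hx

theorem tilde_isSuper : (tildeContragredient M q).IsSuper (CGen.par q) :=
  superPresentation_isSuper _ _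

/-- The Chevalley pair `f`, `e`. -/
theorem chevalleyPair_fe (hR : RespectsCartan M P) :
    ChevalleyPair P (CGen.par q) q (fun i => P.proj (gen 𝕂 (.f i)))
      (fun i => P.proj (gen 𝕂 (.e i))) (fun i => P.proj (gen 𝕂 (.h i))) (fun _ => 1)
      (fun i j => -M i j) where
  a_mem i := gen_mem _ _ _ rfl
  b_mem i := gen_mem _ _ _ rfl
  h_mem i := gen_mem _ _ _ rfl
  ha i j := by
    have h1 := hR _ (CGen.Rel.hf i j)
    rw [map_add, map_smul, proj_mul] at h1
    rw [neg_smul]; exact eq_neg_of_add_eq_zero_left h1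
  hb i j := by
    have h1 := hR _ (CGen.Rel.he i j)
    rw [map_sub, map_smul, proj_mul] at h1
    rw [neg_smul, neg_neg]; exact sub_eq_zero.1 h1
  ba i j := by
    have h1 := hR _ (CGen.Rel.ef i j)
    rw [map_sub, proj_mul] at h1
    refine (sub_eq_zero.1 h1).trans ?_
    split_ifs
    · rw [one_smul]
    · exact map_zero _

/-- The Chevalley pair `e`, `f`. -/
theorem chevalleyPair_ef (hP : P.IsSuper (CGen.par q)) (hR : RespectsCartan M P) :
    ChevalleyPair P (CGen.par q) q (fun i => P.proj (gen 𝕂 (.e i)))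
      (fun i => P.proj (gen 𝕂 (.f i))) (fun i => P.proj (gen 𝕂 (.h i)))
      (fun i => -sgn 𝕂 (q i) (q i)) (fun i j => M i j) := by
  simpa using (chevalleyPair_fe (q := q) hR).swap hP

theorem proj_h_mul_h (hP : P.IsSuper (CGen.par q)) (hR : RespectsCartan M P) (i j : N) :
    P.proj (gen 𝕂 (.h i)) * P.proj (gen 𝕂 (.h j)) = 0 :=
  (chevalleyPair_fe (q := q) hR).h_mul_h hP i j one_ne_zero

/-- The triangular decomposition. -/
theorem comp_le_triangular (hP : P.IsSuper (CGen.par q)) (hR : RespectsCartan M P) (d : N → ℤ)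
    (n : ℤ) : P.comp (CGen.deg d) n ≤
      wordSpan (fun i => P.proj (gen 𝕂 (.e i))) d n ⊔
        wordSpan (fun i => P.proj (gen 𝕂 (.f i))) (fun i => -d i) n ⊔
        zeroSpan (fun i => P.proj (gen 𝕂 (.h i))) n := by
  have C := chevalleyPair_ef hP hR
  have C' := chevalleyPair_fe (q := q) hR
  -- It suffices that the sum of the three pieces contains the generators and is stable under them.
  -- Lowering a word stays on its side or drops to the span of the `h i`, from where a generator
  -- leads back to a single letter.
  refine comp_le_of_gen_mul hP (S := fun n => wordSpan (fun i => P.proj (gen 𝕂 (.e i))) d n ⊔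
    wordSpan (fun i => P.proj (gen 𝕂 (.f i))) (fun i => -d i) n ⊔
    zeroSpan (fun i => P.proj (gen 𝕂 (.h i))) n) ?_ ?_ n
  · rintro (i | i | i)
    · exact Submodule.mem_sup_left (Submodule.mem_sup_left
        (Submodule.subset_span ⟨[], i, by simp [CGen.deg], rfl⟩))
    · exact Submodule.mem_sup_left (Submodule.mem_sup_right
        (Submodule.subset_span ⟨[], i, by simp [CGen.deg], rfl⟩))
    · exact Submodule.mem_sup_right (Submodule.subset_span ⟨i, rfl, rfl⟩)
  · intro x n v hv
    obtain ⟨y, hy, z, hz, rfl⟩ := Submodule.mem_sup.1 hv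
    obtain ⟨x', hx', y', hy', rfl⟩ := Submodule.mem_sup.1 hy
    rw [mul_add, mul_add]
    rcases x with i | i | i
    · refine Submodule.add_mem _ (Submodule.add_mem _ ?_ ?_) ?_
      · exact Submodule.mem_sup_left (Submodule.mem_sup_left
          (ChevalleyPair.a_mul_mem_wordSpan _ d hx' i))
      · have := C'.b_mul_mem_sup hP _ hy' i
        rw [neg_neg] at this
        exact SetLike.le_def.1 (sup_le_sup_right le_sup_right _) this
      · exact Submodule.mem_sup_left (Submodule.mem_sup_left (C.a_mul_mem_of_zeroSpan hP d hz i))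
    · refine Submodule.add_mem _ (Submodule.add_mem _ ?_ ?_) ?_
      · exact SetLike.le_def.1 (sup_le_sup_right le_sup_left _) (C.b_mul_mem_sup hP _ hx' i)
      · exact Submodule.mem_sup_left (Submodule.mem_sup_right
          (ChevalleyPair.a_mul_mem_wordSpan _ (fun i => -d i) hy' i))
      · exact Submodule.mem_sup_left (Submodule.mem_sup_right
          (C'.a_mul_mem_of_zeroSpan hP (fun i => -d i) hz i))
    · have e : CGen.deg d (.h i) + n = n := zero_add n
      rw [e]
      refine Submodule.add_mem _ (Submodule.add_mem _ ?_ ?_) ?_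
      · exact Submodule.mem_sup_left (Submodule.mem_sup_left (C.h_mul_mem_wordSpan hP d hx' i))
      · exact Submodule.mem_sup_left (Submodule.mem_sup_right (C'.h_mul_mem_wordSpan hP _ hy' i))
      · have : P.proj (gen 𝕂 (.h i)) * z = 0 := by
          clear hv
          induction hz using Submodule.span_induction with
          | zero => simp
          | add a b _ _ h1 h2 => rw [mul_add, h1, h2, add_zero]
          | smul t a _ h1 => rw [mul_smul_comm, h1, smul_zero]
          | mem a h1 => obtain ⟨j, -, rfl⟩ := h1; exact proj_h_mul_h hP hR i j
        rw [this]
        exact Submodule.zero_mem _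

/-- This feeds the closure argument of `le_maxIdeal`: by the Chevalley relations, a lowering
generator bracketed with a raising one or with some `h j` stays in the span of the generators. -/
theorem gen_mul_gen_mem (hP : P.IsSuper (CGen.par q)) (hR : RespectsCartan M P) (s : ℤ)
    (x y : CGen.{u} N) (hx : s * CGen.deg (fun _ => 1) x < 0) (hy : 0 ≤ s * CGen.deg (fun _ => 1) y) :
    P.proj (gen 𝕂 x) * P.proj (gen 𝕂 y) ∈
      Submodule.span 𝕂 (Set.range fun x => P.proj (gen 𝕂 x)) := by
  have C := chevalleyPair_ef hP hR
  have C' := chevalleyPair_fe (q := q) hR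
  have hmem : ∀ x, P.proj (gen 𝕂 x) ∈
    Submodule.span 𝕂 (Set.range fun x => P.proj (gen 𝕂 x)) := fun x => Submodule.subset_span ⟨x, rfl⟩
  rcases x with i | i | i <;> rcases y with j | j | j <;> simp only [CGen.deg] at hx hy
  · omega
  · rw [C'.ba i j]
    split_ifs
    · exact Submodule.smul_mem _ _ (hmem _)
    · exact Submodule.zero_mem _
  · rw [C.a_mul_h hP i j]
    exact Submodule.neg_mem _ (Submodule.smul_mem _ _ (hmem _))
  · rw [C.ba i j]
    split_ifs
    · exact Submodule.smul_mem _ _ (hmem _)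
    · exact Submodule.zero_mem _
  · omega
  · rw [C'.a_mul_h hP i j]
    exact Submodule.neg_mem _ (Submodule.smul_mem _ _ (hmem _))
  all_goals omega

variable [Fintype N]

/-- If the Cartan matrix is invertible, there is an element that induces the principal grading. -/
theorem exists_isGrading (hM : IsUnit M.det) (hP : P.IsSuper (CGen.par q))
    (hR : RespectsCartan M P) : ∃ d, P.IsGrading (CGen.deg fun _ => 1) d := by
  have C := chevalleyPair_ef hP hR
  have C' := chevalleyPair_fe (q := q) hR
  -- The column sums of the inverse solve `t M = (1, …, 1)`, so that ∑ t i h i acts on every `e j`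
  -- by one.
  set t : N → 𝕂 := fun i => ∑ k, M⁻¹ k i
  have ht : ∀ j, ∑ i, t i * M i j = 1 := by
    intro j
    have h1 : ∀ k, ∑ i, M⁻¹ k i * M i j = if k = j then 1 else 0 := fun k => by
      rw [← Matrix.mul_apply, Matrix.nonsing_inv_mul M hM, Matrix.one_apply]
    simp only [t, Finset.sum_mul]
    rw [Finset.sum_comm]
    simp [h1]
  refine ⟨∑ i, t i • P.proj (gen 𝕂 (.h i)), mul_mon_of_mul_gen hP (Submodule.sum_mem _ fun i _ =>
    Submodule.smul_mem _ _ (C.h_mem i)) ?_⟩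
  rintro (j | j | j) <;> simp only [Finset.sum_mul, smul_mul_assoc, CGen.deg]
  · have h1 : ∀ i, P.proj (gen 𝕂 (.h i)) * P.proj (gen 𝕂 (.e j)) =
      M i j • P.proj (gen 𝕂 (.e j)) := fun i => C.ha i j
    simp only [h1, smul_smul, ← Finset.sum_smul, ht, Int.cast_one]
  · have h1 : ∀ i, P.proj (gen 𝕂 (.h i)) * P.proj (gen 𝕂 (.f j)) =
      -(M i j • P.proj (gen 𝕂 (.f j))) := fun i => C.hb i j
    simp only [h1, smul_neg, smul_smul, Finset.sum_neg_distrib, ← Finset.sum_smul, ht, Int.cast_neg,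
      Int.cast_one, neg_smul]
  · simp [proj_h_mul_h hP hR]

variable [CharZero 𝕂]

/-- Homogeneous elements that are annihilated by the generators of the opposite sign vanish in the
contragredient Lie superalgebra. -/
theorem contragredient_proj_eq_zero (hM : IsUnit M.det) (s : ℤ) (hs : s = 1 ∨ s = -1)
    {x : FreeNA 𝕂 (CGen.{u} N)} {a : ZMod 2} {n : ℤ} (hn : 2 ≤ s * n)
    (hx : (tildeContragredient M q).proj x ∈
      (tildeContragredient M q).comp (fun x => (CGen.par q x, CGen.deg (fun _ => 1) x)) (a, n))
    (hneg : ∀ y, s * CGen.deg (fun _ => 1) y < 0 →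
      (tildeContragredient M q).proj (gen 𝕂 y) * (tildeContragredient M q).proj x = 0) :
    (contragredient M q).proj x = 0 := by
  obtain ⟨d, hd⟩ := exists_isGrading hM (tilde_isSuper (q := q)) tilde_respectsCartan
  refine minimal_proj_eq_zero.2 (le_maxIdeal tilde_isSuper hd s hs
    (gen_mul_gen_mem tilde_isSuper tilde_respectsCartan s)
    (S := Submodule.span 𝕂 {(tildeContragredient M q).proj x}) ?_ ?_
    (Submodule.mem_span_singleton_self _))
  · rw [Submodule.span_singleton_le_iff_mem]
    exact Submodule.mem_iSup_of_mem (a, n) (Submodule.mem_iSup_of_mem hn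
      ⟨Submodule.mem_span_singleton_self _, hx⟩)
  · intro y hy v hv
    obtain ⟨t, rfl⟩ := Submodule.mem_span_singleton.1 hv
    rw [mul_smul_comm, hneg y hy, smul_zero]
    exact Submodule.zero_mem _

omit [DecidableEq N] [Fintype N] [CharZero 𝕂] in
theorem iterate_mem {X : Type u} {P : Presentation 𝕂 X} {G : Type*} [AddCommGroup G] {w : X → G}
    (x y : X) (n : ℕ) :
    (P.proj (gen 𝕂 x) * ·)^[n] (P.proj (gen 𝕂 y)) ∈ P.comp w (n • w x + w y) := by
  induction n with
  | zero => exact gen_mem _ _ _ (by simp)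
  | succ n ih =>
    rw [Function.iterate_succ_apply']
    exact P.mul_mem w (by rw [succ_nsmul']; abel) (gen_mem P w x rfl) ih

/-- The Serre element has degree n + 1 ≥ 2 and is killed by every `f k` already before the quotient
(`b_mul_serre`), so it lies in the maximal ideal. For n = 1, lowering by `f j` leaves a multiple of
`M j i`, which explains the last hypothesis. -/
theorem contragredient_serre_e (hM : IsUnit M.det) {i j : N} (hij : i ≠ j) (hq : q i = 0)
    (hii : M i i = 2) {n : ℕ} (h0 : n ≠ 0) (hn : (n : 𝕂) = 1 - M i j) (h1 : n = 1 → M j i = 0) :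
    (contragredient M q).proj ((gen 𝕂 (.e i) * ·)^[n] (gen 𝕂 (.e j))) = 0 := by
  refine contragredient_proj_eq_zero hM 1 (Or.inl rfl) (n := n + 1) (a := n • q i + q j)
    (by omega) ?_ ?_
  · rw [proj_iterate]
    have h2 := iterate_mem (P := tildeContragredient M q)
      (w := fun x => (CGen.par q x, CGen.deg (fun _ => 1) x)) (CGen.e i) (CGen.e j) n
    have e : n • (q i, (1 : ℤ)) + (q j, (1 : ℤ)) = (n • q i + q j, (n + 1 : ℤ)) := by
      refine Prod.ext rfl ?_
      simp
    exact e ▸ h2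
  · rintro (k | k | k) hk <;> simp only [CGen.deg] at hk
    · omega
    · rw [proj_iterate]
      exact (chevalleyPair_ef tilde_isSuper tilde_respectsCartan).b_mul_serre tilde_isSuper hij hq h0
        (by rw [hii, hn]; ring) h1 k
    · omega

theorem contragredient_serre_f (hM : IsUnit M.det) {i j : N} (hij : i ≠ j) (hq : q i = 0)
    (hii : M i i = 2) {n : ℕ} (h0 : n ≠ 0) (hn : (n : 𝕂) = 1 - M i j) (h1 : n = 1 → M j i = 0) :
    (contragredient M q).proj ((gen 𝕂 (.f i) * ·)^[n] (gen 𝕂 (.f j))) = 0 := by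
  refine contragredient_proj_eq_zero hM (-1) (Or.inr rfl) (n := -(n + 1)) (a := n • q i + q j)
    (by omega) ?_ ?_
  · rw [proj_iterate]
    have h2 := iterate_mem (P := tildeContragredient M q)
      (w := fun x => (CGen.par q x, CGen.deg (fun _ => 1) x)) (CGen.f i) (CGen.f j) n
    have e : n • (q i, (-1 : ℤ)) + (q j, (-1 : ℤ)) = (n • q i + q j, (-(n + 1) : ℤ)) := by
      refine Prod.ext rfl ?_
      simp; ring
    exact e ▸ h2
  · rintro (k | k | k) hk <;> simp only [CGen.deg] at hk
    · rw [proj_iterate]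
      exact (chevalleyPair_fe tilde_respectsCartan).b_mul_serre tilde_isSuper hij hq h0
        (by rw [hii, hn]; ring) (fun h => by rw [h1 h, neg_zero]) k
    · omega
    · omega

/-- Lowering the square by `f o` gives multiples of [h o, e o], which is zero as `M o o = 0`; the
other `f k` commute with `e o`. -/
theorem contragredient_e_mul_e (hM : IsUnit M.det) {o : N} (ho : M o o = 0) :
    (contragredient M q).proj (gen 𝕂 (.e o) * gen 𝕂 (.e o)) = 0 := by
  have hP := tilde_isSuper (M := M) (q := q)
  have C := chevalleyPair_ef hP tilde_respectsCartan
  refine contragredient_proj_eq_zero hM 1 (Or.inl rfl) (n := 1 + 1) (a := q o + q o)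
    (by omega) ?_ ?_
  · rw [proj_mul]
    exact Presentation.mul_mem _ (fun x => (CGen.par q x, CGen.deg (fun _ => 1) x))
      (k := (q o, 1)) (l := (q o, 1)) (Prod.mk_add_mk _ _ _ _) (gen_mem _ _ _ rfl)
      (gen_mem _ _ _ rfl)
  · rintro (k | k | k) hk <;> simp only [CGen.deg] at hk
    · omega
    · rw [proj_mul, jacobi_comp hP (C.b_mem k) (C.a_mem o)]
      have h1 := C.ba k o
      rw [h1]
      split_ifs with hko
      · have h2 := C.ha o o
        have h3 := C.a_mul_h hP o o
        rw [smul_mul_assoc, mul_smul_comm, h2, h3, ho]; simp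
      · simp
    · omega

end Contragredient

end Cartanification

/-! ### Weights of words and the pseudo-minuscule condition. -/

namespace Cartanification

open Presentation

theorem Presentation.comp_le_comp_par {𝕂 : Type u} [Field 𝕂] {X : Type u} (P : Presentation 𝕂 X)
    {p : X → ZMod 2} {w : X → ℤ} (hw : Consistent p w) (n : ℤ) :
    P.comp w n ≤ P.comp p (n : ZMod 2) := by
  refine Submodule.span_le.2 ?_
  rintro _ ⟨m, rfl, rfl⟩
  exact Submodule.subset_span ⟨m, hw.mdeg m, rfl⟩

theorem Presentation.odd_comm {𝕂 : Type u} [Field 𝕂] {X : Type u} {P : Presentation 𝕂 X}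
    {p : X → ZMod 2} (h : P.IsSuper p) {x y : P.Alg} (hx : x ∈ P.comp p 1) (hy : y ∈ P.comp p 1) :
    x * y = y * x := by
  rw [anti_comp h hx hy]; simp [sgn]

theorem Presentation.odd_jacobi {𝕂 : Type u} [Field 𝕂] {X : Type u} {P : Presentation 𝕂 X}
    {p : X → ZMod 2} (h : P.IsSuper p) {x y : P.Alg} (hx : x ∈ P.comp p 1) (hy : y ∈ P.comp p 1)
    (z : P.Alg) : x * (y * z) = (x * y) * z - y * (x * z) := by
  rw [jacobi_comp h hx hy]; simp [sgn, sub_eq_add_neg]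

theorem Presentation.proj_word {𝕂 : Type u} [Field 𝕂] {X : Type u} (P : Presentation 𝕂 X)
    {N : Type*} (a : N → FreeNA 𝕂 X) (l : List N) (x : FreeNA 𝕂 X) :
    P.proj (word a l x) = word (fun i => P.proj (a i)) l (P.proj x) := by
  induction l with
  | nil => rfl
  | cons k l ih => rw [word_cons, word_cons, proj_mul, ih]

theorem word_map {A N N' : Type*} [Mul A] (a : N → A) (f : N' → N) (l : List N') (x : A) :
    word a (l.map f) x = word (fun i => a (f i)) l x := by
  induction l with
  | nil => rfl
  | cons k l ih => rw [List.map_cons, word_cons, word_cons, ih]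

theorem word_smul {𝕂 A N : Type*} [Field 𝕂] [NonUnitalNonAssocRing A] [Module 𝕂 A]
    [SMulCommClass 𝕂 A A] (a : N → A) (l : List N) (c : 𝕂) (x : A) :
    word a l (c • x) = c • word a l x := by
  induction l with
  | nil => rfl
  | cons k l ih => rw [word_cons, word_cons, ih, mul_smul_comm]

/-- Converts weights, expressed by multiplicities of simple roots, into sums over the letters of a
word. -/
theorem sum_mul_count {R : Type*} [Semiring R] {r : ℕ} (f : Fin r → R) (l : List (Fin r)) :
    ∑ k, f k * (l.count k : R) = (l.map f).sum := by
  induction l with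
  | nil => simp
  | cons a l ih =>
    simp only [List.count_cons, Nat.cast_add, mul_add, Finset.sum_add_distrib, ih, List.map_cons,
      List.sum_cons]
    simp [add_comm]

/-- Right-normed brackets that contain a distinguished odd generator at most once. -/
theorem word_mem_span_of_deg {𝕂 : Type u} [Field 𝕂] {X : Type u} {P : Presentation 𝕂 X}
    {p : X → ZMod 2} (hP : P.IsSuper p) {r : ℕ} {a : Option (Fin r) → P.Alg}
    (ha : ∀ i, a (some i) ∈ P.comp p 0) (l : List (Option (Fin r))) (j : Option (Fin r)) :
    ((l.map Triple.deg).sum + Triple.deg j = 0 → word a l (a j) ∈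
      Submodule.span 𝕂 {v | ∃ l' j', word (fun i => a (some i)) l' (a (some j')) = v}) ∧
    ((l.map Triple.deg).sum + Triple.deg j = 1 → word a l (a j) ∈
      Submodule.span 𝕂 {v | ∃ l', word (fun i => a (some i)) l' (a none) = v}) := by
  set E0 := Submodule.span 𝕂 {v | ∃ l' j', word (fun i => a (some i)) l' (a (some j')) = v} with hE0
  set E1 := Submodule.span 𝕂 {v | ∃ l', word (fun i => a (some i)) l' (a none) = v} with hE1
  have c0 : ∀ i, ∀ v ∈ E0, a (some i) * v ∈ E0 := by
    intro i v hv
    induction hv using Submodule.span_induction with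
    | zero => simp
    | add x y _ _ hx hy => rw [mul_add]; exact Submodule.add_mem _ hx hy
    | smul t x _ hx => rw [mul_smul_comm]; exact Submodule.smul_mem _ _ hx
    | mem x hx => obtain ⟨l, j, rfl⟩ := hx; exact Submodule.subset_span ⟨i :: l, j, rfl⟩
  have c1 : ∀ i, ∀ v ∈ E1, a (some i) * v ∈ E1 := by
    intro i v hv
    induction hv using Submodule.span_induction with
    | zero => simp
    | add x y _ _ hx hy => rw [mul_add]; exact Submodule.add_mem _ hx hy
    | smul t x _ hx => rw [mul_smul_comm]; exact Submodule.smul_mem _ _ hx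
    | mem x hx => obtain ⟨l, rfl⟩ := hx; exact Submodule.subset_span ⟨i :: l, rfl⟩
  have even : ∀ u ∈ E0, u ∈ P.comp p 0 := by
    refine fun u hu => Submodule.span_le.2 ?_ hu
    rintro _ ⟨l, j, rfl⟩
    induction l with
    | nil => exact ha j
    | cons k l ih => exact P.mul_mem p (by simp) (ha k) ih
  -- Bracketing with a word of even letters reduces to bracketing with its letters, by the Jacobi
  -- identity read backwards.
  have c01 : ∀ u ∈ E0, ∀ v ∈ E1, u * v ∈ E1 := by
    intro u hu
    induction hu using Submodule.span_induction with
    | zero => simp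
    | add x y _ _ hx hy =>
      intro v hv; rw [add_mul]; exact Submodule.add_mem _ (hx v hv) (hy v hv)
    | smul t x _ hx => intro v hv; rw [smul_mul_assoc]; exact Submodule.smul_mem _ _ (hx v hv)
    | mem x hx =>
      obtain ⟨l, j, rfl⟩ := hx
      induction l with
      | nil => exact c1 j
      | cons k l ih =>
        intro v hv
        rw [word_cons, ← sub_eq_of_eq_add (even_jacobi hP (ha k) _ v)]
        exact Submodule.sub_mem _ (c1 k _ (ih v hv)) (ih _ (c1 k v hv))
  have dn : ∀ k : Option (Fin r), 0 ≤ (Triple.deg k : ℤ) := by rintro (_ | k) <;> simp [Triple.deg]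
  have sn : ∀ l : List (Option (Fin r)), 0 ≤ (l.map Triple.deg).sum := fun l =>
    List.sum_nonneg (by simpa using fun i _ => dn i)
  induction l with
  | nil =>
    rcases j with _ | j
    · simpa [Triple.deg] using (Submodule.subset_span ⟨[], rfl⟩ : a none ∈ E1)
    · simpa [Triple.deg] using (Submodule.subset_span ⟨[], j, rfl⟩ : a (some j) ∈ E0)
  | cons k l ih =>
    have h1 := sn l
    have h2 := dn j
    rcases k with _ | k
    -- The outer letter already uses up the degree, so the remaining word is even and can be
    -- exchanged with it. This brings the odd letter to the innermost place.
    · have e : (((none : Option (Fin r)) :: l).map Triple.deg).sum = 1 + (l.map Triple.deg).sum := rfl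
      rw [e]
      refine ⟨fun h => by omega, fun h => ?_⟩
      have h3 := ih.1 (by omega)
      rw [word_cons, ← neg_neg (a none * _), ← even_anti hP (even _ h3)]
      exact Submodule.neg_mem _ (c01 _ h3 _ (Submodule.subset_span ⟨[], rfl⟩)) |> fun h => by
        simpa using h
    · have e : ((some k :: l).map Triple.deg).sum = (l.map Triple.deg).sum := by
        simp [Triple.deg]
      rw [e]
      exact ⟨fun h => c0 k _ (ih.1 h), fun h => c1 k _ (ih.2 h)⟩

namespace Triple

variable {𝕂 : Type u} [Field 𝕂] {r : ℕ} (T : Triple 𝕂 r)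

theorem isUnit_det_cartan [CharZero 𝕂] : IsUnit T.cartan.det := by
  rw [isUnit_iff_ne_zero]
  have h : T.cartan.det = ((T.A.det : ℤ) : 𝕂) := ((Int.castRingHom 𝕂).map_det T.A).symm
  rw [h]
  exact Int.cast_ne_zero.2 T.A_invertible

/-- The matrix of κ on the Cartan subalgebra is A D and the labels of the root are A b = (A D)(D⁻¹
b). Its inverse returns D⁻¹ b, and the factors ε cancel. -/
theorem weightForm_eq [CharZero 𝕂] (b : Fin r → ℤ) :
    T.weightForm (fun i => T.ε i * T.lamTri i) (fun i => ((T.A.mulVec b) i : ℤ)) =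
      ∑ i, T.lamTri i * b i := by
  have hk : T.kappaH = T.cartan * Matrix.diagonal T.ε := by
    ext i j; simp [kappaH, Matrix.mul_diagonal]
  have hu : IsUnit T.kappaH.det := by
    rw [hk, Matrix.det_mul, Matrix.det_diagonal]
    exact T.isUnit_det_cartan.mul
      (isUnit_iff_ne_zero.2 (Finset.prod_ne_zero_iff.2 fun i _ => T.ε_ne_zero i))
  have h1 : (fun i => (((T.A.mulVec b) i : ℤ) : 𝕂)) =
      T.kappaH.mulVec (fun i => (T.ε i)⁻¹ * b i) := by
    ext i
    simp only [Matrix.mulVec, dotProduct, kappaH, cartan, Matrix.map_apply]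
    push_cast
    refine Finset.sum_congr rfl fun k _ => ?_
    have := T.ε_ne_zero k
    field_simp
  rw [weightForm, h1, Matrix.mulVec_mulVec, Matrix.nonsing_inv_mul _ hu, Matrix.one_mulVec]
  refine Finset.sum_congr rfl fun k _ => ?_
  have := T.ε_ne_zero k
  field_simp

theorem g_isSuper : T.g.IsSuper (CGen.par 0) := contragredient_isSuper _ _

/-- The bracket with `f j` is `h j`, which the functional `chi` separates from zero. -/
theorem g_e_ne_zero (j : Fin r) : T.g.proj (gen 𝕂 (.e j)) ≠ 0 := by
  intro h
  have h1 := contragredient_rel T.cartan 0 (CGen.Rel.ef j j)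
  rw [if_pos rfl, map_sub, proj_mul] at h1
  have h2 : T.g.proj (gen 𝕂 (.e j)) * T.g.proj (gen 𝕂 (.f j)) = T.g.proj (gen 𝕂 (.h j)) :=
    sub_eq_zero.1 h1
  rw [h, zero_mul] at h2
  have h3 := chi_h T.cartan 0 j j
  rw [if_pos rfl] at h3
  have h4 : (contragredient T.cartan 0).proj (gen 𝕂 (.h j)) = 0 := h2.symm
  rw [h4, map_zero] at h3
  exact zero_ne_one h3

/-- The weight of a nonzero right-normed bracket is a root. -/
theorem isRoot_of_word_ne_zero (l : List (Fin r)) (j : Fin r)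
    (h : word (fun i => T.g.proj (gen 𝕂 (.e i))) l (T.g.proj (gen 𝕂 (.e j))) ≠ 0) :
    T.IsRoot fun k => ((j :: l).count k : ℤ) := by
  refine ⟨fun h0 => ?_, _, h, fun i => ?_⟩
  · have h1 := congrFun h0 j
    simp only [List.count_cons_self, Pi.zero_apply] at h1
    push_cast at h1
    omega
  · have C := chevalleyPair_ef T.g_isSuper (contragredient_respectsCartan (M := T.cartan))
    refine (C.h_mul_word T.g_isSuper (C.ha i j) l).trans ?_
    congr 1
    have h1 := sum_mul_count (T.A i) (j :: l)
    simp only [Matrix.mulVec, dotProduct]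
    rw [h1]
    simp [cartan, List.map_map, Function.comp_def, add_comm, Int.cast_list_sum]

variable {T} in
-- If the word were nonzero, its weight would be a positive root. The form of λ with this root is
-- the total of the labels of the letters, which would have to be 0 or 1.
theorem g_word_eq_zero [CharZero 𝕂] (hT : T.IsPseudoMinuscule T.lamTri) {m : Fin r → ℕ}
    (hm : ∀ i, T.lamTri i = m i) (l : List (Fin r)) (j : Fin r)
    (h : 2 ≤ (l.map m).sum + m j) :
    word (fun i => T.g.proj (gen 𝕂 (.e i))) l (T.g.proj (gen 𝕂 (.e j))) = 0 := by
  by_contra h0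
  have h1 := hT.2 _ (T.isRoot_of_word_ne_zero l j h0) (fun i => by positivity)
  rw [T.weightForm_eq] at h1
  have h2 : ∑ i, T.lamTri i * (((j :: l).count i : ℤ) : 𝕂) = (((l.map m).sum + m j : ℕ) : 𝕂) := by
    have h3 := sum_mul_count m (j :: l)
    rw [List.map_cons, List.sum_cons] at h3
    rw [add_comm, ← h3]
    push_cast
    exact Finset.sum_congr rfl fun i _ => by rw [hm]
  rw [h2] at h1
  rcases h1 with h1 | h1
  · have : (l.map m).sum + m j = 0 := by exact_mod_cast h1
    omega
  · have : (l.map m).sum + m j = 1 := by exact_mod_cast h1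
    omega

variable {T} in
-- The case of a single letter: `e j` is nonzero, so its total cannot reach two.
theorem label_le_one [CharZero 𝕂] (hT : T.IsPseudoMinuscule T.lamTri) {m : Fin r → ℕ}
    (hm : ∀ i, T.lamTri i = m i) (j : Fin r) : m j ≤ 1 := by
  by_contra h
  exact T.g_e_ne_zero j (g_word_eq_zero hT hm [] j (by simp; omega))

/-! #### From the Kac-Moody algebra to the contragredient Lie superalgebra -/

/-- The generators of `g`, in the extended Lie superalgebra. -/
def genSome : CGen.{u} (Fin r) → CGen.{u} (Option (Fin r))
  | .e i => .e (some i)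
  | .f i => .f (some i)
  | .h i => .h (some i)

/-- The Lie superalgebra of `B` without the quotient by the maximal ideal. -/
noncomputable abbrev tildeB : Presentation 𝕂 (CGen.{u} (Option (Fin r))) := tildeContragredient T.B par

/-- The Kac-Moody algebra without the quotient by the maximal ideal. -/
noncomputable abbrev tildeG : Presentation 𝕂 (CGen.{u} (Fin r)) := tildeContragredient T.cartan 0

/-- The homomorphism from the free algebra to the extended Lie superalgebra. -/
noncomputable def freeToTildeB : FreeNA 𝕂 (CGen.{u} (Fin r)) →ₙₐ[𝕂] T.tildeB.Alg :=
  FreeNonUnitalNonAssocAlgebra.lift 𝕂 fun x => T.tildeB.proj (gen 𝕂 (genSome x))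

theorem freeToTildeB_gen (x : CGen.{u} (Fin r)) :
    T.freeToTildeB (gen 𝕂 x) = T.tildeB.proj (gen 𝕂 (genSome x)) :=
  FreeNonUnitalNonAssocAlgebra.lift_of_apply 𝕂 _ x

theorem freeToTildeB_ideal : ∀ x ∈ T.tildeG.ideal, T.freeToTildeB x = 0 := by
  refine map_superPresentation_ideal (tilde_isSuper (M := T.B) (q := par)) T.freeToTildeB ?_ ?_
  · intro x
    rw [freeToTildeB_gen]
    exact gen_mem _ _ _ (by cases x <;> rfl)
  · intro x hx
    cases hx with
    | he i j =>
      rw [map_sub, map_smul, map_mul, freeToTildeB_gen, freeToTildeB_gen]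
      have := superPresentation_rel (CGen.par.{u} (par (r := r))) _
        (CGen.Rel.he (M := T.B) (some i) (some j))
      rwa [map_sub, map_smul, proj_mul] at this
    | hf i j =>
      rw [map_add, map_smul, map_mul, freeToTildeB_gen, freeToTildeB_gen]
      have := superPresentation_rel (CGen.par.{u} (par (r := r))) _
        (CGen.Rel.hf (M := T.B) (some i) (some j))
      rwa [map_add, map_smul, proj_mul] at this
    | ef i j =>
      rw [map_sub, map_mul, freeToTildeB_gen, freeToTildeB_gen]
      have := superPresentation_rel (CGen.par.{u} (par (r := r))) _
        (CGen.Rel.ef (M := T.B) (some i) (some j))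
      rw [map_sub, proj_mul] at this
      by_cases hij : i = j
      · subst hij
        rw [if_pos rfl] at this ⊢
        rwa [freeToTildeB_gen]
      · rw [if_neg hij, map_zero]
        rwa [if_neg (by simpa using hij), map_zero] at this

/-- The homomorphism from the Kac-Moody algebra to the extended Lie superalgebra, before taking the
quotients by the maximal ideals. -/
noncomputable def tildeGToB : T.tildeG.Alg →ₗ[𝕂] T.tildeB.Alg :=
  T.tildeG.lift T.freeToTildeB T.freeToTildeB_ideal

theorem tildeGToB_mul (x y : T.tildeG.Alg) :
    T.tildeGToB (x * y) = T.tildeGToB x * T.tildeGToB y := lift_mul _ _ x y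

theorem tildeGToB_gen (x : CGen.{u} (Fin r)) :
    T.tildeGToB (T.tildeG.proj (gen 𝕂 x)) = T.tildeB.proj (gen 𝕂 (genSome x)) :=
  T.freeToTildeB_gen x

theorem tildeGToB_word (l : List (Fin r)) (j : Fin r) :
    T.tildeGToB (word (fun i => T.tildeG.proj (gen 𝕂 (.e i))) l (T.tildeG.proj (gen 𝕂 (.e j)))) =
      word (fun i => T.tildeB.proj (gen 𝕂 (.e (some i)))) l
        (T.tildeB.proj (gen 𝕂 (.e (some j)))) := by
  induction l with
  | nil => exact T.tildeGToB_gen _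
  | cons k l ih => rw [word_cons, word_cons, tildeGToB_mul, ih, tildeGToB_gen]; rfl

variable [CharZero 𝕂]

/-- The image of an ideal of `tildeG` need not be an ideal of `tildeB`, but its part of degree at
least two on the positive side satisfies the lowering criterion of `le_maxIdeal`. The generator `f
none` kills all words in the `e (some i)`, and `f (some i)` stays inside the image, the ideal being
zero in degree one. -/
theorem map_maxIdeal_le :
    (⨆ (n : ℤ) (_ : 2 ≤ n), (T.tildeG.maxIdeal (CGen.deg fun _ => 1) ⊓
      wordSpan (fun i => T.tildeG.proj (gen 𝕂 (.e i))) (fun _ => 1) n).map T.tildeGToB) ≤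
      T.tildeB.maxIdeal (CGen.deg fun _ => 1) := by
  have hP := tilde_isSuper (M := T.B) (q := par)
  have hR := tilde_respectsCartan (M := T.B) (q := par)
  have C := chevalleyPair_ef hP hR
  have hP' := tilde_isSuper (M := T.cartan) (q := 0)
  have C' := chevalleyPair_ef hP' tilde_respectsCartan
  obtain ⟨d, hd⟩ := exists_isGrading T.isUnit_det_B hP hR
  obtain ⟨d', hd'⟩ := exists_isGrading T.isUnit_det_cartan hP' tilde_respectsCartan
  set F : ℤ → Submodule 𝕂 T.tildeB.Alg := fun n => (T.tildeG.maxIdeal (CGen.deg fun _ => 1) ⊓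
      wordSpan (fun i => T.tildeG.proj (gen 𝕂 (.e i))) (fun _ => 1) n).map T.tildeGToB with hF
  have hle : ∀ n, 2 ≤ n → F n ≤ ⨆ (n : ℤ) (_ : 2 ≤ n), F n := fun n hn => le_iSup₂_of_le n hn le_rfl
  refine le_maxIdeal hP hd 1 (Or.inl rfl) (gen_mul_gen_mem hP hR 1) ?_ ?_
  · refine iSup₂_le fun n hn => ?_
    refine le_iSup₂_of_le ((0 : ZMod 2), n) (by simpa using hn) (le_inf (hle n hn) ?_)
    rintro _ ⟨v, ⟨-, hv⟩, rfl⟩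
    suffices h : wordSpan (fun i => T.tildeG.proj (gen 𝕂 (.e i))) (fun _ => 1) n ≤
      Submodule.comap T.tildeGToB (T.tildeB.comp
        (fun x => (CGen.par par x, CGen.deg (fun _ => 1) x)) ((0 : ZMod 2), n)) from h hv
    refine Submodule.span_le.2 ?_
    rintro _ ⟨l, j, rfl, rfl⟩
    rw [SetLike.mem_coe, Submodule.mem_comap]
    clear hv hn
    rw [T.tildeGToB_word]
    induction l with
    | nil => exact gen_mem _ _ _ (by simp [CGen.par, CGen.deg, par])
    | cons k l ih =>
      refine Presentation.mul_mem _ _ ?_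
        (gen_mem T.tildeB (fun x => (CGen.par par x, CGen.deg (fun _ => 1) x)) (.e (some k)) rfl) ih
      ext <;> simp [CGen.par, CGen.deg, par]; ring
  · intro y hy v hv
    suffices h : (⨆ (n : ℤ) (_ : 2 ≤ n), F n) ≤ Submodule.comap
        (LinearMap.mulLeft 𝕂 (T.tildeB.proj (gen 𝕂 y))) (⨆ (n : ℤ) (_ : 2 ≤ n), F n) from h hv
    refine iSup₂_le fun n hn => ?_
    rintro _ ⟨v, ⟨hv, hv'⟩, rfl⟩
    change T.tildeB.proj (gen 𝕂 y) * T.tildeGToB v ∈ ⨆ (n : ℤ) (_ : 2 ≤ n), F n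
    rcases y with i | i | i <;> simp only [CGen.deg] at hy
    · omega
    · rcases i with _ | i
      · have h0 : T.tildeB.proj (gen 𝕂 (.f none)) * T.tildeGToB v = 0 := by
          clear hv
          induction hv' using Submodule.span_induction with
          | zero => simp
          | add x y _ _ hx hy => rw [map_add, mul_add, hx, hy, add_zero]
          | smul t x _ hx => rw [map_smul, mul_smul_comm, hx, smul_zero]
          | mem x hx =>
            obtain ⟨l, j, -, rfl⟩ := hx
            rw [T.tildeGToB_word]
            induction l with
            | nil => exact (C.ba none (some j)).trans (if_neg (by simp))
            | cons k l ih =>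
              rw [word_cons, jacobi_comp hP (C.b_mem none) (C.a_mem (some k)), ih,
                C.ba none (some k), if_neg (by simp)]
              simp
        rw [h0]
        exact Submodule.zero_mem _
      · have h1 : T.tildeB.proj (gen 𝕂 (.f (some i))) = T.tildeGToB (T.tildeG.proj (gen 𝕂 (.f i))) :=
          (T.tildeGToB_gen (.f i)).symm
        rw [h1, ← tildeGToB_mul]
        have h2 := (maxIdeal_isIdeal T.tildeG (CGen.deg fun _ => 1)
          (T.tildeG.proj (gen 𝕂 (.f i))) v hv).1
        have h3 := C'.b_mul_mem_sup hP' _ hv' i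
        have h4 : (zeroSpan (fun i => T.tildeG.proj (gen 𝕂 (.h i))) (-1 + n) :
            Submodule 𝕂 T.tildeG.Alg) = ⊥ := by
          rw [eq_bot_iff]
          refine Submodule.span_le.2 ?_
          rintro _ ⟨i, h, rfl⟩
          omega
        rw [h4, sup_bot_eq] at h3
        -- From degree two, lowering lands in degree one, where the maximal ideal of `tildeG` is
        -- zero. From higher degrees it stays among the subspaces being summed.
        by_cases hn2 : n = 2
        · have h5 : T.tildeG.proj (gen 𝕂 (.f i)) * v ∈
              T.tildeG.comp (CGen.deg fun _ => 1) 1 := by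
            have hle : (wordSpan (fun i => T.tildeG.proj (gen 𝕂 (.e i))) (fun _ => 1) (-1 + n) :
                Submodule 𝕂 T.tildeG.Alg) ≤ T.tildeG.comp (CGen.deg fun _ => 1) 1 := by
              refine Submodule.span_le.2 ?_
              rintro _ ⟨l, j, h, rfl⟩
              have : l = [] := by
                rw [hn2] at h
                simpa using h
              subst this
              exact gen_mem _ _ _ rfl
            exact hle h3
          have h6 := Submodule.disjoint_def.1 (disjoint_maxIdeal_local hd') _
            (Submodule.mem_sup_right h5) h2
          rw [h6, map_zero]
          exact Submodule.zero_mem _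
        · exact hle (-1 + n) (by omega) ⟨_, ⟨h2, h3⟩, rfl⟩
    · omega

/-- Right-normed brackets that vanish in `g` vanish in the contragredient Lie superalgebra. -/
theorem word_eq_zero_of_g (l : List (Fin r)) (hl : l ≠ []) (j : Fin r)
    (h : word (fun i => T.g.proj (gen 𝕂 (.e i))) l (T.g.proj (gen 𝕂 (.e j))) = 0) :
    word (fun i => T.be (some i)) l (T.be (some j)) = 0 := by
  have h1 : T.g.proj (word (fun i => gen 𝕂 (CGen.e i)) l (gen 𝕂 (.e j))) = 0 :=
    (T.g.proj_word _ l _).trans h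
  have h2 : T.tildeG.proj (word (fun i => gen 𝕂 (CGen.e i)) l (gen 𝕂 (.e j))) ∈
    T.tildeG.maxIdeal (CGen.deg fun _ => 1) := minimal_proj_eq_zero.1 h1
  rw [T.tildeG.proj_word] at h2
  have h3 : T.tildeB.proj (word (fun i => gen 𝕂 (CGen.e (some i))) l (gen 𝕂 (.e (some j)))) ∈
      T.tildeB.maxIdeal (CGen.deg fun _ => 1) := by
    refine T.map_maxIdeal_le ?_
    refine Submodule.mem_iSup_of_mem ((l.length : ℤ) + 1) (Submodule.mem_iSup_of_mem ?_
      ⟨_, ⟨h2, Submodule.subset_span ⟨l, j, by simp, rfl⟩⟩, ?_⟩)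
    · have := List.length_pos_iff.2 hl
      omega
    · rw [T.tildeGToB_word, T.tildeB.proj_word]
  have h4 : T.𝓑.proj (word (fun i => gen 𝕂 (CGen.e (some i))) l (gen 𝕂 (.e (some j)))) = 0 :=
    minimal_proj_eq_zero.2 h3
  rwa [T.𝓑.proj_word] at h4

variable {T} in
-- The transfer from g needs at least two letters. This is automatic, since a single label is at
-- most one.
theorem word_eq_zero (hT : T.IsPseudoMinuscule T.lamTri) {m : Fin r → ℕ}
    (hm : ∀ i, T.lamTri i = m i) (l : List (Fin r)) (j : Fin r)
    (h : 2 ≤ (l.map m).sum + m j) :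
    word (fun i => T.be (some i)) l (T.be (some j)) = 0 := by
  refine T.word_eq_zero_of_g l ?_ j (g_word_eq_zero hT hm l j h)
  rintro rfl
  have := label_le_one hT hm j
  simp at h
  omega

end Triple

end Cartanification

/-! ### The components of 𝓑 in the consistent grading. -/

namespace Cartanification

open Presentation

/-- Right-normed brackets of even elements annihilate what all the factors annihilate. -/
theorem word_mul_eq_zero {𝕂 : Type u} [Field 𝕂] {X : Type u} {P : Presentation 𝕂 X}
    {p : X → ZMod 2} (hP : P.IsSuper p) {N : Type*} {a : N → P.Alg} (ha : ∀ i, a i ∈ P.comp p 0)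
    {l : List N} {x v : P.Alg} (hv : ∀ i ∈ l, a i * v = 0) (hx : x * v = 0) :
    word a l x * v = 0 := by
  induction l with
  | nil => exact hx
  | cons k l ih =>
    rw [word_cons, ← sub_eq_of_eq_add (even_jacobi hP (ha k) _ v),
      ih fun i hi => hv i (List.mem_cons_of_mem _ hi), hv k List.mem_cons_self, mul_zero, mul_zero,
      sub_zero]

namespace Triple

variable {𝕂 : Type u} [Field 𝕂] {r : ℕ} (T : Triple 𝕂 r)

theorem pair_ef : ChevalleyPair T.𝓑 (CGen.par par) par T.be T.bf T.bh
    (fun i => -sgn 𝕂 (par i) (par i)) (fun i j => T.B i j) :=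
  chevalleyPair_ef T.𝓑_isSuper contragredient_respectsCartan

theorem pair_fe : ChevalleyPair T.𝓑 (CGen.par par) par T.bf T.be T.bh (fun _ => 1)
    (fun i j => -T.B i j) := chevalleyPair_fe contragredient_respectsCartan

variable {T} in
theorem even_of_comp {z : T.𝓑.Alg} (hz : z ∈ T.𝓑comp 0) : z ∈ T.𝓑.comp (CGen.par par) 0 := by
  simpa using T.𝓑.comp_le_comp_par consistent 0 hz

variable {T} in
theorem odd_of_comp_one {y : T.𝓑.Alg} (hy : y ∈ T.𝓑comp 1) : y ∈ T.𝓑.comp (CGen.par par) 1 := by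
  simpa using T.𝓑.comp_le_comp_par consistent 1 hy

variable {T} in
theorem odd_of_comp_neg_one {x : T.𝓑.Alg} (hx : x ∈ T.𝓑comp (-1)) :
    x ∈ T.𝓑.comp (CGen.par par) 1 := by
  simpa using T.𝓑.comp_le_comp_par consistent (-1) hx

theorem be_some_mem (i : Fin r) : T.be (some i) ∈ T.𝓑comp 0 := T.e_mem (some i)
theorem bf_some_mem (i : Fin r) : T.bf (some i) ∈ T.𝓑comp 0 := by
  simpa [deg] using T.f_mem (some i)
theorem be_none_mem : T.be none ∈ T.𝓑comp 1 := T.e_mem none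
theorem bf_none_mem : T.bf none ∈ T.𝓑comp (-1) := T.f_mem none

theorem sum_map_neg_deg (l : List (Option (Fin r))) :
    (l.map fun i => -(deg i : ℤ)).sum = -(l.map deg).sum := by
  induction l with
  | nil => rfl
  | cons k l ih => simp only [List.map_cons, List.sum_cons, ih]; ring

theorem sum_map_deg_nonneg (l : List (Option (Fin r))) (j : Option (Fin r)) :
    0 ≤ (l.map deg).sum + deg j := by
  have dn : ∀ k : Option (Fin r), 0 ≤ (Triple.deg k : ℤ) := by rintro (_ | k) <;> simp [Triple.deg]
  exact add_nonneg (List.sum_nonneg (by simpa using fun i _ => dn i)) (dn j)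

/-- In the triangular decomposition only words in the e i can have degree one. They contain e 0
exactly once, and this letter can be moved to the innermost place. Degrees -1 and 0 are treated in
the same way. -/
theorem 𝓑comp_one_le : T.𝓑comp 1 ≤
    Submodule.span 𝕂 {v | ∃ l, word (fun i => T.be (some i)) l (T.be none) = v} := by
  refine (comp_le_triangular T.𝓑_isSuper contragredient_respectsCartan deg 1).trans
    (sup_le (sup_le ?_ ?_) ?_)
  · refine Submodule.span_le.2 ?_
    rintro _ ⟨l, j, h, rfl⟩
    exact (word_mem_span_of_deg T.𝓑_isSuper (fun i => T.pair_ef.a_mem (some i)) l j).2 h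
  · refine Submodule.span_le.2 ?_
    rintro _ ⟨l, j, h, rfl⟩
    have := sum_map_deg_nonneg l j
    simp only [sum_map_neg_deg] at h
    omega
  · refine Submodule.span_le.2 ?_
    rintro _ ⟨i, h, rfl⟩
    omega

theorem 𝓑comp_neg_one_le : T.𝓑comp (-1) ≤
    Submodule.span 𝕂 {v | ∃ l, word (fun i => T.bf (some i)) l (T.bf none) = v} := by
  refine (comp_le_triangular T.𝓑_isSuper contragredient_respectsCartan deg (-1)).trans
    (sup_le (sup_le ?_ ?_) ?_)
  · refine Submodule.span_le.2 ?_
    rintro _ ⟨l, j, h, rfl⟩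
    have := sum_map_deg_nonneg l j
    omega
  · refine Submodule.span_le.2 ?_
    rintro _ ⟨l, j, h, rfl⟩
    simp only [sum_map_neg_deg] at h
    exact (word_mem_span_of_deg T.𝓑_isSuper (fun i => T.pair_fe.a_mem (some i)) l j).2 (by omega)
  · refine Submodule.span_le.2 ?_
    rintro _ ⟨i, h, rfl⟩
    omega

theorem 𝓑comp_zero_le : T.𝓑comp 0 ≤
    Submodule.span 𝕂 {v | ∃ l j, word (fun i => T.be (some i)) l (T.be (some j)) = v} ⊔
    Submodule.span 𝕂 {v | ∃ l j, word (fun i => T.bf (some i)) l (T.bf (some j)) = v} ⊔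
    Submodule.span 𝕂 (Set.range T.bh) := by
  refine (comp_le_triangular T.𝓑_isSuper contragredient_respectsCartan deg 0).trans
    (sup_le_sup (sup_le_sup ?_ ?_) ?_)
  · refine Submodule.span_le.2 ?_
    rintro _ ⟨l, j, h, rfl⟩
    exact (word_mem_span_of_deg T.𝓑_isSuper (fun i => T.pair_ef.a_mem (some i)) l j).1 h
  · refine Submodule.span_le.2 ?_
    rintro _ ⟨l, j, h, rfl⟩
    simp only [sum_map_neg_deg] at h
    exact (word_mem_span_of_deg T.𝓑_isSuper (fun i => T.pair_fe.a_mem (some i)) l j).1 (by omega)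
  · refine Submodule.span_le.2 ?_
    rintro _ ⟨i, h, rfl⟩
    exact Submodule.subset_span ⟨i, rfl⟩

/-! #### Relations in the contragredient Lie superalgebra -/

theorem B_offdiag (i : Fin r) (j : Option (Fin r)) (hij : some i ≠ j) :
    ∃ k : ℕ, T.B (some i) j = -(k : 𝕂) := by
  rcases j with _ | j
  · exact ⟨T.lam i, rfl⟩
  · have h := T.A_offdiag i j (by simpa using hij)
    refine ⟨(-T.A i j).toNat, ?_⟩
    have h1 : (((-T.A i j).toNat : ℤ) : 𝕂) = ((-T.A i j : ℤ) : 𝕂) := by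
      rw [Int.toNat_of_nonneg (by omega)]
    rw [Int.cast_natCast] at h1
    rw [h1]
    simp [B, extendMatrix, cartan]

variable [CharZero 𝕂]

theorem B_symm_zero (i : Fin r) (j : Option (Fin r)) (h : T.B (some i) j = 0) :
    T.B j (some i) = 0 := by
  rcases j with _ | j
  · have h1 : T.lam i = 0 := by simpa [B, extendMatrix] using h
    simp [B, extendMatrix, lamTri, h1]
  · have h1 : T.A i j = 0 := by simpa [B, extendMatrix, cartan] using h
    simp [B, extendMatrix, cartan, T.A_zero i j h1]

/-- These are the side conditions of the Serre relations: off-diagonal entries of rows in I are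
nonpositive integers, so the exponent is positive, and it is one only for a zero entry, whose
transpose is then zero too. -/
theorem serre_exponent {i : Fin r} {j : Option (Fin r)} (hij : some i ≠ j) {n : ℕ}
    (hn : (n : 𝕂) = 1 - T.B (some i) j) : n ≠ 0 ∧ (n = 1 → T.B j (some i) = 0) := by
  obtain ⟨k, hk⟩ := T.B_offdiag i j hij
  have h1 : n = 1 + k := by
    rw [hk] at hn
    have : (n : 𝕂) = ((1 + k : ℕ) : 𝕂) := by rw [hn]; push_cast; ring
    exact_mod_cast this
  refine ⟨by omega, fun h => T.B_symm_zero i j ?_⟩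
  have : k = 0 := by omega
  rw [hk, this]; simp

theorem B_diag (i : Fin r) : T.B (some i) (some i) = 2 := by
  simp [B, extendMatrix, cartan, T.A_diag]

theorem be_serre {i : Fin r} {j : Option (Fin r)} (hij : some i ≠ j) {n : ℕ}
    (hn : (n : 𝕂) = 1 - T.B (some i) j) : (T.be (some i) * ·)^[n] (T.be j) = 0 := by
  obtain ⟨h0, h1⟩ := T.serre_exponent hij hn
  have := contragredient_serre_e T.isUnit_det_B (q := par) hij rfl (T.B_diag i) h0 hn h1
  rwa [proj_iterate] at this

theorem bf_serre {i : Fin r} {j : Option (Fin r)} (hij : some i ≠ j) {n : ℕ}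
    (hn : (n : 𝕂) = 1 - T.B (some i) j) : (T.bf (some i) * ·)^[n] (T.bf j) = 0 := by
  obtain ⟨h0, h1⟩ := T.serre_exponent hij hn
  have := contragredient_serre_f T.isUnit_det_B (q := par) hij rfl (T.B_diag i) h0 hn h1
  rwa [proj_iterate] at this

theorem be_none_mul_self : T.be none * T.be none = 0 := by
  have := contragredient_e_mul_e T.isUnit_det_B (q := par) (o := none) rfl
  rwa [proj_mul] at this

/-- For k ∈ K the entry B k 0 = -λ k vanishes, so the Serre exponent is one. The same holds for the
f's. -/
theorem be_mul_be_none {k : Fin r} (hk : T.lam k = 0) : T.be (some k) * T.be none = 0 :=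
  T.be_serre (n := 1) (by simp) (by simp [B, extendMatrix, hk])

theorem bf_mul_bf_none {k : Fin r} (hk : T.lam k = 0) : T.bf (some k) * T.bf none = 0 :=
  T.bf_serre (n := 1) (by simp) (by simp [B, extendMatrix, hk])

theorem be_mul_bf_none (k : Fin r) : T.be (some k) * T.bf none = 0 := by
  rw [e_mul_f, if_neg (by simp)]

theorem bf_mul_be_none (k : Fin r) : T.bf (some k) * T.be none = 0 := by
  have := T.pair_ef.ba (some k) none
  rwa [if_neg (by simp)] at this

theorem lamTri_eq_zero_iff (i : Fin r) : T.lamTri i = 0 ↔ T.lam i = 0 := by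
  simp [lamTri, T.ε_ne_zero i]

theorem coeffH0_h (i : Option (Fin r)) : T.coeffH0 (T.bh i) = if i = none then 1 else 0 :=
  chi_h T.B par none i

/-- The functional kills brackets inside degree zero, in particular [z, [y, x]]; the Jacobi identity
does the rest. -/
theorem coeffH0_invariant {z y x : T.𝓑.Alg} (hz : z ∈ T.𝓑comp 0) (hy : y ∈ T.𝓑comp 1)
    (hx : x ∈ T.𝓑comp (-1)) : T.coeffH0 ((z * y) * x) = -T.coeffH0 (y * (z * x)) := by
  have h1 := T.coeffH0_mul hz (T.𝓑.mul_mem _ (by norm_num : (1 : ℤ) + -1 = 0) hy hx)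
  rw [T.zero_mul_mul hz, map_add] at h1
  exact eq_neg_of_add_eq_zero_left h1

variable {T}

/-! ### Identities in 𝓑 forced by the pseudo-minuscule condition. -/

section PseudoMinuscule

variable (hT : T.IsPseudoMinuscule T.lamTri) {m : Fin r → ℕ} (hm : ∀ i, T.lamTri i = m i)
include hT hm

/-- The element `f₀ e j` is peripheral if `λ j ≠ 0`. -/
theorem be_mul_bracket_bf_none {j : Fin r} (hj : T.lam j ≠ 0) {y : T.𝓑.Alg} (hy : y ∈ T.𝓑comp 1) :
    T.be (some j) * (y * T.bf none) = T.coeffH0 (y * T.bf none) • T.be (some j) := by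
  have hmj : m j = 1 := by
    have h1 := label_le_one hT hm j
    have h2 : m j ≠ 0 := fun h => hj ((T.lamTri_eq_zero_iff j).1 (by rw [hm, h, Nat.cast_zero]))
    omega
  have he : ∀ i, T.be (some i) * T.bh none = (m i : 𝕂) • T.be (some i) := by
    intro i
    rw [T.pair_ef.a_mul_h T.𝓑_isSuper]
    simp [B, extendMatrix, hm]
  have hy' := T.𝓑comp_one_le hy
  clear hy
  induction hy' using Submodule.span_induction with
  | zero => simp
  | add a b _ _ ha hb => simp only [add_mul, mul_add, map_add, add_smul, ha, hb]
  | smul c a _ ha => simp only [smul_mul_assoc, mul_smul_comm, map_smul, smul_assoc, ha]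
  | mem a ha =>
    obtain ⟨l, rfl⟩ := ha
    -- All e i with i ∈ I commute with f 0, so bracketing with f 0 only turns the innermost e 0 into
    -- h 0.
    have h1 : word (fun i => T.be (some i)) l (T.be none) * T.bf none =
        word (fun i => T.be (some i)) l (T.bh none) := by
      induction l with
      | nil => rw [word_nil, word_nil, e_mul_f, if_pos rfl]
      | cons k l ih =>
        rw [word_cons, word_cons, ← ih, T.zero_mul_mul (T.be_some_mem k), be_mul_bf_none, mul_zero,
          add_zero]
    rw [h1]
    -- For the empty word both sides are e j, since m j = 1. Otherwise the innermost letter e i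
    -- turns h 0 into m i e i and the coefficient on the right is zero. On the left, either m i = 0
    -- or the word that starts with e j and ends with e i has total at least two.
    rcases List.eq_nil_or_concat l with rfl | ⟨l, i, rfl⟩
    · rw [word_nil, he, coeffH0_h, if_pos rfl, hmj, Nat.cast_one]
    · have h2 : word (fun i => T.be (some i)) (l ++ [i]) (T.bh none) =
          (m i : 𝕂) • word (fun i => T.be (some i)) l (T.be (some i)) := by
        rw [word_append, word_cons, word_nil, he, word_smul]
      have h3 : T.coeffH0 (word (fun i => T.be (some i)) (l ++ [i]) (T.bh none)) = 0 := by
        have h4 : ∀ l : List (Fin r), word (fun i => T.be (some i)) l (T.bh none) ∈ T.𝓑comp 0 := by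
          intro l
          induction l with
          | nil => exact T.h_mem none
          | cons k l ih => exact T.𝓑.mul_mem _ (by norm_num) (T.be_some_mem k) ih
        rcases h5 : l ++ [i] with _ | ⟨k, l'⟩
        · simp at h5
        · exact T.coeffH0_mul (T.be_some_mem k) (h4 l')
      rw [List.concat_eq_append, h3, h2, mul_smul_comm, zero_smul]
      rcases Nat.eq_zero_or_pos (m i) with h4 | h4
      · rw [h4]; simp
      · have h5 := word_eq_zero hT hm (j :: l) i (by simp; omega)
        rw [word_cons] at h5
        rw [h5, smul_zero]

/-- Checked on the three pieces of 𝓑₀. Words in the f i commute with e 0, and for h i both sides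
vanish. For a word z in the e i of total M, the claim is [z, e 0] = M [z, e 0]: if M = 0 all letters
commute with e 0, if M = 1 there is nothing to show, and if M ≥ 2 then z = 0. -/
theorem bh_none_mul_bracket {z : T.𝓑.Alg} (hz : z ∈ T.𝓑comp 0) :
    z * T.be none - T.coeffH0 ((z * T.be none) * T.bf none) • T.be none =
      -(T.bh none * (z * T.be none)) := by
  have hB0 : ∀ j, T.B none (some j) = -(m j : 𝕂) := fun j => by simp [B, extendMatrix, hm]
  obtain ⟨y, hy, t, ht, rfl⟩ := Submodule.mem_sup.1 (T.𝓑comp_zero_le hz)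
  obtain ⟨a, ha, b, hb, rfl⟩ := Submodule.mem_sup.1 hy
  clear hz hy
  have key : ∀ z₁ z₂ : T.𝓑.Alg,
      z₁ * T.be none - T.coeffH0 ((z₁ * T.be none) * T.bf none) • T.be none =
        -(T.bh none * (z₁ * T.be none)) →
      z₂ * T.be none - T.coeffH0 ((z₂ * T.be none) * T.bf none) • T.be none =
        -(T.bh none * (z₂ * T.be none)) →
      (z₁ + z₂) * T.be none - T.coeffH0 (((z₁ + z₂) * T.be none) * T.bf none) • T.be none =
        -(T.bh none * ((z₁ + z₂) * T.be none)) := by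
    intro z₁ z₂ h1 h2
    simp only [add_mul, mul_add, map_add, add_smul, neg_add, ← h1, ← h2]
    abel
  have keys : ∀ (c : 𝕂) (z : T.𝓑.Alg),
      z * T.be none - T.coeffH0 ((z * T.be none) * T.bf none) • T.be none =
        -(T.bh none * (z * T.be none)) →
      (c • z) * T.be none - T.coeffH0 (((c • z) * T.be none) * T.bf none) • T.be none =
        -(T.bh none * ((c • z) * T.be none)) := by
    intro c z h1
    simp only [smul_mul_assoc, mul_smul_comm, map_smul, smul_assoc, ← smul_neg, ← h1, smul_sub]
  refine key _ _ (key _ _ ?_ ?_) ?_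
  · induction ha using Submodule.span_induction with
    | zero => simp
    | add a b _ _ ha hb => exact key _ _ ha hb
    | smul c a _ ha => exact keys _ _ ha
    | mem z h =>
      obtain ⟨l, j, rfl⟩ := h
      set z := word (fun i => T.be (some i)) l (T.be (some j)) with hz
      have hz0 : z ∈ T.𝓑comp 0 := by
        rw [hz]; clear hz z
        induction l with
        | nil => exact T.be_some_mem j
        | cons k l ih => exact T.𝓑.mul_mem _ (by norm_num) (T.be_some_mem k) ih
      have hh : T.bh none * z = -(((l.map m).sum + m j : ℕ) : 𝕂) • z := by
        have C : ChevalleyPair T.𝓑 (CGen.par par) _ T.be T.bf T.bh _ _ := T.pair_ef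
        have h1 := C.h_mul_word T.𝓑_isSuper (C.ha none (some j)) (l.map some)
        rw [word_map] at h1
        rw [hz, h1]
        congr 1
        rw [List.map_map, hB0]
        have : (l.map ((fun j => T.B none j) ∘ some)).sum = -(((l.map m).sum : ℕ) : 𝕂) := by
          clear hz hz0 z h1
          induction l with
          | nil => simp
          | cons k l ih =>
            rw [List.map_cons, List.sum_cons, ih, List.map_cons, List.sum_cons, Function.comp_apply,
              hB0]
            push_cast; ring
        rw [this]; push_cast; ring
      have hf : z * T.bf none = 0 := word_mul_eq_zero T.𝓑_isSuper
        (fun i => even_of_comp (T.be_some_mem i)) (fun i _ => T.be_mul_bf_none i)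
        (T.be_mul_bf_none j)
      -- Invariance moves `z` onto f 0, with which all its letters commute.
      have hc : T.coeffH0 ((z * T.be none) * T.bf none) = 0 := by
        rw [T.coeffH0_invariant hz0 T.be_none_mem T.bf_none_mem, hf]; simp
      rw [hc, zero_smul, sub_zero, T.zero_mul_mul (T.h_mem none), hh]
      have hB00 : T.bh none * T.be none = 0 := by
        rw [h_mul_e]; simp [B, extendMatrix]
      rw [hB00, mul_zero, add_zero]
      by_cases h0 : (l.map m).sum + m j = 0
      · have h1 : z * T.be none = 0 := by
          have h2 : ∀ i, m i = 0 → T.be (some i) * T.be none = 0 := fun i hi =>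
            T.be_mul_be_none ((T.lamTri_eq_zero_iff i).1 (by rw [hm, hi, Nat.cast_zero]))
          refine word_mul_eq_zero T.𝓑_isSuper (fun i => even_of_comp (T.be_some_mem i))
            (fun i hi => h2 i ?_) (h2 j (by omega))
          have h3 : m i ≤ (l.map m).sum := List.single_le_sum (by simp) _ (List.mem_map_of_mem hi)
          omega
        rw [smul_mul_assoc, h1]; simp
      · by_cases h1 : (l.map m).sum + m j = 1
        · rw [h1]; simp
        · have h2 : z = 0 := word_eq_zero hT hm l j (by omega)
          simp [h2]
  · induction hb using Submodule.span_induction with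
    | zero => simp
    | add a b _ _ ha hb => exact key _ _ ha hb
    | smul c a _ ha => exact keys _ _ ha
    | mem z h =>
      obtain ⟨l, j, rfl⟩ := h
      have h1 : word (fun i => T.bf (some i)) l (T.bf (some j)) * T.be none = 0 :=
        word_mul_eq_zero T.𝓑_isSuper (fun i => even_of_comp (T.bf_some_mem i))
          (fun i _ => T.bf_mul_be_none i) (T.bf_mul_be_none j)
      simp [h1]
  · induction ht using Submodule.span_induction with
    | zero => simp
    | add a b _ _ ha hb => exact key _ _ ha hb
    | smul c a _ ha => exact keys _ _ ha
    | mem z h =>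
      obtain ⟨i, rfl⟩ := h
      have hB00 : T.bh none * T.be none = 0 := by
        rw [h_mul_e]; simp [B, extendMatrix]
      rw [h_mul_e, smul_mul_assoc, map_smul, e_mul_f, if_pos rfl, coeffH0_h, if_pos rfl,
        mul_smul_comm, hB00]
      simp

/-- The identity behind the vanishing of `⟦⟦x z, e₀⟧, e₀⟧` in the cartanification. -/
theorem bracket_bracket_be_none {x : T.𝓑.Alg} (hx : x ∈ T.𝓑comp (-1)) {z : T.𝓑.Alg}
    (hz : z ∈ T.𝓑comp 0) :
    ((z * T.be none) * x) * T.be none =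
      T.coeffH0 (T.be none * x) • (z * T.be none) -
        T.coeffH0 ((z * T.be none) * x) • T.be none := by
  have hP := T.𝓑_isSuper
  have he := T.be_none_mem
  have hze : ∀ {z : T.𝓑.Alg}, z ∈ T.𝓑comp 0 → z * T.be none ∈ T.𝓑comp 1 := fun hz =>
    T.𝓑.mul_mem _ (by norm_num) hz he
  have hx' := T.𝓑comp_neg_one_le hx
  clear hx
  induction hx' using Submodule.span_induction with
  | zero => simp
  | add a b _ _ ha hb => simp only [add_mul, mul_add, map_add, add_smul, ha, hb]; abel
  | smul c a _ ha => simp only [smul_mul_assoc, mul_smul_comm, map_smul, smul_assoc, ha, smul_sub]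
  | mem a ha =>
    obtain ⟨l, rfl⟩ := ha
    induction l generalizing z with
    | nil =>
      rw [word_nil]
      -- Twice this element is [z, [e 0, e 0]], and e 0 has square zero in 𝓑.
      have h1 : (z * T.be none) * T.be none = 0 := by
        have h2 := T.zero_mul_mul hz (T.be none) (T.be none)
        rw [be_none_mul_self, mul_zero,
          odd_comm hP (odd_of_comp_one he) (odd_of_comp_one (hze hz)), ← two_smul 𝕂] at h2
        exact (smul_eq_zero.1 h2.symm).resolve_left two_ne_zero
      have h2 := odd_jacobi hP (odd_of_comp_one (hze hz)) (odd_of_comp_neg_one T.bf_none_mem)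
        (T.be none)
      rw [h1, mul_zero, sub_zero, f_mul_e_none] at h2
      rw [← h2, ← neg_neg (_ * T.bh none), ← even_anti hP (even_of_comp (T.h_mem none)),
        ← bh_none_mul_bracket hT hm hz, e_mul_f, if_pos rfl, coeffH0_h, if_pos rfl, one_smul]
    | cons i l ih =>
      set x := word (fun i => T.bf (some i)) l (T.bf none) with hxd
      have hx : x ∈ T.𝓑comp (-1) := by
        rw [hxd]; clear hxd ih x
        induction l with
        | nil => exact T.bf_none_mem
        | cons k l ih => exact T.𝓑.mul_mem _ (by norm_num) (T.bf_some_mem k) ih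
      have hi := T.bf_some_mem i
      have hiz : T.bf (some i) * z ∈ T.𝓑comp 0 := T.𝓑.mul_mem _ (by norm_num) hi hz
      have e1 : T.bf (some i) * (z * T.be none) = (T.bf (some i) * z) * T.be none := by
        rw [T.zero_mul_mul hi, bf_mul_be_none, mul_zero, add_zero]
      -- Apply f i, which commutes with e 0, to the identity for the shorter word. The term in which
      -- f i hits `z` is given by the same identity for [f i, z], which is why `z` is generalised.
      -- Invariance of the coefficient functional identifies what remains.
      have h1 := congrArg (T.bf (some i) * ·) (ih hz)
      rw [T.zero_mul_mul hi, bf_mul_be_none, mul_zero, add_zero, T.zero_mul_mul hi, mul_sub,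
        mul_smul_comm, mul_smul_comm, bf_mul_be_none, smul_zero, sub_zero, e1, add_mul, ih hiz] at h1
      have h2 : T.coeffH0 (T.be none * (T.bf (some i) * x)) = 0 := by
        have := T.coeffH0_invariant hi he hx
        rw [bf_mul_be_none, zero_mul, map_zero] at this
        exact neg_eq_zero.1 this.symm
      have h3 := T.coeffH0_invariant hi (hze hz) hx
      rw [e1] at h3
      rw [word_cons, ← hxd, h2, zero_smul, zero_sub]
      rw [h3, neg_smul, sub_neg_eq_add, add_assoc, add_eq_left] at h1
      exact eq_neg_of_add_eq_zero_right h1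

end PseudoMinuscule

end Triple

end Cartanification

/-! ### Minimal extensions and peripheral ideals of local Lie superalgebras. -/

namespace Cartanification

open Presentation

namespace LocalLieSuperalgebra

section Extension

variable {𝕂 : Type u} [Field 𝕂] {H : LocalLieSuperalgebra 𝕂} {P : Presentation 𝕂 H.Gen}

/-- The relations of the local Lie superalgebra are satisfied. -/
def RespectsLocal (H : LocalLieSuperalgebra 𝕂) (P : Presentation 𝕂 H.Gen) : Prop :=
  ∀ x, Gen.Rel H x → P.proj x = 0

theorem maximalExtension_respectsLocal :
    RespectsLocal H (superPresentation (Gen.par H) (Gen.Rel H)) :=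
  fun _ hx => superPresentation_rel _ _ hx

theorem minimalExtension_respectsLocal : RespectsLocal H H.minimalExtension :=
  fun _ hx => (proj_eq_zero _).2 (le_minimal _ _ (subset_span _ (Or.inr hx)))

theorem consistent_gen : Consistent (Gen.par H) (Gen.deg H) := fun _ => rfl

/-- The embedding of the component of degree `-1`. -/
noncomputable def RespectsLocal.inM (hR : RespectsLocal H P) : H.Gm →ₗ[𝕂] P.Alg where
  toFun x := P.proj (gen 𝕂 (.m x))
  map_add' x y := by
    have := hR _ (Gen.Rel.add_m x y)
    rwa [map_sub, map_add, sub_eq_zero] at this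
  map_smul' c x := by
    have := hR _ (Gen.Rel.smul_m c x)
    rwa [map_sub, map_smul, sub_eq_zero] at this

/-- The embedding of the component of degree `0`. -/
noncomputable def RespectsLocal.inZ (hR : RespectsLocal H P) : H.G0 →ₗ[𝕂] P.Alg where
  toFun x := P.proj (gen 𝕂 (.z x))
  map_add' x y := by
    have := hR _ (Gen.Rel.add_z x y)
    rwa [map_sub, map_add, sub_eq_zero] at this
  map_smul' c x := by
    have := hR _ (Gen.Rel.smul_z c x)
    rwa [map_sub, map_smul, sub_eq_zero] at this

/-- The embedding of the component of degree `1`. -/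
noncomputable def RespectsLocal.inP (hR : RespectsLocal H P) : H.Gp →ₗ[𝕂] P.Alg where
  toFun x := P.proj (gen 𝕂 (.p x))
  map_add' x y := by
    have := hR _ (Gen.Rel.add_p x y)
    rwa [map_sub, map_add, sub_eq_zero] at this
  map_smul' c x := by
    have := hR _ (Gen.Rel.smul_p c x)
    rwa [map_sub, map_smul, sub_eq_zero] at this

theorem RespectsLocal.inM_apply (hR : RespectsLocal H P) (x : H.Gm) :
    hR.inM x = P.proj (gen 𝕂 (.m x)) := rfl
theorem RespectsLocal.inZ_apply (hR : RespectsLocal H P) (x : H.G0) :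
    hR.inZ x = P.proj (gen 𝕂 (.z x)) := rfl
theorem RespectsLocal.inP_apply (hR : RespectsLocal H P) (x : H.Gp) :
    hR.inP x = P.proj (gen 𝕂 (.p x)) := rfl

theorem RespectsLocal.inZ_mul_inZ (hR : RespectsLocal H P) (s t : H.G0) :
    hR.inZ s * hR.inZ t = hR.inZ (H.b00 s t) := by
  have := hR _ (Gen.Rel.b00 s t)
  rwa [map_sub, proj_mul, sub_eq_zero] at this

theorem RespectsLocal.inZ_mul_inM (hR : RespectsLocal H P) (s : H.G0) (x : H.Gm) :
    hR.inZ s * hR.inM x = hR.inM (H.b0m s x) := by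
  have := hR _ (Gen.Rel.b0m s x)
  rwa [map_sub, proj_mul, sub_eq_zero] at this

theorem RespectsLocal.inZ_mul_inP (hR : RespectsLocal H P) (s : H.G0) (y : H.Gp) :
    hR.inZ s * hR.inP y = hR.inP (H.b0p s y) := by
  have := hR _ (Gen.Rel.b0p s y)
  rwa [map_sub, proj_mul, sub_eq_zero] at this

theorem RespectsLocal.inP_mul_inM (hR : RespectsLocal H P) (y : H.Gp) (x : H.Gm) :
    hR.inP y * hR.inM x = hR.inZ (H.bpm y x) := by
  have := hR _ (Gen.Rel.bpm y x)
  rwa [map_sub, proj_mul, sub_eq_zero] at this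

theorem RespectsLocal.inM_mem (hR : RespectsLocal H P) (x : H.Gm) :
    hR.inM x ∈ P.comp (Gen.par H) 1 :=
  gen_mem P (Gen.par H) (.m x) (by simp [Gen.par, Gen.deg])

theorem RespectsLocal.inZ_mem (hR : RespectsLocal H P) (x : H.G0) :
    hR.inZ x ∈ P.comp (Gen.par H) 0 :=
  gen_mem P (Gen.par H) (.z x) (by simp [Gen.par, Gen.deg])

theorem RespectsLocal.inP_mem (hR : RespectsLocal H P) (x : H.Gp) :
    hR.inP x ∈ P.comp (Gen.par H) 1 :=
  gen_mem P (Gen.par H) (.p x) (by simp [Gen.par, Gen.deg])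

variable (hP : P.IsSuper (Gen.par H)) (hR : RespectsLocal H P)
include hP

theorem RespectsLocal.inZ_anti (s : H.G0) (v : P.Alg) : hR.inZ s * v = -(v * hR.inZ s) :=
  even_anti hP (hR.inZ_mem s) v

theorem RespectsLocal.inM_comm_inP (x : H.Gm) (y : H.Gp) : hR.inM x * hR.inP y = hR.inP y * hR.inM x :=
  odd_comm hP (hR.inM_mem x)
    (hR.inP_mem y)

theorem RespectsLocal.inM_jacobi (x : H.Gm) (y : H.Gp) (v : P.Alg) :
    hR.inM x * (hR.inP y * v) = (hR.inM x * hR.inP y) * v - hR.inP y * (hR.inM x * v) :=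
  odd_jacobi hP (hR.inM_mem x)
    (hR.inP_mem y) v

/-- A grading element of the local part is a grading element of any extension. -/
theorem RespectsLocal.isGrading {L : H.G0} (h0 : ∀ z, H.b00 L z = 0) (hm : ∀ x, H.b0m L x = -x)
    (hp : ∀ y, H.b0p L y = y) : P.IsGrading (Gen.deg H) (hR.inZ L) := by
  refine mul_mon_of_mul_gen hP
    (hR.inZ_mem L) ?_
  rintro (x | z | y)
  · rw [← hR.inM_apply, hR.inZ_mul_inM, hm, map_neg]; simp [Gen.deg]
  · rw [← hR.inZ_apply, hR.inZ_mul_inZ, h0, map_zero]; simp [Gen.deg]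
  · rw [← hR.inP_apply, hR.inZ_mul_inP, hp]; simp [Gen.deg]

omit hP in
/-- The square of an element of degree `1` vanishes in the minimal extension if its brackets with
all elements of degree `-1` do. -/
theorem minimalExtension_p_mul_p [CharZero 𝕂] {L : H.G0} (h0 : ∀ z, H.b00 L z = 0)
    (hm : ∀ x, H.b0m L x = -x) (hp : ∀ y, H.b0p L y = y) (y : H.Gp)
    (hy : ∀ x, H.b0p (H.bpm y x) y = 0) :
    H.minimalExtension.proj (gen 𝕂 (.p y) * gen 𝕂 (.p y)) = 0 := by
  have hP : (superPresentation (Gen.par H) (Gen.Rel H)).IsSuper (Gen.par H) :=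
    superPresentation_isSuper _ _
  have hR := maximalExtension_respectsLocal (H := H)
  refine minimal_proj_eq_zero.2 (le_maxIdeal hP (hR.isGrading hP h0 hm hp) 1 (Or.inl rfl) ?_
    (S := Submodule.span 𝕂 {(superPresentation (Gen.par H) (Gen.Rel H)).proj
      (gen 𝕂 (.p y) * gen 𝕂 (.p y))}) ?_ ?_ (Submodule.mem_span_singleton_self _))
  · rintro (x | z | y) (x' | z' | y') h1 h2 <;> simp only [Gen.deg] at h1 h2 <;> try omega
    · rw [← hR.inM_apply, ← hR.inZ_apply, ← neg_neg (hR.inM x * _), ← hR.inZ_anti hP,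
        hR.inZ_mul_inM]
      exact Submodule.neg_mem _ (Submodule.subset_span ⟨.m _, rfl⟩)
    · rw [← hR.inM_apply, ← hR.inP_apply, hR.inM_comm_inP hP, hR.inP_mul_inM]
      exact Submodule.subset_span ⟨.z _, rfl⟩
  · rw [Submodule.span_singleton_le_iff_mem]
    refine Submodule.mem_iSup_of_mem (Gen.par H (.p y) + Gen.par H (.p y), 1 + 1)
      (Submodule.mem_iSup_of_mem (by norm_num) ⟨Submodule.mem_span_singleton_self _, ?_⟩)
    rw [proj_mul]
    exact Presentation.mul_mem _ (fun x => (Gen.par H x, Gen.deg H x))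
      (k := (Gen.par H (.p y), 1)) (l := (Gen.par H (.p y), 1)) (Prod.mk_add_mk _ _ _ _)
      (gen_mem _ _ _ rfl) (gen_mem _ _ _ rfl)
  · rintro (x | z | y') h1 v hv <;> simp only [Gen.deg] at h1 <;> try omega
    obtain ⟨t, rfl⟩ := Submodule.mem_span_singleton.1 hv
    -- The bracket of x with the square of y consists of [[x, y], y] and [y, [x, y]], and both
    -- vanish by hypothesis. So the square spans a subspace of degree two that lowering annihilates.
    have h2 : hR.inP y * hR.inZ (H.bpm y x) = 0 := by
      rw [← neg_eq_zero, ← hR.inZ_anti hP, hR.inZ_mul_inP, hy, map_zero]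
    have h3 : hR.inM x * (hR.inP y * hR.inP y) = 0 := by
      rw [hR.inM_jacobi hP, hR.inM_comm_inP hP, hR.inP_mul_inM, hR.inZ_mul_inP, hy, h2, map_zero,
        sub_zero]
    have h4 : (superPresentation (Gen.par H) (Gen.Rel H)).proj (gen 𝕂 (.m x)) *
        (t • (superPresentation (Gen.par H) (Gen.Rel H)).proj (gen 𝕂 (.p y) * gen 𝕂 (.p y))) = 0 := by
      rw [mul_smul_comm, proj_mul, ← hR.inM_apply, ← hR.inP_apply, h3, smul_zero]
    rw [h4]
    exact Submodule.zero_mem _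

end Extension

/-- Elements of degree `-1` whose brackets with all elements of degree `1` vanish are
peripheral. -/
theorem mem_maxPeripheral_m {𝕂 : Type u} [Field 𝕂] {G : LocalLieSuperalgebra 𝕂} {x : G.Gm}
    (hx : ∀ y, G.bpm y x = 0) : x ∈ G.maxPeripheral.m := by
  -- The common kernel of all brackets with degree one, with zero in the other degrees. The Jacobi
  -- identity makes it stable under degree zero, so it is an ideal that avoids degree zero.
  let I : G.LocalIdeal :=
    { m := ⨅ y, LinearMap.ker (G.bpm y)
      z := ⊥
      p := ⊥
      b00_left := fun s hs t => by rw [(Submodule.mem_bot 𝕂).1 hs]; simp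
      b00_right := fun s t ht => by rw [(Submodule.mem_bot 𝕂).1 ht]; simp
      b0m_left := fun s hs x => by rw [(Submodule.mem_bot 𝕂).1 hs]; simp
      b0m_right := fun s x hx => by
        simp only [Submodule.mem_iInf, LinearMap.mem_ker] at hx ⊢
        intro y
        have := G.jacpm s y x
        rwa [hx, hx, map_zero, zero_add, eq_comm] at this
      b0p_left := fun s hs y => by rw [(Submodule.mem_bot 𝕂).1 hs]; simp
      b0p_right := fun s y hy => by rw [(Submodule.mem_bot 𝕂).1 hy]; simp
      bpm_left := fun y hy x => by rw [(Submodule.mem_bot 𝕂).1 hy]; simp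
      bpm_right := fun y x hx => by
        simp only [Submodule.mem_iInf, LinearMap.mem_ker] at hx
        exact (Submodule.mem_bot 𝕂).2 (hx y) }
  have h1 : I.m ≤ G.maxPeripheral.m := le_sSup ⟨I, rfl, rfl⟩
  refine h1 ?_
  simp only [I, Submodule.mem_iInf, LinearMap.mem_ker]
  exact hx

end LocalLieSuperalgebra

/-! ### Explicit form of the local cartanification. -/

namespace ContragredientLocal

open LocalLieSuperalgebra

variable {𝕂 : Type u} [Field 𝕂] (G : ContragredientLocal 𝕂)

theorem ell_b00_inU (s t : G.G0) : G.ell.b00 (inU 𝕂 s) (inU 𝕂 t) = inU 𝕂 (G.b00 s t) :=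
  (inU_lie (𝕂 := 𝕂) s t).symm

theorem ell_b0m_tmul (s z : G.G0) (x : G.Gm) :
    G.ell.b0m (inU 𝕂 s) (x ⊗ₜ[𝕂] inU 𝕂 z) =
      G.b0m s x ⊗ₜ[𝕂] inU 𝕂 z + x ⊗ₜ[𝕂] inU 𝕂 (G.b00 s z) := by
  change lact G.b0m G.isRep_m (inU 𝕂 s) (x ⊗ₜ[𝕂] inU 𝕂 z) - ract G.Gm (inU 𝕂 s) (x ⊗ₜ[𝕂] inU 𝕂 z) = _
  rw [lact_inU, ract_tmul, ← lie_def, inU_lie, TensorProduct.tmul_sub]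
  abel

theorem ell_b0p_tmul (s : G.G0) (y : G.Gp) :
    G.ell.b0p (inU 𝕂 s) (y ⊗ₜ[𝕂] (1 : G.U)) = G.b0p s y ⊗ₜ[𝕂] (1 : G.U) := by
  change lact G.b0p G.isRep_p (inU 𝕂 s) (y ⊗ₜ[𝕂] (1 : G.U)) -
    ract G.Gp (inU 𝕂 s) (y ⊗ₜ[𝕂] (1 : G.U)) = _
  rw [lact_inU, ract_tmul, mul_one, one_mul]
  abel

/-- The bracket of `y` and `x z`, for `y ∈ G₁`, `x ∈ G₋₁` and `z ∈ G₀`. -/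
def pairing (y : G.Gp) (x : G.Gm) (z : G.G0) : G.G0 :=
  -G.form x y • z - G.bpm (G.b0p z y) x + G.form x (G.b0p z y) • G.L

theorem ell_bpm_tmul (x : G.Gm) (y : G.Gp) (z : G.G0) :
    G.ell.bpm (y ⊗ₜ[𝕂] (1 : G.U)) (x ⊗ₜ[𝕂] inU 𝕂 z) = inU 𝕂 (G.pairing y x z) :=
  G.ell_bracket x y z

/-- The subalgebra spanned by `G₋₁ G₀`, `G₀` and `G₁`. -/
noncomputable def spanSub : G.ell.Sub where
  m := Submodule.span 𝕂 {X | ∃ (x : G.Gm) (z : G.G0), X = x ⊗ₜ[𝕂] inU 𝕂 z}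
  z := LinearMap.range (inU 𝕂 : G.G0 →ₗ[𝕂] G.U)
  p := LinearMap.range ((TensorProduct.mk 𝕂 G.Gp G.U).flip 1)
  b00_mem := by
    rintro _ ⟨s, rfl⟩ _ ⟨t, rfl⟩
    exact ⟨G.b00 s t, (G.ell_b00_inU s t).symm⟩
  b0m_mem := by
    rintro _ ⟨s, rfl⟩ X hX
    induction hX using Submodule.span_induction with
    | zero => rw [map_zero]; exact Submodule.zero_mem _
    | add a b _ _ ha hb => rw [map_add]; exact Submodule.add_mem _ ha hb
    | smul c a _ ha => rw [map_smul]; exact Submodule.smul_mem _ _ ha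
    | mem a ha =>
      obtain ⟨x, z, rfl⟩ := ha
      refine (congrArg (· ∈ Submodule.span 𝕂 _) (G.ell_b0m_tmul s z x)).mpr ?_
      exact Submodule.add_mem _ (Submodule.subset_span ⟨_, _, rfl⟩)
        (Submodule.subset_span ⟨_, _, rfl⟩)
  b0p_mem := by
    rintro _ ⟨s, rfl⟩ _ ⟨y, rfl⟩
    exact ⟨G.b0p s y, (G.ell_b0p_tmul s y).symm⟩
  bpm_mem := by
    rintro _ ⟨y, rfl⟩ X hX
    induction hX using Submodule.span_induction with
    | zero => rw [map_zero]; exact Submodule.zero_mem _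
    | add a b _ _ ha hb => rw [map_add]; exact Submodule.add_mem _ ha hb
    | smul c a _ ha => rw [map_smul]; exact Submodule.smul_mem _ _ ha
    | mem a ha =>
      obtain ⟨x, z, rfl⟩ := ha
      exact ⟨_, (G.ell_bpm_tmul x y z).symm⟩

/-- `spanSub` is a subalgebra containing the generators of `cartSub`. This and the next two bounds
give normal forms: sums of elements x z, elements of G₀, and elements of G₁. -/
theorem cartSub_m_le : G.cartSub.m ≤ G.spanSub.m :=
  sInf_le ⟨G.spanSub, Submodule.subset_span, by rintro _ ⟨y, rfl⟩; exact ⟨y, rfl⟩, rfl⟩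

theorem cartSub_z_le : G.cartSub.z ≤ G.spanSub.z :=
  sInf_le ⟨G.spanSub, Submodule.subset_span, by rintro _ ⟨y, rfl⟩; exact ⟨y, rfl⟩, rfl⟩

theorem cartSub_p_le : G.cartSub.p ≤ G.spanSub.p :=
  sInf_le ⟨G.spanSub, Submodule.subset_span, by rintro _ ⟨y, rfl⟩; exact ⟨y, rfl⟩, rfl⟩

theorem cartSub_induction_p {Q : G.ell.Gp → Prop} (h : ∀ y, Q (y ⊗ₜ[𝕂] (1 : G.U))) {u : G.ell.Gp}
    (hu : u ∈ G.cartSub.p) : Q u := by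
  obtain ⟨y, rfl⟩ := G.cartSub_p_le hu
  exact h y

/-! #### The local cartanification -/

/-- The element `x z` of the local cartanification. -/
def locM (x : G.Gm) (z : G.G0) : G.localCartanification.Gm :=
  Submodule.Quotient.mk ⟨_, G.tmul_mem_cartSub x z⟩

/-- The element `z` of the local cartanification. -/
def locZ (z : G.G0) (hz : inU 𝕂 z ∈ G.cartSub.z) : G.localCartanification.G0 :=
  Submodule.Quotient.mk ⟨_, hz⟩

/-- The element `y` of the local cartanification. -/
def locP (y : G.Gp) : G.localCartanification.Gp :=
  Submodule.Quotient.mk ⟨_, G.tmul_one_mem_cartSub y⟩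

theorem loc_b00 {s t : G.G0} (hs : inU 𝕂 s ∈ G.cartSub.z) (ht : inU 𝕂 t ∈ G.cartSub.z) :
    G.localCartanification.b00 (G.locZ s hs) (G.locZ t ht) =
      G.locZ (G.b00 s t) (G.inU_b00_mem hs ht) :=
  congrArg Submodule.Quotient.mk (Subtype.ext (G.ell_b00_inU s t))

theorem loc_b0p {s : G.G0} (hs : inU 𝕂 s ∈ G.cartSub.z) (y : G.Gp) :
    G.localCartanification.b0p (G.locZ s hs) (G.locP y) = G.locP (G.b0p s y) :=
  congrArg Submodule.Quotient.mk (Subtype.ext (G.ell_b0p_tmul s y))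

theorem loc_b0m {s : G.G0} (hs : inU 𝕂 s ∈ G.cartSub.z) (x : G.Gm) (z : G.G0) :
    G.localCartanification.b0m (G.locZ s hs) (G.locM x z) =
      G.locM (G.b0m s x) z + G.locM x (G.b00 s z) :=
  congrArg Submodule.Quotient.mk (Subtype.ext (G.ell_b0m_tmul s z x))

theorem pairing_mem (y : G.Gp) (x : G.Gm) (z : G.G0) : inU 𝕂 (G.pairing y x z) ∈ G.cartSub.z :=
  G.bracket_mem_cartSub x y z

theorem loc_bpm (y : G.Gp) (x : G.Gm) (z : G.G0) :
    G.localCartanification.bpm (G.locP y) (G.locM x z) =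
      G.locZ (G.pairing y x z) (G.pairing_mem y x z) :=
  congrArg Submodule.Quotient.mk (Subtype.ext (G.ell_bpm_tmul x y z))

/-- Every element of degree one of the subalgebra is some y ∈ G₁, so vanishing pairings make x z
peripheral, and peripheral elements have been factored out. -/
theorem locM_eq_zero {x : G.Gm} {z : G.G0} (h : ∀ y, G.pairing y x z = 0) : G.locM x z = 0 := by
  refine (Submodule.Quotient.mk_eq_zero _).2 (mem_maxPeripheral_m ?_)
  rintro ⟨Y, hY⟩
  apply Subtype.ext
  change G.ell.bpm Y (x ⊗ₜ[𝕂] inU 𝕂 z) = 0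
  refine G.cartSub_induction_p (Q := fun Y => G.ell.bpm Y (x ⊗ₜ[𝕂] inU 𝕂 z) = 0) (fun y => ?_) hY
  rw [ell_bpm_tmul, h, map_zero]
  rfl

theorem loc_induction_m {Q : G.localCartanification.Gm → Prop} (h : ∀ x z, Q (G.locM x z))
    (h0 : Q 0) (hadd : ∀ X Y, Q X → Q Y → Q (X + Y)) (hsmul : ∀ (c : 𝕂) X, Q X → Q (c • X))
    (X : G.localCartanification.Gm) : Q X := by
  obtain ⟨⟨X, hX⟩, rfl⟩ := Submodule.Quotient.mk_surjective _ X
  -- Membership in `cartSub` is carried along the induction, because the class in the quotient makes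
  -- sense only for members.
  have h1 : ∀ X ∈ G.spanSub.m, ∃ hX : X ∈ G.cartSub.m,
      Q (Submodule.Quotient.mk (p := G.cartSub.toLocal.maxPeripheral.m) ⟨X, hX⟩) := by
    intro X hX
    induction hX using Submodule.span_induction with
    | zero => exact ⟨Submodule.zero_mem _, h0⟩
    | add a b _ _ ha hb =>
      obtain ⟨ha, ha'⟩ := ha
      obtain ⟨hb, hb'⟩ := hb
      exact ⟨Submodule.add_mem _ ha hb, hadd _ _ ha' hb'⟩
    | smul c a _ ha =>
      obtain ⟨ha, ha'⟩ := ha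
      exact ⟨Submodule.smul_mem _ c ha, hsmul c _ ha'⟩
    | mem a ha =>
      obtain ⟨x, z, rfl⟩ := ha
      exact ⟨G.tmul_mem_cartSub x z, h x z⟩
  exact (h1 X (G.cartSub_m_le hX)).2

theorem loc_induction_p {Q : G.localCartanification.Gp → Prop} (h : ∀ y, Q (G.locP y))
    (Y : G.localCartanification.Gp) : Q Y := by
  obtain ⟨⟨Y, hY⟩, rfl⟩ := Submodule.Quotient.mk_surjective _ Y
  obtain ⟨y, rfl⟩ := G.cartSub_p_le hY
  exact h y

theorem loc_induction_z {Q : G.localCartanification.G0 → Prop} (h : ∀ z hz, Q (G.locZ z hz))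
    (Z : G.localCartanification.G0) : Q Z := by
  obtain ⟨⟨Z, hZ⟩, rfl⟩ := Submodule.Quotient.mk_surjective _ Z
  obtain ⟨z, rfl⟩ := G.cartSub_z_le hZ
  exact h z hZ

section GradingElement

variable (hL : inU 𝕂 G.L ∈ G.cartSub.z)

/-- With the next two lemmas: `L` remains a grading element. It commutes with G₀, so on x z it acts
through x alone. Both the criterion for vanishing squares and the descent to the local part of `W`
depend on this. -/
theorem loc_grading_zero (Z : G.localCartanification.G0) :
    G.localCartanification.b00 (G.locZ G.L hL) Z = 0 := by
  induction Z using G.loc_induction_z with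
  | h z hz =>
    rw [loc_b00]
    refine (Submodule.Quotient.mk_eq_zero _).2 ?_
    simp only [G.grading_zero, map_zero]
    exact Submodule.zero_mem _

theorem loc_grading_pos (Y : G.localCartanification.Gp) :
    G.localCartanification.b0p (G.locZ G.L hL) Y = Y := by
  induction Y using G.loc_induction_p with
  | h y => rw [loc_b0p, G.grading_pos]

theorem loc_grading_neg (X : G.localCartanification.Gm) :
    G.localCartanification.b0m (G.locZ G.L hL) X = -X := by
  induction X using G.loc_induction_m with
  | h0 => simp
  | hadd X Y hX hY => rw [map_add, hX, hY]; abel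
  | hsmul c X hX => rw [map_smul, hX, smul_neg]
  | h x z =>
    rw [loc_b0m]
    refine congrArg Submodule.Quotient.mk (Subtype.ext ?_)
    change G.b0m G.L x ⊗ₜ[𝕂] inU 𝕂 z + x ⊗ₜ[𝕂] inU 𝕂 (G.b00 G.L z) = -(x ⊗ₜ[𝕂] inU 𝕂 z)
    rw [G.grading_zero, G.grading_neg, map_zero, TensorProduct.tmul_zero, add_zero,
      TensorProduct.neg_tmul]

end GradingElement

/-! #### Calculations in the cartanification -/

section Calculations

variable [CharZero 𝕂]

theorem respects : RespectsLocal G.localCartanification G.cartanification :=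
  minimalExtension_respectsLocal

theorem cart_isSuper : G.cartanification.IsSuper (Gen.par G.localCartanification) :=
  G.localCartanification.minimalExtension_isSuper

theorem locM_smul_right (x : G.Gm) (c : 𝕂) (z : G.G0) : G.locM x (c • z) = c • G.locM x z :=
  congrArg Submodule.Quotient.mk (Subtype.ext (by
    change x ⊗ₜ[𝕂] inU 𝕂 (c • z) = c • (x ⊗ₜ[𝕂] inU 𝕂 z)
    rw [map_smul, TensorProduct.tmul_smul]))

theorem locM_smul_left (x : G.Gm) (c : 𝕂) (z : G.G0) : G.locM (c • x) z = c • G.locM x z :=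
  congrArg Submodule.Quotient.mk (Subtype.ext (by
    change (c • x) ⊗ₜ[𝕂] inU 𝕂 z = c • (x ⊗ₜ[𝕂] inU 𝕂 z)
    rw [TensorProduct.smul_tmul']))

theorem locZ_smul (c : 𝕂) (z : G.G0) (hz : inU 𝕂 z ∈ G.cartSub.z)
    (hcz : inU 𝕂 (c • z) ∈ G.cartSub.z) : G.locZ (c • z) hcz = c • G.locZ z hz :=
  congrArg Submodule.Quotient.mk (Subtype.ext (map_smul _ c z))

theorem locP_smul (c : 𝕂) (y : G.Gp) : G.locP (c • y) = c • G.locP y :=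
  congrArg Submodule.Quotient.mk (Subtype.ext (by
    change (c • y) ⊗ₜ[𝕂] (1 : G.U) = c • (y ⊗ₜ[𝕂] (1 : G.U))
    rw [TensorProduct.smul_tmul']))

theorem locP_zero : G.locP 0 = 0 := by simpa using G.locP_smul 0 0

/-- The element `x z` of the cartanification. -/
noncomputable def negEl (x : G.Gm) (z : G.G0) : G.cartanification.Alg := G.respects.inM (G.locM x z)

/-- The element `z` of the cartanification. -/
noncomputable def zeroEl (z : G.G0) (hz : inU 𝕂 z ∈ G.cartSub.z) : G.cartanification.Alg :=
  G.respects.inZ (G.locZ z hz)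

/-- The element `y` of the cartanification. -/
noncomputable def posEl (y : G.Gp) : G.cartanification.Alg := G.respects.inP (G.locP y)

theorem negEl_smul_right (x : G.Gm) (c : 𝕂) (z : G.G0) :
    G.negEl x (c • z) = c • G.negEl x z := by
  rw [negEl, locM_smul_right, map_smul, negEl]

theorem negEl_smul_left (x : G.Gm) (c : 𝕂) (z : G.G0) :
    G.negEl (c • x) z = c • G.negEl x z := by
  rw [negEl, locM_smul_left, map_smul, negEl]

theorem negEl_zero_right (x : G.Gm) : G.negEl x 0 = 0 := by
  simpa using G.negEl_smul_right x 0 0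

theorem negEl_zero_left (z : G.G0) : G.negEl 0 z = 0 := by
  simpa using G.negEl_smul_left 0 0 z

theorem zeroEl_smul (c : 𝕂) (z : G.G0) (hz : inU 𝕂 z ∈ G.cartSub.z)
    (hcz : inU 𝕂 (c • z) ∈ G.cartSub.z) : G.zeroEl (c • z) hcz = c • G.zeroEl z hz := by
  rw [zeroEl, G.locZ_smul c z hz, map_smul, zeroEl]

theorem zeroEl_zero (h : inU 𝕂 (0 : G.G0) ∈ G.cartSub.z) : G.zeroEl 0 h = 0 := by
  simpa using G.zeroEl_smul 0 0 h (by simpa using h)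

theorem posEl_smul (c : 𝕂) (y : G.Gp) : G.posEl (c • y) = c • G.posEl y := by
  rw [posEl, locP_smul, map_smul, posEl]

theorem posEl_zero : G.posEl 0 = 0 := by
  simpa using G.posEl_smul 0 0

theorem zeroEl_mul_zeroEl {s t : G.G0} (hs : inU 𝕂 s ∈ G.cartSub.z) (ht : inU 𝕂 t ∈ G.cartSub.z) :
    G.zeroEl s hs * G.zeroEl t ht = G.zeroEl (G.b00 s t) (G.inU_b00_mem hs ht) := by
  rw [zeroEl, zeroEl, G.respects.inZ_mul_inZ, loc_b00, zeroEl]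

theorem zeroEl_mul_posEl {s : G.G0} (hs : inU 𝕂 s ∈ G.cartSub.z) (y : G.Gp) :
    G.zeroEl s hs * G.posEl y = G.posEl (G.b0p s y) := by
  rw [zeroEl, posEl, G.respects.inZ_mul_inP, loc_b0p, posEl]

theorem posEl_mul_zeroEl {s : G.G0} (hs : inU 𝕂 s ∈ G.cartSub.z) (y : G.Gp) :
    G.posEl y * G.zeroEl s hs = -G.posEl (G.b0p s y) := by
  rw [← zeroEl_mul_posEl G hs, zeroEl, G.respects.inZ_anti G.cart_isSuper, neg_neg]

theorem zeroEl_mul_negEl {s : G.G0} (hs : inU 𝕂 s ∈ G.cartSub.z) (x : G.Gm) (z : G.G0) :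
    G.zeroEl s hs * G.negEl x z = G.negEl (G.b0m s x) z + G.negEl x (G.b00 s z) := by
  rw [zeroEl, negEl, G.respects.inZ_mul_inM, loc_b0m, map_add, negEl, negEl]

theorem posEl_mul_negEl (y : G.Gp) (x : G.Gm) (z : G.G0) :
    G.posEl y * G.negEl x z = G.zeroEl (G.pairing y x z) (G.pairing_mem y x z) := by
  rw [posEl, negEl, G.respects.inP_mul_inM, loc_bpm, zeroEl]

theorem negEl_eq_zero {x : G.Gm} {z : G.G0} (h : ∀ y, G.pairing y x z = 0) :
    G.negEl x z = 0 := by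
  rw [negEl, G.locM_eq_zero h, map_zero]

theorem posEl_mul_self (hL : inU 𝕂 G.L ∈ G.cartSub.z) (y : G.Gp)
    (hy : ∀ x z, G.b0p (G.pairing y x z) y = 0) : G.posEl y * G.posEl y = 0 := by
  refine minimalExtension_p_mul_p (G.loc_grading_zero hL) (G.loc_grading_neg hL)
    (G.loc_grading_pos hL) (G.locP y) fun X => ?_
  induction X using G.loc_induction_m with
  | h0 => simp
  | hadd X Y hX hY => rw [map_add, LinearMap.map_add₂, hX, hY, add_zero]
  | hsmul c X hX => rw [map_smul, LinearMap.map_smul₂, hX, smul_zero]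
  | h x z => rw [loc_bpm, loc_b0p, hy, locP_zero]

theorem cart_isGrading (hL : inU 𝕂 G.L ∈ G.cartSub.z) :
    G.cartanification.IsGrading (Gen.deg G.localCartanification) (G.zeroEl G.L hL) :=
  G.respects.isGrading G.cart_isSuper (G.loc_grading_zero hL) (G.loc_grading_neg hL)
    (G.loc_grading_pos hL)

end Calculations

end ContragredientLocal

end Cartanification

/-! ### Brackets of the generators in the cartanification of 𝓑. -/

namespace Cartanification

open Presentation

namespace ContragredientLocal

variable {𝕂 : Type u} [Field 𝕂] [CharZero 𝕂] (G : ContragredientLocal 𝕂)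

theorem iterate_mem_cartSub {s t : G.G0} (hs : inU 𝕂 s ∈ G.cartSub.z)
    (ht : inU 𝕂 t ∈ G.cartSub.z) (n : ℕ) : inU 𝕂 ((G.b00 s ·)^[n] t) ∈ G.cartSub.z := by
  induction n with
  | zero => exact ht
  | succ n ih =>
    rw [Function.iterate_succ_apply']
    exact G.inU_b00_mem hs ih

theorem zeroEl_mul_iterate_zeroEl {s t : G.G0} (hs : inU 𝕂 s ∈ G.cartSub.z)
    (ht : inU 𝕂 t ∈ G.cartSub.z) (n : ℕ) :
    (G.zeroEl s hs * ·)^[n] (G.zeroEl t ht) =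
      G.zeroEl ((G.b00 s ·)^[n] t) (G.iterate_mem_cartSub hs ht n) := by
  induction n with
  | zero => rfl
  | succ n ih =>
    simp only [Function.iterate_succ_apply', ih]
    rw [zeroEl_mul_zeroEl]

theorem zeroEl_mul_iterate_posEl {s : G.G0} (hs : inU 𝕂 s ∈ G.cartSub.z) (y : G.Gp) (n : ℕ) :
    (G.zeroEl s hs * ·)^[n] (G.posEl y) = G.posEl ((G.b0p s ·)^[n] y) := by
  induction n with
  | zero => rfl
  | succ n ih =>
    simp only [Function.iterate_succ_apply', ih]
    rw [zeroEl_mul_posEl]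

/-- The Leibniz rule with binomial coefficients, cut off after three terms because the third bracket
of `s` with `z` vanishes. The shift by two keeps all exponents natural. -/
theorem zeroEl_mul_iterate_negEl {s : G.G0} (hs : inU 𝕂 s ∈ G.cartSub.z) (x : G.Gm) {z : G.G0}
    (hz : G.b00 s (G.b00 s (G.b00 s z)) = 0) (n : ℕ) :
    (G.zeroEl s hs * ·)^[n + 2] (G.negEl x z) =
      G.negEl ((G.b0m s ·)^[n + 2] x) z +
        (n + 2 : 𝕂) • G.negEl ((G.b0m s ·)^[n + 1] x) (G.b00 s z) +
        ((n + 2) * (n + 1) / 2 : 𝕂) • G.negEl ((G.b0m s ·)^[n] x) (G.b00 s (G.b00 s z)) := by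
  induction n with
  | zero =>
    simp only [Function.iterate_succ_apply', Function.iterate_zero, id, zeroEl_mul_negEl, mul_add]
    norm_num
    rw [two_smul]
    abel
  | succ n ih =>
    rw [Function.iterate_succ_apply', ih]
    simp only [mul_add, mul_smul_comm, zeroEl_mul_negEl, hz, negEl_zero_right, smul_add, add_zero]
    simp only [Function.iterate_succ_apply']
    push_cast
    module

theorem zeroEl_mul_negEl_of_eq_zero {s : G.G0} (hs : inU 𝕂 s ∈ G.cartSub.z) {x : G.Gm}
    (hx : G.b0m s x = 0) (z : G.G0) : G.zeroEl s hs * G.negEl x z = G.negEl x (G.b00 s z) := by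
  rw [zeroEl_mul_negEl, hx, negEl_zero_left, zero_add]

/-- Makes rewriting possible although the membership proof depends on the element. -/
theorem zeroEl_congr {s t : G.G0} (h : s = t) (hs : inU 𝕂 s ∈ G.cartSub.z)
    (ht : inU 𝕂 t ∈ G.cartSub.z) : G.zeroEl s hs = G.zeroEl t ht := by
  subst h; rfl

end ContragredientLocal

namespace Triple

variable {𝕂 : Type u} [Field 𝕂] [CharZero 𝕂] {r : ℕ} (T : Triple 𝕂 r)

theorem b00_e_f (i j : Fin r) :
    T.𝓑local.b00 (T.e' i) (T.f' j) = if i = j then T.h' (some j) else 0 := by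
  apply Subtype.ext
  change T.be (some i) * T.bf (some j) = _
  rw [e_mul_f]
  by_cases h : i = j
  · subst h; simp [h']
  · simp only [Option.some.injEq, h, if_false]; rfl

theorem b00_h_f (i : Option (Fin r)) (j : Fin r) :
    T.𝓑local.b00 (T.h' i) (T.f' j) = -T.B i (some j) • T.f' j :=
  Subtype.ext ((T.h_mul_f i (some j)).trans (neg_smul _ _).symm)

theorem b00_h_e (i : Option (Fin r)) (j : Fin r) :
    T.𝓑local.b00 (T.h' i) (T.e' j) = T.B i (some j) • T.e' j :=
  Subtype.ext (T.h_mul_e i (some j))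

theorem b00_h_h (i j : Option (Fin r)) : T.𝓑local.b00 (T.h' i) (T.h' j) = 0 :=
  Subtype.ext (T.h_mul_h i j)

theorem b0p_h_eo (i : Option (Fin r)) : T.𝓑local.b0p (T.h' i) T.eo = T.B i none • T.eo :=
  Subtype.ext (T.h_mul_e i none)

theorem b0m_h_fo (i : Option (Fin r)) : T.𝓑local.b0m (T.h' i) T.fo = -T.B i none • T.fo :=
  Subtype.ext ((T.h_mul_f i none).trans (neg_smul _ _).symm)

theorem b0m_e_fo (i : Fin r) : T.𝓑local.b0m (T.e' i) T.fo = 0 :=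
  Subtype.ext (T.be_mul_bf_none i)

theorem b0p_f_eo (i : Fin r) : T.𝓑local.b0p (T.f' i) T.eo = 0 :=
  Subtype.ext (T.bf_mul_be_none i)

theorem b0m_f_fo {k : Fin r} (hk : T.lam k = 0) : T.𝓑local.b0m (T.f' k) T.fo = 0 :=
  Subtype.ext (T.bf_mul_bf_none hk)

theorem b0p_e_eo {k : Fin r} (hk : T.lam k = 0) : T.𝓑local.b0p (T.e' k) T.eo = 0 :=
  Subtype.ext (T.be_mul_be_none hk)

theorem b00_skew (s t : T.𝓑local.G0) : T.𝓑local.b00 s t = -T.𝓑local.b00 t s :=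
  Subtype.ext (anti_zero T.𝓑_isSuper consistent s.2 t.1)

theorem b00_e_h (j : Fin r) (i : Option (Fin r)) :
    T.𝓑local.b00 (T.e' j) (T.h' i) = -T.B i (some j) • T.e' j := by
  rw [b00_skew, b00_h_e, neg_smul]

theorem b00_f_h (j : Fin r) (i : Option (Fin r)) :
    T.𝓑local.b00 (T.f' j) (T.h' i) = T.B i (some j) • T.f' j := by
  rw [b00_skew, b00_h_f, neg_smul, neg_neg]

theorem b00_f_e (j : Fin r) : T.𝓑local.b00 (T.f' j) (T.e' j) = -T.h' (some j) := by
  rw [b00_skew, b00_e_f, if_pos rfl]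

theorem coe_iterate_b00 (s t : T.𝓑local.G0) (n : ℕ) :
    ((T.𝓑local.b00 s ·)^[n] t).1 = (s.1 * ·)^[n] t.1 := by
  induction n with
  | zero => rfl
  | succ n ih =>
    simp only [Function.iterate_succ_apply', ← ih]
    rfl

theorem coe_iterate_b0p (s : T.𝓑local.G0) (t : T.𝓑local.Gp) (n : ℕ) :
    ((T.𝓑local.b0p s ·)^[n] t).1 = (s.1 * ·)^[n] t.1 := by
  induction n with
  | zero => rfl
  | succ n ih =>
    simp only [Function.iterate_succ_apply', ← ih]
    rfl

theorem coe_iterate_b0m (s : T.𝓑local.G0) (t : T.𝓑local.Gm) (n : ℕ) :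
    ((T.𝓑local.b0m s ·)^[n] t).1 = (s.1 * ·)^[n] t.1 := by
  induction n with
  | zero => rfl
  | succ n ih =>
    simp only [Function.iterate_succ_apply', ← ih]
    rfl

/-- The form is minus the coefficient of h 0 in the bracket, which accounts for the signs. -/
theorem coe_pairing (y : T.𝓑local.Gp) (x : T.𝓑local.Gm) (z : T.𝓑local.G0) :
    (T.𝓑local.pairing y x z).1 = T.coeffH0 (x.1 * y.1) • z.1 - (z.1 * y.1) * x.1 -
      T.coeffH0 (x.1 * (z.1 * y.1)) • T.L := by
  have h : (T.𝓑local.pairing y x z).1 = -(-T.coeffH0 (x.1 * y.1)) • z.1 - (z.1 * y.1) * x.1 +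
      (-T.coeffH0 (x.1 * (z.1 * y.1))) • T.L := rfl
  rw [h, neg_neg, neg_smul, sub_eq_add_neg _ (T.coeffH0 _ • T.L)]

theorem odd_swap (x : T.𝓑local.Gm) (y : T.𝓑local.Gp) : x.1 * y.1 = y.1 * x.1 :=
  odd_comm T.𝓑_isSuper (odd_of_comp_neg_one x.2) (odd_of_comp_one y.2)

/-- When B i 0 = 0 the bracket [h i, e 0] drops out, and only the term with ⟨f 0 | e 0⟩ = -1
remains. The vanishing holds for indices in {0} ∪ K. -/
theorem pairing_eo_fo_h {i : Option (Fin r)} (hi : T.B i none = 0) :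
    T.𝓑local.pairing T.eo T.fo (T.h' i) = T.h' i := by
  apply Subtype.ext
  rw [coe_pairing]
  change T.coeffH0 (T.bf none * T.be none) • T.bh i - (T.bh i * T.be none) * T.bf none -
    T.coeffH0 (T.bf none * (T.bh i * T.be none)) • T.L = T.bh i
  rw [h_mul_e, hi, f_mul_e_none, coeffH0_h, if_pos rfl]
  simp

/-- `L` is a combination of the h i, all of which lie in the subalgebra. -/
theorem L_mem_cartSub : inU 𝕂 T.𝓑local.L ∈ T.𝓑local.cartSub.z := by
  have h : T.𝓑local.L = ∑ i, T.B⁻¹ none i • T.h' i :=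
    Subtype.ext (map_sum (Submodule.subtype (T.𝓑comp 0))
      (fun i => T.B⁻¹ none i • (⟨T.bh i, T.h_mem i⟩ : T.𝓑comp 0)) Finset.univ).symm
  rw [h, map_sum]
  exact Submodule.sum_mem _ fun i _ => by
    rw [map_smul]; exact Submodule.smul_mem _ _ (T.h'_mem i)

theorem B_idx_none (i : Option {k : Fin r // T.lam k = 0}) : T.B (T.idx i) none = 0 := by
  rcases i with _ | ⟨k, hk⟩ <;> simp [idx, B, extendMatrix]
  exact hk

/-! #### The generators of `𝓑^W` -/

/-- The generator `e i` of the cartanification. -/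
noncomputable def cE (i : Fin r) : T.𝓑local.cartanification.Alg := T.𝓑local.zeroEl (T.e' i) (T.e'_mem i)
/-- The generator `f i` of the cartanification. -/
noncomputable def cF (i : Fin r) : T.𝓑local.cartanification.Alg := T.𝓑local.zeroEl (T.f' i) (T.f'_mem i)
/-- The generator `h i` of the cartanification. -/
noncomputable def cH (i : Option (Fin r)) : T.𝓑local.cartanification.Alg := T.𝓑local.zeroEl (T.h' i) (T.h'_mem i)
/-- The generator `e 0` of the cartanification. -/
noncomputable def cE0 : T.𝓑local.cartanification.Alg := T.𝓑local.posEl T.eo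
/-- The element `f 0 z` of the cartanification. -/
noncomputable def cF0 (z : T.𝓑local.G0) : T.𝓑local.cartanification.Alg := T.𝓑local.negEl T.fo z

theorem cE_mul_cF (i j : Fin r) : T.cE i * T.cF j = if i = j then T.cH (some j) else 0 := by
  rw [cE, cF, ContragredientLocal.zeroEl_mul_zeroEl]
  by_cases h : i = j
  · rw [if_pos h]
    exact T.𝓑local.zeroEl_congr (by rw [b00_e_f, if_pos h]) _ _
  · rw [if_neg h]
    have h1 : inU 𝕂 (0 : T.𝓑local.G0) ∈ T.𝓑local.cartSub.z := by
      rw [map_zero]; exact Submodule.zero_mem _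
    rw [T.𝓑local.zeroEl_congr (by rw [b00_e_f, if_neg h]) _ h1, ContragredientLocal.zeroEl_zero]

theorem cE0_mul_cF (j : Fin r) : T.cE0 * T.cF j = 0 := by
  rw [cE0, cF, ContragredientLocal.posEl_mul_zeroEl, b0p_f_eo, ContragredientLocal.posEl_zero,
    neg_zero]

theorem cH_mul_cF (i : Option (Fin r)) (j : Fin r) : T.cH i * T.cF j = -T.B i (some j) • T.cF j := by
  have h : inU 𝕂 (-T.B i (some j) • T.f' j) ∈ T.𝓑local.cartSub.z := by
    rw [map_smul]; exact Submodule.smul_mem _ _ (T.f'_mem j)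
  rw [cH, cF, ContragredientLocal.zeroEl_mul_zeroEl, T.𝓑local.zeroEl_congr (T.b00_h_f i j) _ h,
    ContragredientLocal.zeroEl_smul]

theorem cH_mul_cE (i : Option (Fin r)) (j : Fin r) : T.cH i * T.cE j = T.B i (some j) • T.cE j := by
  have h : inU 𝕂 (T.B i (some j) • T.e' j) ∈ T.𝓑local.cartSub.z := by
    rw [map_smul]; exact Submodule.smul_mem _ _ (T.e'_mem j)
  rw [cH, cE, ContragredientLocal.zeroEl_mul_zeroEl, T.𝓑local.zeroEl_congr (T.b00_h_e i j) _ h,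
    ContragredientLocal.zeroEl_smul]

theorem cH_mul_cE0 (i : Option (Fin r)) : T.cH i * T.cE0 = T.B i none • T.cE0 := by
  rw [cH, cE0, ContragredientLocal.zeroEl_mul_posEl, b0p_h_eo, ContragredientLocal.posEl_smul]

theorem cE0_mul_cF0_h {i : Option (Fin r)} (hi : T.B i none = 0) :
    T.cE0 * T.cF0 (T.h' i) = T.cH i := by
  rw [cE0, cF0, ContragredientLocal.posEl_mul_negEl]
  exact T.𝓑local.zeroEl_congr (T.pairing_eo_fo_h hi) _ _

theorem cH_mul_cF0_h (i j : Option (Fin r)) :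
    T.cH i * T.cF0 (T.h' j) = -T.B i none • T.cF0 (T.h' j) := by
  rw [cH, cF0, ContragredientLocal.zeroEl_mul_negEl, b00_h_h, ContragredientLocal.negEl_zero_right,
    add_zero, b0m_h_fo, ContragredientLocal.negEl_smul_left]

/-- As e i commutes with f 0, it acts on f 0 z through z alone. For the f k below this requires λ k
= 0. -/
theorem cE_mul_cF0 (i : Fin r) (z : T.𝓑local.G0) :
    T.cE i * T.cF0 z = T.cF0 (T.𝓑local.b00 (T.e' i) z) :=
  T.𝓑local.zeroEl_mul_negEl_of_eq_zero _ (T.b0m_e_fo i) z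

theorem cF_mul_cF0 {k : Fin r} (hk : T.lam k = 0) (z : T.𝓑local.G0) :
    T.cF k * T.cF0 z = T.cF0 (T.𝓑local.b00 (T.f' k) z) :=
  T.𝓑local.zeroEl_mul_negEl_of_eq_zero _ (T.b0m_f_fo hk) z

theorem cF0_smul (c : 𝕂) (z : T.𝓑local.G0) : T.cF0 (c • z) = c • T.cF0 z :=
  T.𝓑local.negEl_smul_right _ c z

theorem cF0_zero : T.cF0 0 = 0 := T.𝓑local.negEl_zero_right _

theorem cE_mul_cF0_h (i : Fin r) (j : Option (Fin r)) :
    T.cE i * T.cF0 (T.h' j) = -T.B j (some i) • T.cF0 (T.e' i) := by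
  rw [cE_mul_cF0, b00_e_h, cF0_smul]

theorem cF_mul_cF0_h {k : Fin r} (hk : T.lam k = 0) (j : Option (Fin r)) :
    T.cF k * T.cF0 (T.h' j) = T.B j (some k) • T.cF0 (T.f' k) := by
  rw [T.cF_mul_cF0 hk, b00_f_h, cF0_smul]

theorem cE_serre {i j : Fin r} (hij : i ≠ j) {n : ℕ} (hn : (n : 𝕂) = 1 - T.B (some i) (some j)) :
    (T.cE i * ·)^[n] (T.cE j) = 0 := by
  have h1 : (T.𝓑local.b00 (T.e' i) ·)^[n] (T.e' j) = 0 := Subtype.ext (by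
    rw [coe_iterate_b00]
    exact T.be_serre (by simpa using hij) hn)
  have h2 : inU 𝕂 (0 : T.𝓑local.G0) ∈ T.𝓑local.cartSub.z := by
    rw [map_zero]; exact Submodule.zero_mem _
  unfold cE
  rw [ContragredientLocal.zeroEl_mul_iterate_zeroEl, T.𝓑local.zeroEl_congr h1 _ h2,
    ContragredientLocal.zeroEl_zero]

theorem cF_serre {i j : Fin r} (hij : i ≠ j) {n : ℕ} (hn : (n : 𝕂) = 1 - T.B (some i) (some j)) :
    (T.cF i * ·)^[n] (T.cF j) = 0 := by
  have h1 : (T.𝓑local.b00 (T.f' i) ·)^[n] (T.f' j) = 0 := Subtype.ext (by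
    rw [coe_iterate_b00]
    exact T.bf_serre (by simpa using hij) hn)
  have h2 : inU 𝕂 (0 : T.𝓑local.G0) ∈ T.𝓑local.cartSub.z := by
    rw [map_zero]; exact Submodule.zero_mem _
  unfold cF
  rw [ContragredientLocal.zeroEl_mul_iterate_zeroEl, T.𝓑local.zeroEl_congr h1 _ h2,
    ContragredientLocal.zeroEl_zero]

theorem cE_serre_cE0 (i : Fin r) {n : ℕ} (hn : (n : 𝕂) = 1 - T.B (some i) none) :
    (T.cE i * ·)^[n] T.cE0 = 0 := by
  have h1 : (T.𝓑local.b0p (T.e' i) ·)^[n] T.eo = 0 := Subtype.ext (by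
    rw [coe_iterate_b0p]
    exact T.be_serre (by simp) hn)
  unfold cE cE0
  rw [ContragredientLocal.zeroEl_mul_iterate_posEl, h1, ContragredientLocal.posEl_zero]

theorem evalW_iterate (x y : FreeNA 𝕂 (WGen.{u} T.lam)) (n : ℕ) :
    T.evalW ((x * ·)^[n] y) = (T.evalW x * ·)^[n] (T.evalW y) := by
  induction n with
  | zero => rfl
  | succ n ih =>
    simp only [Function.iterate_succ_apply', ← ih, map_mul]

theorem evalW_gen (x : WGen.{u} T.lam) : T.evalW (gen 𝕂 x) = T.genImage x :=
  FreeNonUnitalNonAssocAlgebra.lift_of_apply 𝕂 T.genImage x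

variable {T}

/-! ### The defining relations of `Wtilde` in `𝓑W`. -/

section PseudoMinuscule

variable (hT : T.IsPseudoMinuscule T.lamTri)
include hT

theorem exists_label : ∃ m : Fin r → ℕ, ∀ i, T.lamTri i = m i := by
  choose m hm using hT.1
  exact ⟨m, hm⟩

/-- It suffices that [[e 0, x z], e 0] = 0 for all x and z. Written out with `coe_pairing`, this is
`bracket_bracket_be_none`. -/
theorem cE0_mul_cE0 : T.cE0 * T.cE0 = 0 := by
  obtain ⟨m, hm⟩ := exists_label hT
  refine T.𝓑local.posEl_mul_self T.L_mem_cartSub _ fun x z => Subtype.ext ?_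
  change (T.𝓑local.pairing T.eo x z).1 * T.be none = 0
  rw [coe_pairing]
  change (T.coeffH0 (x.1 * T.be none) • z.1 - (z.1 * T.be none) * x.1 -
    T.coeffH0 (x.1 * (z.1 * T.be none)) • T.L) * T.be none = 0
  have h1 := T.odd_swap x T.eo
  have h2 := T.odd_swap x (T.𝓑local.b0p z T.eo)
  change x.1 * T.be none = T.be none * x.1 at h1
  change x.1 * (z.1 * T.be none) = (z.1 * T.be none) * x.1 at h2
  rw [sub_mul, sub_mul, smul_mul_assoc, smul_mul_assoc, bracket_bracket_be_none hT hm x.2 z.2,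
    T.L_mul T.be_none_mem, h1, h2, Int.cast_one, one_smul]
  abel

/-- In the pairing with y ∈ 𝓑₁ one has [[e j, y], f 0] = [e j, [y, f 0]], since e j commutes with f
0. The coefficient of `L` is then that of h 0 in a bracket inside 𝓑₀, hence zero, and the other two
terms cancel by `be_mul_bracket_bf_none`. -/
theorem cF0_e {j : Fin r} (hj : T.lam j ≠ 0) : T.cF0 (T.e' j) = 0 := by
  obtain ⟨m, hm⟩ := exists_label hT
  refine T.𝓑local.negEl_eq_zero fun y => Subtype.ext ?_
  rw [coe_pairing]
  change T.coeffH0 (T.bf none * y.1) • T.be (some j) - (T.be (some j) * y.1) * T.bf none -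
    T.coeffH0 (T.bf none * (T.be (some j) * y.1)) • T.L = 0
  have h1 := T.odd_swap T.fo y
  have h2 := T.odd_swap T.fo (T.𝓑local.b0p (T.e' j) y)
  change T.bf none * y.1 = y.1 * T.bf none at h1
  change T.bf none * (T.be (some j) * y.1) = (T.be (some j) * y.1) * T.bf none at h2
  have h3 := T.zero_mul_mul (T.be_some_mem j) y.1 (T.bf none)
  rw [be_mul_bf_none, mul_zero, add_zero] at h3
  rw [h2, h1, ← h3, T.coeffH0_mul (T.be_some_mem j) (T.𝓑.mul_mem _ (by norm_num) y.2 T.bf_none_mem),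
    be_mul_bracket_bf_none hT hm hj y.2]
  simp

/-- The exponent is m j + 1. If m j = 0, then λ j = 0 and e j commutes with e 0. Otherwise e 0 is
applied at least twice, and its square is zero. -/
theorem cE0_serre_cE (j : Fin r) {n : ℕ} (hn : (n : 𝕂) = 1 - T.B none (some j)) :
    (T.cE0 * ·)^[n] (T.cE j) = 0 := by
  obtain ⟨m, hm⟩ := exists_label hT
  have h1 : n = m j + 1 := by
    have : (n : 𝕂) = ((m j + 1 : ℕ) : 𝕂) := by
      rw [hn]; simp [B, extendMatrix, hm]; ring
    exact_mod_cast this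
  subst h1
  rcases h2 : m j with _ | k
  · have h3 : T.lam j = 0 := (T.lamTri_eq_zero_iff j).1 (by rw [hm, h2, Nat.cast_zero])
    change T.cE0 * T.cE j = 0
    rw [cE0, cE, ContragredientLocal.posEl_mul_zeroEl, T.b0p_e_eo h3, ContragredientLocal.posEl_zero,
      neg_zero]
  · rw [Function.iterate_succ_apply', Function.iterate_succ_apply']
    set v := (T.cE0 * ·)^[k] (T.cE j)
    have h3 : T.cE0 ∈ T.𝓑local.cartanification.comp
        (LocalLieSuperalgebra.Gen.par T.𝓑local.localCartanification) 1 :=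
      T.𝓑local.respects.inP_mem _
    have h4 := odd_jacobi T.𝓑local.cart_isSuper h3 h3 v
    rw [cE0_mul_cE0 hT, zero_mul, zero_sub, eq_neg_iff_add_eq_zero, ← two_smul 𝕂] at h4
    exact (smul_eq_zero.1 h4).resolve_left two_ne_zero

theorem cF_serre_cF0_h {j : Fin r} (hj : T.lam j ≠ 0) (i : Option (Fin r)) {n : ℕ}
    (hn : (n : 𝕂) = 1 - T.B (some j) none) : (T.cF j * ·)^[n] (T.cF0 (T.h' i)) = 0 := by
  have h1 : (T.𝓑local.b0m (T.f' j) ·)^[n] T.fo = 0 := Subtype.ext (by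
    rw [coe_iterate_b0m]
    exact T.bf_serre (by simp) hn)
  have h2 : n = T.lam j + 1 := by
    have : (n : 𝕂) = ((T.lam j + 1 : ℕ) : 𝕂) := by
      rw [hn]; simp [B, extendMatrix]; ring
    exact_mod_cast this
  subst h2
  obtain ⟨l, hl⟩ := Nat.exists_eq_succ_of_ne_zero hj
  rw [hl] at h1 ⊢
  have hff : T.𝓑local.b00 (T.f' j) (T.f' j) = 0 := T.𝓑local.alt _
  -- With λ j = l + 1, apply ad f j to f 0 e j = 0 exactly λ j + 2 times. Since λ j + 1 applications
  -- kill f 0, the only surviving term has two of them on e j, giving [f j, [f j, e j]] = -2 f j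
  -- with a nonzero binomial coefficient.
  have h3 : T.𝓑local.negEl ((T.𝓑local.b0m (T.f' j) ·)^[l + 1] T.fo) (T.f' j) = 0 := by
    have h4 := T.𝓑local.zeroEl_mul_iterate_negEl (T.f'_mem j) T.fo (z := T.e' j)
      (by rw [b00_f_e, map_neg, b00_f_h, map_neg, map_smul, hff]; simp) (l + 1)
    have h5 : (T.𝓑local.b0m (T.f' j) ·)^[l + 1 + 2] T.fo = 0 := by
      rw [Function.iterate_succ_apply', h1, map_zero]
    have h6 : T.𝓑local.negEl T.fo (T.e' j) = 0 := cF0_e hT hj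
    have h7 : ∀ n, (T.𝓑local.zeroEl (T.f' j) (T.f'_mem j) * ·)^[n] 0 = 0 := fun n =>
      Function.iterate_fixed (mul_zero _) n
    have h8 : T.𝓑local.b00 (T.f' j) (T.𝓑local.b00 (T.f' j) (T.e' j)) = (-2 : 𝕂) • T.f' j := by
      rw [b00_f_e, map_neg, b00_f_h, B_diag, neg_smul]
    rw [h6, h7, h5, h1, ContragredientLocal.negEl_zero_left, ContragredientLocal.negEl_zero_left,
      smul_zero, add_zero, zero_add, h8, ContragredientLocal.negEl_smul_right, smul_smul] at h4
    refine (smul_eq_zero.1 h4.symm).resolve_left ?_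
    have h9 : ((l + 1 : ℕ) : 𝕂) + 2 ≠ 0 := by exact_mod_cast Nat.succ_ne_zero (l + 1 + 1)
    have h10 : ((l + 1 : ℕ) : 𝕂) + 1 ≠ 0 := by exact_mod_cast Nat.succ_ne_zero (l + 1)
    exact mul_ne_zero (div_ne_zero (mul_ne_zero h9 h10) two_ne_zero) (by norm_num)
  -- Now λ j + 1 applications to f 0 h i: the first term vanishes by the Serre relation of 𝓑, the
  -- second by the previous step, and the third because [f j, f j] = 0.
  have h4 := T.𝓑local.zeroEl_mul_iterate_negEl (T.f'_mem j) T.fo (z := T.h' i)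
    (by rw [b00_f_h, map_smul, hff]; simp) l
  refine h4.trans ?_
  rw [h1, b00_f_h, map_smul, hff, ContragredientLocal.negEl_smul_right, h3, smul_zero, smul_zero,
    smul_zero, ContragredientLocal.negEl_zero_left, ContragredientLocal.negEl_zero_right]
  simp

/-- The pseudo-minuscule condition is felt only where e 0 acts on e 0 or on some e j, or where an
index of J meets the elements f 0 h i. The remaining relations are brackets of 𝓑 carried over to the
cartanification. -/
theorem evalW_rel (R : FreeNA 𝕂 (WGen.{u} T.lam)) (hR : T.RelW R) : T.evalW R = 0 := by
  induction hR with
  | ef i j =>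
    rcases i with _ | i
    · rw [if_neg (by simp), sub_zero, map_mul, evalW_gen, evalW_gen]
      exact T.cE0_mul_cF j
    · by_cases h : i = j
      · rw [if_pos (by rw [h]), map_sub, map_mul, evalW_gen, evalW_gen, evalW_gen, sub_eq_zero]
        exact (T.cE_mul_cF i j).trans (if_pos h)
      · rw [if_neg (by simpa using h), sub_zero, map_mul, evalW_gen, evalW_gen]
        exact (T.cE_mul_cF i j).trans (if_neg h)
  | hf i j =>
    rw [map_add, map_smul, map_mul, evalW_gen, evalW_gen, add_eq_zero_iff_eq_neg, ← neg_smul]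
    exact T.cH_mul_cF i j
  | he i j =>
    rw [map_sub, map_smul, map_mul, evalW_gen, evalW_gen, sub_eq_zero]
    rcases j with _ | j
    · exact T.cH_mul_cE0 i
    · exact T.cH_mul_cE i j
  | e0f0 i =>
    rw [map_sub, map_mul, evalW_gen, evalW_gen, evalW_gen, sub_eq_zero]
    exact T.cE0_mul_cF0_h (T.B_idx_none i)
  | hf0 i j =>
    rw [map_add, map_smul, map_mul, evalW_gen, evalW_gen, add_eq_zero_iff_eq_neg, ← neg_smul]
    exact T.cH_mul_cF0_h i _
  | serre_e i j n hn =>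
    rw [evalW_iterate, evalW_gen, evalW_gen]
    rcases i with _ | i <;> rcases j with _ | j
    · have h : n = 1 := by
        have : (n : 𝕂) = (1 : ℕ) := by rw [hn]; simp [B, extendMatrix]
        exact_mod_cast this
      subst h
      exact cE0_mul_cE0 hT
    · exact cE0_serre_cE hT j hn
    · exact T.cE_serre_cE0 i hn
    · refine T.cE_serre ?_ hn
      -- Equal indices would make the exponent 1 - 2 = -1, which is not a natural number.
      rintro rfl
      rw [B_diag] at hn
      have : ((n + 1 : ℕ) : 𝕂) = (0 : ℕ) := by push_cast; rw [hn]; norm_num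
      exact absurd (Nat.cast_injective this) (Nat.succ_ne_zero n)
  | serre_f i j n hn =>
    rw [evalW_iterate, evalW_gen, evalW_gen]
    refine T.cF_serre ?_ hn
    rintro rfl
    rw [B_diag] at hn
    have : ((n + 1 : ℕ) : 𝕂) = (0 : ℕ) := by push_cast; rw [hn]; norm_num
    exact absurd (Nat.cast_injective this) (Nat.succ_ne_zero n)
  | eff0 k l i =>
    have h1 : T.cE k.1 * (T.cF l.1 * T.cF0 (T.h' (T.idx i))) =
        T.B (T.idx i) (some l.1) • T.cF0 (T.𝓑local.b00 (T.e' k.1) (T.f' l.1)) := by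
      rw [T.cF_mul_cF0_h l.2, mul_smul_comm, cE_mul_cF0]
    rw [b00_e_f] at h1
    by_cases h : k = l
    · rw [if_pos h, map_sub, map_smul, map_mul, map_mul, evalW_gen, evalW_gen, evalW_gen, evalW_gen,
        sub_eq_zero]
      rw [if_pos (by rw [h])] at h1
      subst h
      exact h1
    · rw [if_neg h, sub_zero, map_mul, map_mul, evalW_gen, evalW_gen, evalW_gen]
      rw [if_neg (fun h2 => h (Subtype.ext h2)), cF0_zero, smul_zero] at h1
      exact h1
  | serre_f0 j hj i n hn =>
    rw [evalW_iterate, evalW_gen, evalW_gen]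
    exact cF_serre_cF0_h hT hj _ hn
  | ef0 j hj i =>
    rw [map_mul, evalW_gen, evalW_gen]
    exact (T.cE_mul_cF0_h j _).trans (by rw [cF0_e hT hj, smul_zero]; rfl)
  | eef0 k i =>
    rw [map_mul, map_mul, evalW_gen, evalW_gen]
    have : T.cE k.1 * (T.cE k.1 * T.cF0 (T.h' (T.idx i))) = 0 := by
      rw [cE_mul_cF0_h, mul_smul_comm, cE_mul_cF0, T.𝓑local.alt, cF0_zero, smul_zero]
    exact this
  | fff0 k i =>
    rw [map_mul, map_mul, evalW_gen, evalW_gen]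
    have : T.cF k.1 * (T.cF k.1 * T.cF0 (T.h' (T.idx i))) = 0 := by
      rw [T.cF_mul_cF0_h k.2, mul_smul_comm, T.cF_mul_cF0 k.2, T.𝓑local.alt, cF0_zero, smul_zero]
    exact this
  | ejf0 j hj k i =>
    rw [map_mul, map_mul, evalW_gen, evalW_gen, evalW_gen]
    have : T.cE j * (T.cE k.1 * T.cF0 (T.h' (T.idx i))) = 0 := by
      -- As e k commutes with f 0, f 0 [e j, e k] = -[e k, f 0 e j], and f 0 e j is zero.
      have h : T.cF0 (T.𝓑local.b00 (T.e' j) (T.e' k.1)) = 0 := by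
        rw [b00_skew, ← neg_one_smul 𝕂, cF0_smul, ← cE_mul_cF0, cF0_e hT hj, mul_zero, smul_zero]
      rw [cE_mul_cF0_h, mul_smul_comm, cE_mul_cF0, h, smul_zero]
    exact this

end PseudoMinuscule

end Triple

end Cartanification

/-! ### Local homomorphisms from values on generators. -/

namespace Cartanification

open Presentation

section Construction

variable {𝕂 : Type u} [Field 𝕂] {X Y : Type u}

variable (𝕂) in
/-- The component of degree `n` of the free algebra. -/
noncomputable def freeComp {G : Type*} [Add G] (w : X → G) (n : G) : Submodule 𝕂 (FreeNA 𝕂 X) :=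
  Submodule.span 𝕂 {x | ∃ m : FreeMagma X, mdeg w m = n ∧ mon 𝕂 m = x}

theorem gen_mem_freeComp {G : Type*} [Add G] (w : X → G) (x : X) :
    gen 𝕂 x ∈ freeComp 𝕂 w (w x) :=
  Submodule.subset_span ⟨FreeMagma.of x, rfl, rfl⟩

theorem mul_mem_freeComp {G : Type*} [Add G] {w : X → G} {k l n : G} (h : k + l = n)
    {x y : FreeNA 𝕂 X} (hx : x ∈ freeComp 𝕂 w k) (hy : y ∈ freeComp 𝕂 w l) :
    x * y ∈ freeComp 𝕂 w n := by
  induction hx using Submodule.span_induction with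
  | zero => simp
  | add a b _ _ ha hb => rw [add_mul]; exact Submodule.add_mem _ ha hb
  | smul c a _ ha => rw [smul_mul_assoc]; exact Submodule.smul_mem _ _ ha
  | mem a ha =>
    obtain ⟨m, hm, rfl⟩ := ha
    induction hy using Submodule.span_induction with
    | zero => simp
    | add a b _ _ ha hb => rw [mul_add]; exact Submodule.add_mem _ ha hb
    | smul c a _ ha => rw [mul_smul_comm]; exact Submodule.smul_mem _ _ ha
    | mem a ha =>
      obtain ⟨m', hm', rfl⟩ := ha
      exact Submodule.subset_span ⟨m * m', by simp [hm, hm', h], mon_mul 𝕂 _ _⟩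

theorem map_freeComp {G : Type*} [Add G] (P : Presentation 𝕂 X) (w : X → G) (n : G) :
    (freeComp 𝕂 w n).map P.proj = P.comp w n := by
  rw [freeComp, Submodule.map_span]
  refine congrArg _ (Set.ext fun x => ?_)
  constructor
  · rintro ⟨_, ⟨m, hm, rfl⟩, rfl⟩
    exact ⟨m, hm, rfl⟩
  · rintro ⟨m, hm, rfl⟩
    exact ⟨_, ⟨m, hm, rfl⟩, rfl⟩

theorem map_freeComp_mem {G : Type*} [Add G] {w : X → G} {w' : Y → G} {P' : Presentation 𝕂 Y}
    (φ : FreeNA 𝕂 X →ₙₐ[𝕂] P'.Alg) (hg : ∀ x, φ (gen 𝕂 x) ∈ P'.comp w' (w x)) {n : G}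
    {x : FreeNA 𝕂 X} (hx : x ∈ freeComp 𝕂 w n) : φ x ∈ P'.comp w' n := by
  have h : freeComp 𝕂 w n ≤ (P'.comp w' n).comap (φ : FreeNA 𝕂 X →ₗ[𝕂] P'.Alg) := by
    refine Submodule.span_le.2 ?_
    rintro _ ⟨m, rfl, rfl⟩
    exact map_mon_mem φ hg m
  exact h hx

/-- A linear section of the projection from the free component defines the map, and `hφ` makes its
value independent of the representative. Only relations of degree `n` have to be respected. -/
theorem exists_compMap {P : Presentation 𝕂 X} {P' : Presentation 𝕂 Y} {w : X → ℤ} {w' : Y → ℤ}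
    (φ : FreeNA 𝕂 X →ₙₐ[𝕂] P'.Alg) (hg : ∀ x, φ (gen 𝕂 x) ∈ P'.comp w' (w x)) (n : ℤ)
    (hφ : ∀ x ∈ freeComp 𝕂 w n, P.proj x = 0 → φ x = 0) :
    ∃ g : P.comp w n →ₗ[𝕂] P'.comp w' n, ∀ x ∈ freeComp 𝕂 w n, ∀ y : P.comp w n,
      P.proj x = y.1 → (g y).1 = φ x := by
  let π : freeComp 𝕂 w n →ₗ[𝕂] P.comp w n :=
    (P.proj.comp (freeComp 𝕂 w n).subtype).codRestrict _ fun x =>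
      map_freeComp P w n ▸ Submodule.mem_map_of_mem x.2
  let ψ : freeComp 𝕂 w n →ₗ[𝕂] P'.comp w' n :=
    ((φ : FreeNA 𝕂 X →ₗ[𝕂] P'.Alg).comp (freeComp 𝕂 w n).subtype).codRestrict _ fun x =>
      map_freeComp_mem φ hg x.2
  have hπ : LinearMap.range π = ⊤ := by
    rw [LinearMap.range_eq_top]
    rintro ⟨y, hy⟩
    obtain ⟨x, hx, rfl⟩ := (map_freeComp P w n).symm ▸ hy
    exact ⟨⟨x, hx⟩, rfl⟩
  obtain ⟨σ, hσ⟩ := π.exists_rightInverse_of_surjective hπ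
  refine ⟨ψ ∘ₗ σ, fun x hx y hy => ?_⟩
  have h1 : P.proj (σ y).1 = y.1 := congrArg Subtype.val (LinearMap.congr_fun hσ y)
  have h2 := hφ ((σ y).1 - x) (Submodule.sub_mem _ (σ y).2 hx) (by rw [map_sub, h1, hy, sub_self])
  rw [map_sub, sub_eq_zero] at h2
  exact h2

/-- Products of homogeneous representatives represent the products, so a single argument covers all
four brackets. -/
theorem exists_localHom [CharZero 𝕂] {P : Presentation 𝕂 X} {P' : Presentation 𝕂 Y}
    {p : X → ZMod 2} {q : Y → ZMod 2} {w : X → ℤ} {w' : Y → ℤ} (hP : P.IsSuper p)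
    (hw : Consistent p w) (hP' : P'.IsSuper q) (hw' : Consistent q w')
    (φ : FreeNA 𝕂 X →ₙₐ[𝕂] P'.Alg) (hg : ∀ x, φ (gen 𝕂 x) ∈ P'.comp w' (w x))
    (hφ : ∀ n : ℤ, |n| ≤ 1 → ∀ x ∈ freeComp 𝕂 w n, P.proj x = 0 → φ x = 0) :
    ∃ Φ : LocalHom (P.localPart hP hw) (P'.localPart hP' hw'),
      (∀ x ∈ freeComp 𝕂 w (-1), ∀ y : P.comp w (-1), P.proj x = y.1 → (Φ.neg y).1 = φ x) ∧
      (∀ x ∈ freeComp 𝕂 w 0, ∀ y : P.comp w 0, P.proj x = y.1 → (Φ.zero y).1 = φ x) ∧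
      (∀ x ∈ freeComp 𝕂 w 1, ∀ y : P.comp w 1, P.proj x = y.1 → (Φ.pos y).1 = φ x) := by
  obtain ⟨gm, hm⟩ := exists_compMap (P := P) φ hg (-1) (hφ _ (by norm_num))
  obtain ⟨gz, hz⟩ := exists_compMap (P := P) φ hg 0 (hφ _ (by norm_num))
  obtain ⟨gp, hp⟩ := exists_compMap (P := P) φ hg 1 (hφ _ (by norm_num))
  have key : ∀ {k l n : ℤ} (h : k + l = n) {gk : P.comp w k →ₗ[𝕂] P'.comp w' k}
      {gl : P.comp w l →ₗ[𝕂] P'.comp w' l} {gn : P.comp w n →ₗ[𝕂] P'.comp w' n},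
      (∀ x ∈ freeComp 𝕂 w k, ∀ y : P.comp w k, P.proj x = y.1 → (gk y).1 = φ x) →
      (∀ x ∈ freeComp 𝕂 w l, ∀ y : P.comp w l, P.proj x = y.1 → (gl y).1 = φ x) →
      (∀ x ∈ freeComp 𝕂 w n, ∀ y : P.comp w n, P.proj x = y.1 → (gn y).1 = φ x) →
      ∀ (y : P.comp w k) (z : P.comp w l), gn (P.compMul w h y z) = P'.compMul w' h (gk y) (gl z) := by
    intro k l n h gk gl gn hk hl hn y z
    obtain ⟨y', hy, hy'⟩ := (map_freeComp P w k).ge y.2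
    obtain ⟨z', hz, hz'⟩ := (map_freeComp P w l).ge z.2
    apply Subtype.ext
    rw [compMul_coe, hk y' hy y hy', hl z' hz z hz', ← map_mul]
    refine hn _ (mul_mem_freeComp h hy hz) _ ?_
    rw [compMul_coe, ← hy', ← hz', proj_mul]
  exact ⟨⟨gm, gz, gp, key (by norm_num) hz hz hz, key (by norm_num) hz hm hm,
    key (by norm_num) hz hp hp, key (by norm_num) hp hm hz⟩, hm, hz, hp⟩

/-- A homomorphism that respects the relations of `P` respects the relations of low degree of the
minimal quotient of `P`. -/
theorem map_eq_zero_of_minimal [CharZero 𝕂] {P : Presentation 𝕂 X} {P' : Presentation 𝕂 Y}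
    {w : X → ℤ} {w' : Y → ℤ} {d : P'.Alg} (hd : P'.IsGrading w' d)
    (φ : FreeNA 𝕂 X →ₙₐ[𝕂] P'.Alg) (hg : ∀ x, φ (gen 𝕂 x) ∈ P'.comp w' (w x))
    (hφ : ∀ x ∈ P.ideal, φ x = 0) {n : ℤ} (hn : |n| ≤ 1) {x : FreeNA 𝕂 X}
    (hx : x ∈ freeComp 𝕂 w n) (h0 : (P.minimal w).proj x = 0) : φ x = 0 := by
  -- A new relation of the minimal quotient comes from degrees of absolute value at least two, so
  -- its image lies there as well. By its own degree the image also lies in the local part of `P'`,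
  -- and the grading element separates the two.
  have h1 := maxIdeal_le w (minimal_proj_eq_zero.1 h0)
  have h2 : (⨆ n ∈ {n : ℤ | 2 ≤ |n|}, P.comp w n) ≤
      (⨆ n ∈ {n : ℤ | 2 ≤ |n|}, P'.comp w' n).comap (P.lift φ hφ) := by
    refine iSup₂_le fun n hn => ?_
    rw [← map_freeComp P, Submodule.map_le_iff_le_comap]
    intro x hx
    exact le_biSup (P'.comp w') hn (map_freeComp_mem φ hg hx)
  have h3 : φ x ∈ P'.comp w' (-1) ⊔ P'.comp w' 0 ⊔ P'.comp w' 1 := by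
    rw [local_eq_iSup]
    refine le_biSup (P'.comp w') (i := n) ?_ (map_freeComp_mem φ hg hx)
    rw [abs_le] at hn
    simp only [Set.mem_insert_iff, Set.mem_singleton_iff]
    omega
  exact Submodule.disjoint_def.1 (disjoint_local hd) _ h3 (h2 h1)

/-! ### Homomorphisms of local parts are determined by the generators -/

/-- The span of the `n`-fold right-normed products `a₁ * (a₂ * (⋯ * aₙ₊₁))`. -/
noncomputable def chain {P : Presentation 𝕂 X} (A : Submodule 𝕂 P.Alg) : ℕ → Submodule 𝕂 P.Alg
  | 0 => A
  | n + 1 => Submodule.span 𝕂 {x | ∃ a ∈ A, ∃ v ∈ chain A n, x = a * v}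

theorem mul_mem_chain {P : Presentation 𝕂 X} {A : Submodule 𝕂 P.Alg} {n : ℕ} {a v : P.Alg}
    (ha : a ∈ A) (hv : v ∈ chain A n) : a * v ∈ chain A (n + 1) :=
  Submodule.subset_span ⟨a, ha, v, hv, rfl⟩

/-- Elements of `Z` act as derivations on right-normed products and preserve `A`. -/
theorem even_mul_mem_chain {P : Presentation 𝕂 X} {p : X → ZMod 2} (hP : P.IsSuper p)
    {A Z : Submodule 𝕂 P.Alg} (hZ : Z ≤ P.comp p 0) (hZA : ∀ z ∈ Z, ∀ a ∈ A, z * a ∈ A) {n : ℕ}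
    {z v : P.Alg} (hz : z ∈ Z) (hv : v ∈ chain A n) : z * v ∈ chain A n := by
  induction n generalizing v with
  | zero => exact hZA z hz v hv
  | succ n ih =>
    induction hv using Submodule.span_induction with
    | zero => rw [mul_zero]; exact Submodule.zero_mem _
    | add a b _ _ ha hb => rw [mul_add]; exact Submodule.add_mem _ ha hb
    | smul c a _ ha => rw [mul_smul_comm]; exact Submodule.smul_mem _ _ ha
    | mem v hv =>
      obtain ⟨a, ha, v, hv, rfl⟩ := hv
      rw [even_jacobi hP (hZ hz)]
      exact Submodule.add_mem _ (mul_mem_chain (hZA z hz a ha) hv) (mul_mem_chain ha (ih hv))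

/-- A factor of the opposite degree passes through the product. At each place it turns one factor
into an element of `Z`, which acts on what follows, so exactly one factor is lost. -/
theorem odd_mul_mem_chain {P : Presentation 𝕂 X} {p : X → ZMod 2} (hP : P.IsSuper p)
    {A Z C : Submodule 𝕂 P.Alg} (hA : A ≤ P.comp p 1) (hZ : Z ≤ P.comp p 0) (hC : C ≤ P.comp p 1)
    (hZA : ∀ z ∈ Z, ∀ a ∈ A, z * a ∈ A) (hCA : ∀ c ∈ C, ∀ a ∈ A, c * a ∈ Z) {n : ℕ}
    {c v : P.Alg} (hc : c ∈ C) (hv : v ∈ chain A (n + 1)) : c * v ∈ chain A n := by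
  induction hv using Submodule.span_induction with
  | zero => rw [mul_zero]; exact Submodule.zero_mem _
  | add a b _ _ ha hb => rw [mul_add]; exact Submodule.add_mem _ ha hb
  | smul c a _ ha => rw [mul_smul_comm]; exact Submodule.smul_mem _ _ ha
  | mem v hv =>
    obtain ⟨a, ha, v, hv, rfl⟩ := hv
    rw [odd_jacobi hP (hC hc) (hA ha)]
    refine Submodule.sub_mem _ (even_mul_mem_chain hP hZ hZA (hCA c hc a ha) hv) ?_
    induction n generalizing a v with
    | zero =>
      rw [← neg_neg (a * _), ← even_anti hP (hZ (hCA c hc v hv))]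
      exact Submodule.neg_mem _ (hZA _ (hCA c hc v hv) a ha)
    | succ n ih =>
      refine mul_mem_chain ha ?_
      induction hv using Submodule.span_induction with
      | zero => rw [mul_zero]; exact Submodule.zero_mem _
      | add a b _ _ ha hb => rw [mul_add]; exact Submodule.add_mem _ ha hb
      | smul c a _ ha => rw [mul_smul_comm]; exact Submodule.smul_mem _ _ ha
      | mem v hv =>
        obtain ⟨b, hb, v, hv, rfl⟩ := hv
        rw [odd_jacobi hP (hC hc) (hA hb)]
        exact Submodule.sub_mem _ (even_mul_mem_chain hP hZ hZA (hCA c hc b hb) hv) (ih b hb v hv)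

/-- A subalgebra of the local part, extended to all degrees. -/
noncomputable def chainFamily {P : Presentation 𝕂 X} (M Z A : Submodule 𝕂 P.Alg) : ℤ → Submodule 𝕂 P.Alg
  | .ofNat 0 => Z
  | .ofNat (n + 1) => chain A n
  | .negSucc n => chain M n

/-- A subalgebra of the local part that contains the generators is the whole local part. -/
theorem comp_le_of_local {P : Presentation 𝕂 X} {p : X → ZMod 2} (hP : P.IsSuper p) {w : X → ℤ}
    {M Z A : Submodule 𝕂 P.Alg} (hM : M ≤ P.comp p 1) (hZ : Z ≤ P.comp p 0) (hA : A ≤ P.comp p 1)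
    (hZZ : ∀ z ∈ Z, ∀ a ∈ Z, z * a ∈ Z) (hZM : ∀ z ∈ Z, ∀ a ∈ M, z * a ∈ M)
    (hZA : ∀ z ∈ Z, ∀ a ∈ A, z * a ∈ A) (hAM : ∀ a ∈ A, ∀ b ∈ M, a * b ∈ Z)
    (hgen : ∀ x, (w x = -1 ∧ P.proj (gen 𝕂 x) ∈ M) ∨ (w x = 0 ∧ P.proj (gen 𝕂 x) ∈ Z) ∨
      (w x = 1 ∧ P.proj (gen 𝕂 x) ∈ A)) (n : ℤ) : P.comp w n ≤ chainFamily M Z A n := by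
  have hMA : ∀ a ∈ M, ∀ b ∈ A, a * b ∈ Z := fun a ha b hb =>
    odd_comm hP (hM ha) (hA hb) ▸ hAM b hb a ha
  have hAZ : ∀ {A : Submodule 𝕂 P.Alg}, (∀ z ∈ Z, ∀ a ∈ A, z * a ∈ A) → ∀ a ∈ A, ∀ z ∈ Z,
      a * z ∈ A := by
    intro A h a ha z hz
    rw [← neg_neg (a * z), ← even_anti hP (hZ hz)]
    exact Submodule.neg_mem _ (h z hz a ha)
  -- `chain A n` consists of products of n + 1 factors, so it sits in degree n + 1, and `chain M n`
  -- in degree -(n + 1), which is `Int.negSucc n`.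
  refine comp_le_of_gen_mul hP (fun x => ?_) (fun x n v hv => ?_) n
  · rcases hgen x with ⟨h, hx⟩ | ⟨h, hx⟩ | ⟨h, hx⟩ <;> rw [h] <;> exact hx
  · rcases hgen x with ⟨h, hx⟩ | ⟨h, hx⟩ | ⟨h, hx⟩ <;> rw [h]
    · rcases n with (_ | n) | n
      · exact hAZ hZM _ hx _ hv
      · have e : (-1 : ℤ) + Int.ofNat (n + 1) = Int.ofNat n := by simp
        rw [e]
        rcases n with _ | n
        · exact hMA _ hx _ hv
        · exact odd_mul_mem_chain hP hA hZ hM hZA hMA hx hv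
      · have e : (-1 : ℤ) + Int.negSucc n = Int.negSucc (n + 1) := by omega
        rw [e]
        exact mul_mem_chain hx hv
    · rw [zero_add]
      rcases n with (_ | n) | n
      · exact hZZ _ hx _ hv
      · exact even_mul_mem_chain hP hZ hZA hx hv
      · exact even_mul_mem_chain hP hZ hZM hx hv
    · rcases n with (_ | n) | n
      · exact hAZ hZA _ hx _ hv
      · have e : (1 : ℤ) + Int.ofNat (n + 1) = Int.ofNat (n + 1 + 1) := by simp; ring
        rw [e]
        exact mul_mem_chain hx hv
      · rcases n with _ | n
        · exact hAM _ hx _ hv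
        · have e : (1 : ℤ) + Int.negSucc (n + 1) = Int.negSucc n := by omega
          rw [e]
          exact odd_mul_mem_chain hP hM hZ hA hZM hAM hx hv

/-- The elements on which the two maps agree form a graded subalgebra of the local part that
contains the generators. A monomial of low degree may have factors of high degree, where the maps
are not defined; `comp_le_of_local` deals with these. -/
theorem localHom_ext [CharZero 𝕂] {P : Presentation 𝕂 X} {p : X → ZMod 2} {w : X → ℤ}
    (hP : P.IsSuper p) (hw : Consistent p w) {H : LocalLieSuperalgebra 𝕂}
    (Φ Ψ : LocalHom (P.localPart hP hw) H)
    (hgen : ∀ x,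
      (∃ y : P.comp w (-1), w x = -1 ∧ P.proj (gen 𝕂 x) = y.1 ∧ Φ.neg y = Ψ.neg y) ∨
      (∃ y : P.comp w 0, w x = 0 ∧ P.proj (gen 𝕂 x) = y.1 ∧ Φ.zero y = Ψ.zero y) ∨
      (∃ y : P.comp w 1, w x = 1 ∧ P.proj (gen 𝕂 x) = y.1 ∧ Φ.pos y = Ψ.pos y)) : Φ = Ψ := by
  let M : Submodule 𝕂 P.Alg := (LinearMap.eqLocus Φ.neg Ψ.neg).map (P.comp w (-1)).subtype
  let Z : Submodule 𝕂 P.Alg := (LinearMap.eqLocus Φ.zero Ψ.zero).map (P.comp w 0).subtype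
  let A : Submodule 𝕂 P.Alg := (LinearMap.eqLocus Φ.pos Ψ.pos).map (P.comp w 1).subtype
  have hpar : ∀ n, P.comp w n ≤ P.comp p (n : ZMod 2) := P.comp_le_comp_par hw
  have key := comp_le_of_local hP (w := w) (M := M) (Z := Z) (A := A)
    (by rintro _ ⟨y, -, rfl⟩; simpa using hpar _ y.2)
    (by rintro _ ⟨y, -, rfl⟩; simpa using hpar _ y.2)
    (by rintro _ ⟨y, -, rfl⟩; simpa using hpar _ y.2)
    (by
      rintro _ ⟨z, hz : Φ.zero z = Ψ.zero z, rfl⟩ _ ⟨t, ht : Φ.zero t = Ψ.zero t, rfl⟩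
      exact ⟨(P.localPart hP hw).b00 z t,
        (Φ.map_b00 z t).trans ((by rw [hz, ht] : _ = _).trans (Ψ.map_b00 z t).symm), rfl⟩)
    (by
      rintro _ ⟨z, hz : Φ.zero z = Ψ.zero z, rfl⟩ _ ⟨t, ht : Φ.neg t = Ψ.neg t, rfl⟩
      exact ⟨(P.localPart hP hw).b0m z t,
        (Φ.map_b0m z t).trans ((by rw [hz, ht] : _ = _).trans (Ψ.map_b0m z t).symm), rfl⟩)
    (by
      rintro _ ⟨z, hz : Φ.zero z = Ψ.zero z, rfl⟩ _ ⟨t, ht : Φ.pos t = Ψ.pos t, rfl⟩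
      exact ⟨(P.localPart hP hw).b0p z t,
        (Φ.map_b0p z t).trans ((by rw [hz, ht] : _ = _).trans (Ψ.map_b0p z t).symm), rfl⟩)
    (by
      rintro _ ⟨z, hz : Φ.pos z = Ψ.pos z, rfl⟩ _ ⟨t, ht : Φ.neg t = Ψ.neg t, rfl⟩
      exact ⟨(P.localPart hP hw).bpm z t,
        (Φ.map_bpm z t).trans ((by rw [hz, ht] : _ = _).trans (Ψ.map_bpm z t).symm), rfl⟩)
    (by
      intro x
      rcases hgen x with ⟨y, h, h1, h2⟩ | ⟨y, h, h1, h2⟩ | ⟨y, h, h1, h2⟩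
      · exact Or.inl ⟨h, y, h2, h1.symm⟩
      · exact Or.inr (Or.inl ⟨h, y, h2, h1.symm⟩)
      · exact Or.inr (Or.inr ⟨h, y, h2, h1.symm⟩))
  apply LocalHom.ext
  · refine LinearMap.ext fun (y : P.comp w (-1)) => ?_
    obtain ⟨y', h, h'⟩ := key (-1) y.2
    rwa [Subtype.ext h'] at h
  · refine LinearMap.ext fun (y : P.comp w 0) => ?_
    obtain ⟨y', h, h'⟩ := key 0 y.2
    rwa [Subtype.ext h'] at h
  · refine LinearMap.ext fun (y : P.comp w 1) => ?_
    obtain ⟨y', h, h'⟩ := key 1 y.2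
    rwa [Subtype.ext h'] at h

end Construction

/-! ### The homomorphism from the local part of `W` to that of `𝓑W`. -/

namespace Triple

variable {𝕂 : Type u} [Field 𝕂] [CharZero 𝕂] {r : ℕ} {T : Triple 𝕂 r}

theorem genImage_mem (x : WGen.{u} T.lam) :
    T.genImage x ∈ T.𝓑W.comp (LocalLieSuperalgebra.Gen.deg T.𝓑local.localCartanification)
      (WGen.deg T.lam x) := by
  rcases x with (_ | i) | j | i | k
  · exact T.𝓑We0.2
  · exact (T.𝓑We i).2
  · exact (T.𝓑Wf j).2
  · exact (T.𝓑Wh i).2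
  · exact (T.𝓑Wf0h (T.idx k)).2

theorem genImage_mem_par (x : WGen.{u} T.lam) :
    T.genImage x ∈ T.𝓑W.comp (LocalLieSuperalgebra.Gen.par T.𝓑local.localCartanification)
      (WGen.par T.lam x) := by
  rw [WGen.consistent T.lam x]
  exact comp_le_comp_par _ LocalLieSuperalgebra.consistent_gen _ (genImage_mem x)

theorem exists_unique_localHom (hT : T.IsPseudoMinuscule T.lamTri) :
    ∃! φ : LocalHom T.Wlocal T.𝓑Wlocal,
      (∀ i, φ.neg (T.Wf0 i) = T.𝓑Wf0h (T.idx i)) ∧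
      (∀ i, φ.zero (T.We i) = T.𝓑We i) ∧
      (∀ i, φ.zero (T.Wf i) = T.𝓑Wf i) ∧
      (∀ i, φ.zero (T.Wh i) = T.𝓑Wh i) ∧
      φ.pos T.We0 = T.𝓑We0 := by
  have hg : ∀ x, T.evalW (gen 𝕂 x) ∈ T.𝓑W.comp
      (LocalLieSuperalgebra.Gen.deg T.𝓑local.localCartanification) (WGen.deg T.lam x) :=
    fun x => T.evalW_gen x ▸ genImage_mem x
  have hI : ∀ x ∈ T.Wtilde.ideal, T.evalW x = 0 :=
    map_superPresentation_ideal T.𝓑local.cart_isSuper T.evalW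
      (fun x => T.evalW_gen x ▸ genImage_mem_par x) (evalW_rel hT)
  obtain ⟨Φ, hm, hz, hp⟩ := exists_localHom T.W_isSuper (WGen.consistent T.lam)
    T.𝓑local.cart_isSuper LocalLieSuperalgebra.consistent_gen T.evalW hg
    (fun n hn x hx h0 => map_eq_zero_of_minimal (T.𝓑local.cart_isGrading T.L_mem_cartSub) T.evalW hg
      hI hn hx h0)
  have e1 : ∀ i, Φ.neg (T.Wf0 i) = T.𝓑Wf0h (T.idx i) := fun i => Subtype.ext
    ((hm _ (gen_mem_freeComp (WGen.deg T.lam) (.f0 i)) (T.Wf0 i) rfl).trans (T.evalW_gen _))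
  have e2 : ∀ i, Φ.zero (T.We i) = T.𝓑We i := fun i => Subtype.ext
    ((hz _ (gen_mem_freeComp (WGen.deg T.lam) (.e (some i))) (T.We i) rfl).trans (T.evalW_gen _))
  have e3 : ∀ i, Φ.zero (T.Wf i) = T.𝓑Wf i := fun i => Subtype.ext
    ((hz _ (gen_mem_freeComp (WGen.deg T.lam) (.f i)) (T.Wf i) rfl).trans (T.evalW_gen _))
  have e4 : ∀ i, Φ.zero (T.Wh i) = T.𝓑Wh i := fun i => Subtype.ext
    ((hz _ (gen_mem_freeComp (WGen.deg T.lam) (.h i)) (T.Wh i) rfl).trans (T.evalW_gen _))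
  have e5 : Φ.pos T.We0 = T.𝓑We0 := Subtype.ext
    ((hp _ (gen_mem_freeComp (WGen.deg T.lam) (.e none)) T.We0 rfl).trans (T.evalW_gen _))
  refine ⟨Φ, ⟨e1, e2, e3, e4, e5⟩, ?_⟩
  rintro Ψ ⟨h1, h2, h3, h4, h5⟩
  refine localHom_ext T.W_isSuper (WGen.consistent T.lam) Ψ Φ fun x => ?_
  rcases x with (_ | i) | j | i | k
  · exact Or.inr (Or.inr ⟨T.We0, rfl, rfl, h5.trans e5.symm⟩)
  · exact Or.inr (Or.inl ⟨T.We i, rfl, rfl, (h2 i).trans (e2 i).symm⟩)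
  · exact Or.inr (Or.inl ⟨T.Wf j, rfl, rfl, (h3 j).trans (e3 j).symm⟩)
  · exact Or.inr (Or.inl ⟨T.Wh i, rfl, rfl, (h4 i).trans (e4 i).symm⟩)
  · exact Or.inl ⟨T.Wf0 k, rfl, rfl, (h1 k).trans (e1 k).symm⟩

end Triple

end Cartanification

theorem proposition4p1 {𝕂 : Type u} [Field 𝕂] [IsAlgClosed 𝕂] [CharZero 𝕂] {r : ℕ}
    (T : Cartanification.Triple 𝕂 r) (hT : T.IsPseudoMinuscule T.lamTri) :
    (∃! φ : Cartanification.LocalHom T.Wlocal T.𝓑Wlocal,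
      (∀ i, φ.neg (T.Wf0 i) = T.𝓑Wf0h (T.idx i)) ∧
      (∀ i, φ.zero (T.We i) = T.𝓑We i) ∧
      (∀ i, φ.zero (T.Wf i) = T.𝓑Wf i) ∧
      (∀ i, φ.zero (T.Wh i) = T.𝓑Wh i) ∧
      φ.pos T.We0 = T.𝓑We0) ∧
    (∀ R, T.RelW R → T.evalW R = 0) := by
  exact ⟨Cartanification.Triple.exists_unique_localHom hT, Cartanification.Triple.evalW_rel hT⟩
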